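/- Let $w:\mathbb Z\to[0,\infty)$ be non-decreasing and non-constant with $w(0)>0$. Let $(X(n))_{n\ge 0}$ be the nearest neighbour random walk on $\mathbb Z$ with $X(0)=0$ such that, with the oriented-edge local times $$\ell^{\pm}(n,k)=\#\{0\le i\le n-1:\ X(i)=k,\ X(i+1)=k\pm1\},\qquad n\ge 0,\ k\in\mathbb Z,$$ and $\mathcal F_n=\sigma(X(0),\dots,X(n))$, for all $n\ge 0$ almost surely $$\mathbf P\big(X(n+1)=X(n)\pm1\,\big|\,\mathcal F_n\big)=\frac{w(\mp\Delta_n)}{w(\Delta_n)+w(-\Delta_n)},\qquad \Delta_n=\ell^+(n,X(n))-\ell^-(n,X(n)).$$ For $j\in\mathbb Z$ and $r\in\{0,1,2,\dots\}$ let $$T^{\pm}_{j,r}=\min\{n\ge0:\ \ell^{\pm}(n,j)\ge r\}$$ be the inverse local times (with $\min\emptyset=\infty$). Let $x\in\mathbb R$ and $h>0$ be fixed. Then, for each choice of the sign $\pm$, $T^{\pm}_{\lfloor Ax\rfloor,\lfloor Ah\rfloor}$ is almost surely finite for every real $A>0$, and $$A^{-2}\,T^{\pm}_{\lfloor Ax\rfloor,\lfloor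 Ah\rfloor}\longrightarrow(|x|+2h)^2\quad\text{in probability, as } A\to\infty.$$ -/

import Mathlib

open MeasureTheory ProbabilityTheory Filter Topology

namespace OrientedSelfRepelling

/-- Local time on oriented edges: the number of `0 ≤ i ≤ n - 1` such that the path `p` jumps from
`k` to `k + s` at its step from time `i` to time `i + 1`. The sign `s : ℤˣ` is `1` or `-1`. -/
def orientedLocalTime (s : ℤˣ) (p : ℕ → ℤ) (n : ℕ) (k : ℤ) : ℕ :=
  ((Finset.range n).filter fun i => p i = k ∧ p (i + 1) = k + (s : ℤ)).card

/-- The difference `ℓ⁺(n, p n) - ℓ⁻(n, p n)` of the local times at time `n` on the two edges that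
point away from the present position. -/
def localTimeDiff (p : ℕ → ℤ) (n : ℕ) : ℤ :=
  (orientedLocalTime 1 p n (p n) : ℤ) - (orientedLocalTime (-1) p n (p n) : ℤ)

/-- The probability `w(∓d) / (w(d) + w(-d))` of a jump of sign `s = ±1`, where `d` is the
difference of the local times at the present position. -/
noncomputable def stepProb (w : ℤ → ℝ) (s : ℤˣ) (d : ℤ) : ℝ :=
  w (-(s : ℤ) * d) / (w d + w (-d))

/-- A weight function: nonnegative, non-decreasing and non-constant, and positive at `0`
(equivalently, all the denominators `w d + w (-d)` are positive). -/
structure IsWeight (w : ℤ → ℝ) : Prop where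
  nonneg : ∀ z, 0 ≤ w z
  pos_zero : 0 < w 0
  mono : Monotone w
  nonconst : ∃ a b, w a ≠ w b

/-- `X` is the self-repelling random walk with weight function `w`, started from `0`: conditionally
on its past up to time `n`, it jumps by `s = ±1` with probability `stepProb w s d`, where `d` is
the current difference of the local times at its position. -/
structure IsSelfRepellingWalk {Ω : Type*} [MeasurableSpace Ω] (μ : Measure Ω) (w : ℤ → ℝ)
    (X : ℕ → Ω → ℤ) : Prop where
  measurable : ∀ n, Measurable (X n)
  start : ∀ᵐ ω ∂μ, X 0 ω = 0
  step : ∀ (n : ℕ) (s : ℤˣ),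
    μ⟦{ω | X (n + 1) ω = X n ω + (s : ℤ)} |
        Filtration.natural X (fun i => (measurable i).stronglyMeasurable) n⟧
      =ᵐ[μ] fun ω => stepProb w s (localTimeDiff (fun i => X i ω) n)

/-- The inverse local time `min {n ≥ 0 : ℓ^s(n, j) ≥ r}`, equal to `⊤` if there is no such `n`. -/
noncomputable def inverseLocalTime (s : ℤˣ) (p : ℕ → ℤ) (j : ℤ) (r : ℕ) : ℕ∞ :=
  ⨅ (n : ℕ) (_ : r ≤ orientedLocalTime s p n j), (n : ℕ∞)

end OrientedSelfRepelling

/-!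
The walk is realised by stacks of instructions: every site `k` carries independent signs indexed by
the numbers `(u, d)` of earlier upward and downward departures from `k`, the sign at `(u, d)` being
upward with probability `w (d - u) / (w (u - d) + w (d - u))`. A walker who obeys the stacks uses no
instruction twice, so its path has the law of any self-repelling walk (`isWalkLaw_map_walk`,
`IsWalkLaw.unique`).

At a single site the excess of upward over downward instructions is a nearest neighbour chain on `ℤ`
with drift towards `0`, whose tails are geometric, uniformly in time, and monotone along times of
equal parity (`exists_absTail_le`, `absTail_le_add_two`). Hence the number `upsBefore` of upward
departures before the `n`-th downward one is `n` plus an error with bounded second moment, whose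
mean is at least `-1 / 2` and tends to `-1 / 2` as `n → ∞`: in the limit the error has a law which
is symmetric about `-1 / 2`. The tails of `upsBefore` are tails of the chain at deterministic times,
and this reduces both facts about the mean to a telescoping comparison of tails.

At the time of the `r`-th jump from `j` to `j + 1`, conservation of flow determines the local times
site by site. To the right of `j` and, after reflection, to the left of `j`, they form a Markov chain
`profile`, which moves by `n ↦ upsBefore n`, with one additional unit at each site between `j` and
the origin (`Follows.eq_profile`). The time is twice the sum of both profiles, up to an error which
is linear in `|j|` and `r` (`Follows.time_eq`). The profile has mean slope `1 / 2` at sites with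
the additional unit and `-1 / 2` at the others, until it dies; a second moment recursion keeps it
close to the piecewise linear `meanProfile` while the latter is positive
(`exists_lintegral_sq_profile_le`), and a Lyapunov function shows that it dies quickly afterwards
(`exists_tsum_lintegral_profile_le`). The areas below the two approximations add up to
`A ^ 2 * (|x| + 2 * h) ^ 2 / 2` to leading order (`sum_meanProfile`, `tendsto_meanTime`), so the
scaled time converges in mean and hence in probability. Jumps downwards are reduced to jumps upwards
by reflection.
-/

namespace OrientedSelfRepelling

/-! ### The signed local time of one site -/

/-- A bias: `p d` is the probability that a walker leaves a site upwards if the site was so far left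
`d` more times upwards than downwards. It is antisymmetric about `1 / 2` and pushes `d` back
to `0`. -/
structure IsBias (p : ℤ → ℝ) : Prop where
  nonneg : ∀ d, 0 ≤ p d
  symm : ∀ d, p (-d) = 1 - p d
  lt_half : ∃ b < (1 / 2 : ℝ), ∃ M : ℕ, ∀ d : ℤ, M ≤ d → p d ≤ b

lemma IsBias.le_one {p : ℤ → ℝ} (hp : IsBias p) (d : ℤ) : p d ≤ 1 := by
  have := hp.nonneg (-d)
  rw [hp.symm] at this
  linarith

/-- The transition operator of the nearest neighbour chain on `ℤ` that jumps from `d` to `d + 1`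
with probability `p d` and to `d - 1` with probability `1 - p d`. -/
def stepOp (p : ℤ → ℝ) (f : ℤ → ℝ) (d : ℤ) : ℝ := p d * f (d + 1) + (1 - p d) * f (d - 1)

section

variable {p : ℤ → ℝ}

lemma stepOp_mono (hp : IsBias p) {f g : ℤ → ℝ} (h : ∀ d, f d ≤ g d) (d : ℤ) :
    stepOp p f d ≤ stepOp p g d := by
  have h1 := hp.nonneg d
  have h2 := hp.le_one d
  have h3 : 0 ≤ 1 - p d := by linarith
  unfold stepOp
  gcongr <;> exact h _

lemma iterate_stepOp_mono (hp : IsBias p) (t : ℕ) {f g : ℤ → ℝ} (h : ∀ d, f d ≤ g d) (d : ℤ) :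
    (stepOp p)^[t] f d ≤ (stepOp p)^[t] g d := by
  induction t generalizing f g with
  | zero => exact h d
  | succ t ih => exact ih (stepOp_mono hp h)

lemma iterate_stepOp_add (t : ℕ) (f g : ℤ → ℝ) (d : ℤ) :
    (stepOp p)^[t] (fun d => f d + g d) d = (stepOp p)^[t] f d + (stepOp p)^[t] g d := by
  induction t generalizing f g with
  | zero => rfl
  | succ t ih =>
    rw [Function.iterate_succ_apply, Function.iterate_succ_apply, Function.iterate_succ_apply,
      ← ih]
    refine congrArg (fun g => (stepOp p)^[t] g d) (funext fun d => ?_)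
    simp only [stepOp]
    ring

lemma iterate_stepOp_affine (t : ℕ) (a K : ℝ) (f : ℤ → ℝ) (d : ℤ) :
    (stepOp p)^[t] (fun d => a * f d + K) d = a * (stepOp p)^[t] f d + K := by
  induction t generalizing f with
  | zero => rfl
  | succ t ih =>
    rw [Function.iterate_succ_apply, Function.iterate_succ_apply, ← ih]
    refine congrArg (fun g => (stepOp p)^[t] g d) (funext fun d => ?_)
    simp only [stepOp]
    ring

lemma stepOp_comp_neg (hp : IsBias p) (f : ℤ → ℝ) :
    stepOp p (fun d => f (-d)) = fun d => stepOp p f (-d) := by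
  ext d
  simp only [stepOp, hp.symm, neg_add, sub_eq_add_neg, neg_neg]
  rw [add_comm (-d) 1, add_comm (-d) (-1), add_comm 1 (-d), add_comm (-1) (-d)]
  ring

lemma iterate_stepOp_comp_neg (hp : IsBias p) (t : ℕ) (f : ℤ → ℝ) (d : ℤ) :
    (stepOp p)^[t] (fun d => f (-d)) d = (stepOp p)^[t] f (-d) := by
  induction t generalizing f with
  | zero => rfl
  | succ t ih =>
    rw [Function.iterate_succ_apply, Function.iterate_succ_apply, stepOp_comp_neg hp, ih]

/-- Started from `0`, the absolute value of the chain is stochastically nondecreasing along times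
of equal parity: even functions which are nondecreasing in steps of two on the positive half line
are preserved by the transition operator, and two steps from `0` cannot decrease them. -/
lemma iterate_stepOp_le_add_two (hp : IsBias p) (t : ℕ) {f : ℤ → ℝ} (heven : ∀ d, f (-d) = f d)
    (hmono : ∀ d, 0 ≤ d → f d ≤ f (d + 2)) :
    (stepOp p)^[t] f 0 ≤ (stepOp p)^[t + 2] f 0 := by
  have key : ∀ t : ℕ, (∀ d, (stepOp p)^[t] f (-d) = (stepOp p)^[t] f d) ∧
      ∀ d, 0 ≤ d → (stepOp p)^[t] f d ≤ (stepOp p)^[t] f (d + 2) := by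
    intro t
    induction t with
    | zero => exact ⟨heven, hmono⟩
    | succ t ih =>
      obtain ⟨he, hm⟩ := ih
      simp only [Function.iterate_succ_apply']
      set g := (stepOp p)^[t] f
      refine ⟨fun d => ?_, fun d hd => ?_⟩
      · have := congrFun (stepOp_comp_neg hp g) d
        simp only [he] at this
        exact this.symm
      · have h1 : g (d + 1) ≤ g (d + 2 + 1) := by
          have := hm (d + 1) (by omega)
          rwa [show d + 1 + 2 = d + 2 + 1 by ring] at this
        have h2 : g (d - 1) ≤ g (d + 1) := by
          rcases hd.eq_or_lt with rfl | hd
          · exact (he 1).le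
          · have := hm (d - 1) (by omega)
            rwa [show d - 1 + 2 = d + 1 by ring] at this
        have h3 := hp.nonneg d
        have h4 := hp.le_one d
        have h5 := hp.nonneg (d + 2)
        have h6 := hp.le_one (d + 2)
        simp only [stepOp]
        rw [show d + 2 - 1 = d + 1 by ring]
        nlinarith
  obtain ⟨he, hm⟩ := key t
  rw [Function.iterate_succ_apply', Function.iterate_succ_apply']
  set g := (stepOp p)^[t] f
  have h0 := hm 0 le_rfl
  have h3 := hp.nonneg 1
  have h4 := hp.le_one 1
  have h5 : stepOp p g (-1) = stepOp p g 1 := by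
    have := congrFun (stepOp_comp_neg hp g) 1
    simp only [he] at this
    exact this.symm
  have h6 : stepOp p (stepOp p g) 0 = stepOp p g 1 := by
    simp only [stepOp.eq_1 p (stepOp p g), zero_add, zero_sub, h5]
    ring
  rw [h6]
  simp only [stepOp]
  norm_num at h0 ⊢
  nlinarith

/-- `P(|D_t| ≥ i)` for the chain `D` with transition operator `stepOp p` and `D_0 = 0`. -/
def absTail (p : ℤ → ℝ) (t i : ℕ) : ℝ :=
  (stepOp p)^[t] (fun d => if (i : ℤ) ≤ |d| then 1 else 0) 0

lemma absTail_le_add_two (hp : IsBias p) (t i : ℕ) : absTail p t i ≤ absTail p (t + 2) i := by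
  refine iterate_stepOp_le_add_two hp t (fun d => by rw [abs_neg]) fun d hd => ?_
  rw [abs_of_nonneg hd, abs_of_nonneg (by omega)]
  split_ifs <;> first | omega | norm_num

/-- A geometric moment of the chain stays bounded, by a Foster-Lyapunov drift condition. -/
lemma exists_iterate_stepOp_pow_le (hp : IsBias p) :
    ∃ θ > (1 : ℝ), ∃ C, ∀ t, (stepOp p)^[t] (fun d => θ ^ d.natAbs) 0 ≤ C := by
  obtain ⟨b₀, hb₀, M, hM⟩ := hp.lt_half
  obtain ⟨b, hb, hb0, hbM⟩ : ∃ b < (1 / 2 : ℝ), 0 < b ∧ ∀ d : ℤ, M ≤ d → p d ≤ b :=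
    ⟨max b₀ (1 / 4), max_lt hb₀ (by norm_num), lt_max_of_lt_right (by norm_num),
      fun d hd => (hM d hd).trans (le_max_left _ _)⟩
  -- `θ = 1 / (2 b)` lies between the two roots `1` and `(1 - b) / b` of `b θ + (1 - b) / θ = 1`
  set θ : ℝ := 1 / (2 * b) with hθ
  have hθ1 : 1 < θ := by
    rw [hθ, lt_div_iff₀ (by positivity)]
    linarith
  have hbθ : b * θ = 1 / 2 := by rw [hθ]; field_simp
  set γ : ℝ := 1 / 2 + 2 * b * (1 - b) with hγ
  have hγ1 : γ < 1 := by nlinarith [sq_nonneg (b - 1 / 2), mul_pos (sub_pos.2 hb) (sub_pos.2 hb)]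
  have hγ0 : 0 < γ := by nlinarith
  set W : ℤ → ℝ := fun d => θ ^ d.natAbs with hW
  set K : ℝ := θ ^ (M + 1) with hK
  have hK0 : 0 < K := by positivity
  have drift_nat : ∀ n : ℕ, stepOp p W n ≤ γ * W n + K := by
    intro n
    have h1 := hp.nonneg n
    have h2 := hp.le_one n
    have e1 : W (n + 1) = θ ^ (n + 1) := by simp only [hW]; congr 1
    have e2 : W n = θ ^ n := by simp [hW]
    rcases lt_or_ge M n with hn | hn
    · obtain ⟨m, rfl⟩ : ∃ m, n = m + 1 := ⟨n - 1, by omega⟩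
      have e3 : W (((m + 1 : ℕ) : ℤ) - 1) = θ ^ m := by simp [hW]
      have h3 := hbM ((m + 1 : ℕ) : ℤ) (by exact_mod_cast hn.le)
      have hm : 0 < θ ^ m := by positivity
      simp only [stepOp]
      rw [e1, e2, e3]
      have e4 : γ * θ = b * θ * θ + (1 - b) := by
        rw [hγ]; linear_combination (2 * (1 - b) - θ) * hbθ
      have h5 : p ((m + 1 : ℕ) : ℤ) * θ ^ 2 + (1 - p ((m + 1 : ℕ) : ℤ)) ≤ γ * θ := by
        have h6 : 0 ≤ θ ^ 2 - 1 := by nlinarith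
        rw [e4]
        linarith [mul_le_mul_of_nonneg_right h3 h6]
      calc p ((m + 1 : ℕ) : ℤ) * θ ^ (m + 1 + 1) + (1 - p ((m + 1 : ℕ) : ℤ)) * θ ^ m
          = (p ((m + 1 : ℕ) : ℤ) * θ ^ 2 + (1 - p ((m + 1 : ℕ) : ℤ))) * θ ^ m := by ring
        _ ≤ γ * θ * θ ^ m := by gcongr
        _ = γ * θ ^ (m + 1) := by ring
        _ ≤ _ := by linarith
    · have b1 : W (n + 1) ≤ K := by
        rw [e1]; exact pow_le_pow_right₀ hθ1.le (by omega)
      have b2 : W ((n : ℤ) - 1) ≤ K := pow_le_pow_right₀ hθ1.le (by omega)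
      have b3 : 0 ≤ W n := by rw [e2]; positivity
      simp only [stepOp]
      nlinarith
  have heven : ∀ d, W (-d) = W d := fun d => by simp [hW]
  have drift : ∀ d, stepOp p W d ≤ γ * W d + K := by
    intro d
    obtain ⟨n, rfl | rfl⟩ := d.eq_nat_or_neg
    · exact drift_nat n
    · have := congrFun (stepOp_comp_neg hp W) n
      simp only [heven] at this
      rw [← this, heven]
      exact drift_nat n
  refine ⟨θ, hθ1, 1 + K / (1 - γ), fun t => ?_⟩
  have h1γ : 0 < 1 - γ := by linarith
  induction t with
  | zero => simp; positivity
  | succ t ih =>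
    rw [Function.iterate_succ_apply]
    refine (iterate_stepOp_mono hp t drift 0).trans ?_
    rw [iterate_stepOp_affine]
    calc γ * (stepOp p)^[t] W 0 + K ≤ γ * (1 + K / (1 - γ)) + K := by gcongr
      _ = γ + K / (1 - γ) := by field_simp; ring
      _ ≤ _ := by linarith

lemma exists_absTail_le (hp : IsBias p) :
    ∃ θ > (1 : ℝ), ∃ C, ∀ t i, absTail p t i ≤ C * (θ⁻¹) ^ i := by
  obtain ⟨θ, hθ, C, hC⟩ := exists_iterate_stepOp_pow_le hp
  refine ⟨θ, hθ, C, fun t i => ?_⟩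
  have hθ0 : 0 < θ := by linarith
  calc absTail p t i
      ≤ (stepOp p)^[t] (fun d => (θ⁻¹) ^ i * θ ^ d.natAbs + 0) 0 := by
        refine iterate_stepOp_mono hp t (fun d => ?_) 0
        split_ifs with h
        · rw [add_zero, inv_pow, inv_mul_eq_div, le_div_iff₀ (by positivity), one_mul]
          exact pow_le_pow_right₀ hθ.le (by rw [Int.abs_eq_natAbs] at h; omega)
        · positivity
    _ = (θ⁻¹) ^ i * (stepOp p)^[t] (fun d => θ ^ d.natAbs) 0 + 0 := iterate_stepOp_affine ..
    _ ≤ _ := by rw [add_zero, mul_comm]; gcongr; exact hC t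

end

/-! ### Stacks of instructions -/

/-- A configuration of stacks: the value at `(k, u, d)` is the instruction used by a walker at the
site `k` which has left it `u` times upwards and `d` times downwards: `true` sends it upwards. -/
abbrev Stacks := ℤ × ℕ × ℕ → Bool

/-- The law on `Bool` giving mass `a` to `true`; the number `a` is first projected to `[0, 1]`, so
that this is always a probability measure. -/
noncomputable def coin (a : ℝ) : Measure Bool :=
  ENNReal.ofReal (max 0 (min a 1)) • Measure.dirac true +
    ENNReal.ofReal (1 - max 0 (min a 1)) • Measure.dirac false

instance (a : ℝ) : IsProbabilityMeasure (coin a) := by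
  constructor
  have h1 : 0 ≤ max 0 (min a 1) := le_max_left _ _
  have h2 : 0 ≤ 1 - max 0 (min a 1) := by
    rw [sub_nonneg]
    exact max_le zero_le_one (min_le_right _ _)
  simp only [coin, Measure.coe_add, Measure.coe_smul, Pi.add_apply, Pi.smul_apply, measure_univ,
    smul_eq_mul, mul_one, ← ENNReal.ofReal_add h1 h2]
  simp

lemma coin_true {a : ℝ} (h0 : 0 ≤ a) (h1 : a ≤ 1) : coin a {true} = ENNReal.ofReal a := by
  simp [coin, min_eq_left h1, max_eq_right h0]

lemma coin_false {a : ℝ} (h0 : 0 ≤ a) (h1 : a ≤ 1) : coin a {false} = ENNReal.ofReal (1 - a) := by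
  simp [coin, min_eq_left h1, max_eq_right h0]

/-- The law of independent stack instructions, those at `(k, u, d)` pointing upwards with
probability `p (u - d)`. -/
noncomputable def stackLaw (p : ℤ → ℝ) : Measure Stacks :=
  Measure.infinitePi fun a => coin (p ((a.2.1 : ℤ) - a.2.2))

instance (p : ℤ → ℝ) : IsProbabilityMeasure (stackLaw p) := by
  unfold stackLaw; infer_instance

lemma comap_le_of_dependsOn {β : Type*} [MeasurableSpace β] {S : Set (ℤ × ℕ × ℕ)} {f : Stacks → β}
    (hf : Measurable f) (hS : DependsOn f S) : MeasurableSpace.comap f inferInstance ≤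
      ⨆ i ∈ S, MeasurableSpace.comap (fun ξ : Stacks => ξ i) inferInstance := by
  classical
  let π : Stacks → Stacks := fun ξ i => if i ∈ S then ξ i else false
  have h1 : f = f ∘ π := by
    ext ξ
    exact hS fun i hi => by simp [π, hi]
  have h2 : Measurable[⨆ i ∈ S, MeasurableSpace.comap (fun ξ : Stacks => ξ i) inferInstance]
      π := by
    refine @measurable_pi_lambda _ _ _ (_) _ _ fun i => ?_
    by_cases hi : i ∈ S
    · simp only [π, hi, if_true]
      rw [measurable_iff_comap_le]
      exact le_iSup₂ (f := fun i (_ : i ∈ S) =>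
        MeasurableSpace.comap (fun ξ : Stacks => ξ i) inferInstance) i hi
    · simp only [π, hi, if_false]
      exact @measurable_const _ _ _ (_) _
  rw [← measurable_iff_comap_le, h1]
  exact hf.comp h2

/-- Functions of disjoint sets of instructions are independent. -/
lemma indepFun_of_dependsOn (p : ℤ → ℝ) {β γ : Type*} [MeasurableSpace β] [MeasurableSpace γ]
    {S T : Set (ℤ × ℕ × ℕ)} (hST : Disjoint S T) {f : Stacks → β} {g : Stacks → γ}
    (hf : Measurable f) (hg : Measurable g) (hfS : DependsOn f S) (hgT : DependsOn g T) :
    IndepFun f g (stackLaw p) := by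
  have hind : iIndep (fun i => MeasurableSpace.comap (fun ξ : Stacks => ξ i) inferInstance)
      (stackLaw p) :=
    iIndepFun_infinitePi (X := fun _ b => b) (fun i => measurable_id)
  have := indep_iSup_of_disjoint (fun i => (measurable_pi_apply i).comap_le) hind hST
  rw [IndepFun_iff_Indep]
  exact indep_of_indep_of_le_left (indep_of_indep_of_le_right this
    (comap_le_of_dependsOn hg hgT)) (comap_le_of_dependsOn hf hfS)

lemma exists_factor_of_dependsOn {β : Type*} {S : Set (ℤ × ℕ × ℕ)} {f : Stacks → β}
    (hf : DependsOn f S) : ∃ F : (S → Bool) → β, f = fun ξ => F fun i => ξ i := by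
  classical
  refine ⟨fun x => f fun i => if h : i ∈ S then x ⟨i, h⟩ else false, funext fun ξ => ?_⟩
  exact hf fun i hi => by simp [hi]

lemma measurable_of_dependsOn {β : Type*} [MeasurableSpace β] {S : Set (ℤ × ℕ × ℕ)}
    (hS : S.Finite) {f : Stacks → β} (hf : DependsOn f S) : Measurable f := by
  obtain ⟨F, rfl⟩ := exists_factor_of_dependsOn hf
  have := hS.to_subtype
  exact (measurable_of_finite F).comp (by fun_prop)

lemma integrable_of_dependsOn (p : ℤ → ℝ) {S : Set (ℤ × ℕ × ℕ)} (hS : S.Finite)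
    {f : Stacks → ℝ} (hf : DependsOn f S) : Integrable f (stackLaw p) := by
  have hm := measurable_of_dependsOn hS hf
  obtain ⟨F, rfl⟩ := exists_factor_of_dependsOn hf
  have := hS.to_subtype
  obtain ⟨C, hC⟩ := (Set.finite_range fun x => ‖F x‖).bddAbove
  exact Integrable.of_bound hm.aestronglyMeasurable C
    (Eventually.of_forall fun ξ => hC ⟨_, rfl⟩)

lemma integral_instruction {p : ℤ → ℝ} (hp : IsBias p) (a : ℤ × ℕ × ℕ) (x y : ℝ) :
    ∫ ξ, (if ξ a then x else y) ∂stackLaw p =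
      p ((a.2.1 : ℤ) - a.2.2) * x + (1 - p ((a.2.1 : ℤ) - a.2.2)) * y := by
  have h0 := hp.nonneg ((a.2.1 : ℤ) - a.2.2)
  have h1 := hp.le_one ((a.2.1 : ℤ) - a.2.2)
  have hmp := measurePreserving_eval_infinitePi
    (fun a : ℤ × ℕ × ℕ => coin (p ((a.2.1 : ℤ) - a.2.2))) a
  have h2 := integral_map (μ := stackLaw p) hmp.measurable.aemeasurable
    (f := fun b : Bool => if b then x else y) (measurable_of_finite _).aestronglyMeasurable
  rw [← h2, stackLaw, hmp.map_eq, integral_fintype .of_finite]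
  simp [Measure.real, coin_true h0 h1, coin_false h0 h1, h0, h1]

/-! ### The walk in the stack of one site -/

/-- The instructions at the site `k`. -/
def site (ξ : Stacks) (k : ℤ) : ℕ → ℕ → Bool := fun u d => ξ (k, u, d)

/-- The number of upward instructions among the first `t` instructions that are used at a site
with instructions `η`. -/
def ups (η : ℕ → ℕ → Bool) : ℕ → ℕ
  | 0 => 0
  | t + 1 => ups η t + (η (ups η t) (t - ups η t)).toNat

lemma ups_le (η : ℕ → ℕ → Bool) (t : ℕ) : ups η t ≤ t := by
  induction t with
  | zero => rfl
  | succ t ih => exact Nat.add_le_add ih (Bool.toNat_le _)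

lemma ups_succ_le (η : ℕ → ℕ → Bool) (t : ℕ) : ups η (t + 1) ≤ ups η t + 1 :=
  Nat.add_le_add_left (Bool.toNat_le _) _

lemma dependsOn_ups (k : ℤ) (t : ℕ) :
    DependsOn (fun ξ => ups (site ξ k) t) {a | a.1 = k ∧ a.2.1 + a.2.2 < t} := by
  induction t with
  | zero => exact fun _ _ _ => rfl
  | succ t ih =>
    intro ξ ξ' h
    have h1 : ups (site ξ k) t = ups (site ξ' k) t :=
      ih fun i hi => h i ⟨hi.1, hi.2.trans (Nat.lt_succ_self t)⟩
    have h2 := ups_le (site ξ' k) t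
    have h3 : ξ (k, ups (site ξ' k) t, t - ups (site ξ' k) t) =
        ξ' (k, ups (site ξ' k) t, t - ups (site ξ' k) t) := by
      refine h _ ⟨rfl, ?_⟩
      show ups (site ξ' k) t + (t - ups (site ξ' k) t) < t + 1
      omega
    simp only [ups, site] at h1 h3 ⊢
    rw [h1, h3]

lemma finite_instructions (k : ℤ) (t : ℕ) :
    {a : ℤ × ℕ × ℕ | a.1 = k ∧ a.2.1 + a.2.2 < t}.Finite := by
  refine (((Set.finite_singleton k).prod ((Set.finite_Iio t).prod (Set.finite_Iio t)))).subset ?_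
  rintro ⟨a, b, c⟩ ⟨h1, h2⟩
  simp only [Set.mem_prod, Set.mem_singleton_iff, Set.mem_Iio] at h1 h2 ⊢
  exact ⟨h1, by omega, by omega⟩

lemma measurable_ups (k : ℤ) (t : ℕ) : Measurable fun ξ => ups (site ξ k) t :=
  measurable_of_dependsOn (finite_instructions k t) (dependsOn_ups k t)

lemma dependsOn_comp_ups {β : Type*} (k : ℤ) (t : ℕ) (f : ℕ → β) :
    DependsOn (fun ξ => f (ups (site ξ k) t)) {a | a.1 = k ∧ a.2.1 + a.2.2 < t} :=
  fun _ _ h => congrArg f (dependsOn_ups k t h)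

/-- The excess of upward over downward instructions used at a site is the chain with transition
operator `stepOp p`, since each instruction is used at most once. -/
lemma integral_ups {p : ℤ → ℝ} (hp : IsBias p) (k : ℤ) (t : ℕ) (f : ℤ → ℝ) :
    ∫ ξ, f (2 * ups (site ξ k) t - t) ∂stackLaw p = (stepOp p)^[t] f 0 := by
  induction t generalizing f with
  | zero => simp [ups]
  | succ t ih =>
    rw [Function.iterate_succ_apply, ← ih]
    have h1 : ∀ ξ : Stacks, f (2 * ups (site ξ k) (t + 1) - (t + 1 : ℕ)) =
        ∑ u ∈ Finset.range (t + 1), (if ups (site ξ k) t = u then (1 : ℝ) else 0) *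
          (if ξ (k, u, t - u) then f (2 * u - t + 1) else f (2 * u - t - 1)) := by
      intro ξ
      rw [Finset.sum_eq_single (ups (site ξ k) t)]
      · simp only [if_true, one_mul, ups, site]
        split_ifs with h
        · simp only [h, Bool.toNat_true]
          congr 1; push_cast; ring
        · simp only [Bool.not_eq_true] at h
          simp only [h, Bool.toNat_false]
          congr 1; push_cast; ring
      · intro u _ hu
        rw [if_neg (Ne.symm hu), zero_mul]
      · intro h
        exact absurd (Finset.mem_range.2 (Nat.lt_succ_of_le (ups_le _ _))) h
    have h2 : ∀ ξ : Stacks, stepOp p f (2 * ups (site ξ k) t - t) =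
        ∑ u ∈ Finset.range (t + 1), (if ups (site ξ k) t = u then (1 : ℝ) else 0) *
          stepOp p f (2 * u - t) := by
      intro ξ
      rw [Finset.sum_eq_single (ups (site ξ k) t)]
      · simp
      · intro u _ hu
        rw [if_neg (Ne.symm hu), zero_mul]
      · intro h
        exact absurd (Finset.mem_range.2 (Nat.lt_succ_of_le (ups_le _ _))) h
    have hd1 : ∀ u : ℕ, DependsOn (fun ξ : Stacks => if ups (site ξ k) t = u then (1 : ℝ) else 0)
        {a | a.1 = k ∧ a.2.1 + a.2.2 < t} :=
      fun u => dependsOn_comp_ups k t fun v => if v = u then (1 : ℝ) else 0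
    have hd2 : ∀ u : ℕ, DependsOn (fun ξ : Stacks =>
        if ξ (k, u, t - u) then f (2 * u - t + 1) else f (2 * u - t - 1)) {(k, u, t - u)} := by
      intro u ξ ξ' h
      simp only [h (k, u, t - u) rfl]
    have hi1 := fun u => integrable_of_dependsOn p (finite_instructions k t) (hd1 u)
    have hi2 := fun u => integrable_of_dependsOn p (Set.finite_singleton _) (hd2 u)
    have hind : ∀ u ∈ Finset.range (t + 1), IndepFun
        (fun ξ : Stacks => if ups (site ξ k) t = u then (1 : ℝ) else 0)
        (fun ξ : Stacks => if ξ (k, u, t - u) then f (2 * u - t + 1) else f (2 * u - t - 1))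
        (stackLaw p) := by
      intro u hu
      have hu' := Finset.mem_range.1 hu
      refine indepFun_of_dependsOn p ?_
        (measurable_of_dependsOn (finite_instructions k t) (hd1 u))
        (measurable_of_dependsOn (Set.finite_singleton _) (hd2 u)) (hd1 u) (hd2 u)
      rw [Set.disjoint_singleton_right]
      rintro ⟨-, h⟩
      simp only at h
      omega
    simp_rw [h1, h2]
    rw [integral_finsetSum _ fun u hu => ?_,
      integral_finsetSum _ fun u hu => (hi1 u).mul_const _]
    swap
    · exact (hind u hu).integrable_mul (hi1 u) (hi2 u)
    refine Finset.sum_congr rfl fun u hu => ?_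
    have hu' := Finset.mem_range.1 hu
    rw [integral_mul_const, (hind u hu).integral_fun_mul_eq_mul_integral
      (hi1 u).aestronglyMeasurable (hi2 u).aestronglyMeasurable, integral_instruction hp]
    congr 1
    have : ((u : ℤ) - ((t - u : ℕ) : ℤ)) = 2 * u - t := by omega
    simp only [this, stepOp]

/-! ### The number of upward steps before a given downward step -/

/-- The number of upward instructions used at a site with instructions `η` before its `n`-th
downward instruction (`0` if there are fewer than `n` of these). At the time `n + v` there were at
least `n` downward instructions if and only if there were at most `v` upward ones. -/
noncomputable def upsBefore (η : ℕ → ℕ → Bool) (n : ℕ) : ℕ := sInf {v | ups η (n + v) ≤ v}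

lemma ups_add_le (η : ℕ → ℕ → Bool) (t m : ℕ) : ups η (t + m) ≤ ups η t + m := by
  induction m with
  | zero => rfl
  | succ m ih => have := ups_succ_le η (t + m); rw [← add_assoc]; omega

lemma upsBefore_zero (η : ℕ → ℕ → Bool) : upsBefore η 0 = 0 :=
  Nat.sInf_eq_zero.2 (Or.inl (le_refl (ups η (0 + 0))))

lemma lt_upsBefore_iff {η : ℕ → ℕ → Bool} {n : ℕ} (h : ∃ v, ups η (n + v) ≤ v) (v : ℕ) :
    v < upsBefore η n ↔ v < ups η (n + v) := by
  constructor
  · intro hv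
    exact not_le.1 (Nat.notMem_of_lt_sInf (s := {v | ups η (n + v) ≤ v}) hv)
  · intro hv
    by_contra! hle
    have h1 : ups η (n + upsBefore η n) ≤ upsBefore η n := Nat.sInf_mem h
    have h2 := ups_add_le η (n + upsBefore η n) (v - upsBefore η n)
    rw [show n + upsBefore η n + (v - upsBefore η n) = n + v by omega] at h2
    omega

lemma measurable_upsBefore (k : ℤ) (n : ℕ) : Measurable fun ξ => upsBefore (site ξ k) n := by
  have h1 : ∀ v, MeasurableSet {ξ : Stacks | ups (site ξ k) (n + v) ≤ v} := fun v =>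
    measurable_ups k (n + v) measurableSet_Iic
  refine measurable_to_countable' fun v => ?_
  have : (fun ξ => upsBefore (site ξ k) n) ⁻¹' {v} =
      {ξ | (ups (site ξ k) (n + v) ≤ v ∧ ∀ u < v, ¬ ups (site ξ k) (n + u) ≤ u) ∨
        (v = 0 ∧ ∀ u, ¬ ups (site ξ k) (n + u) ≤ u)} := by
    ext ξ
    simp only [Set.mem_preimage, Set.mem_singleton_iff, Set.mem_ofPred_eq]
    constructor
    · rintro rfl
      by_cases h : ∃ v, ups (site ξ k) (n + v) ≤ v
      · exact Or.inl ⟨Nat.sInf_mem h, fun u hu =>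
          Nat.notMem_of_lt_sInf (s := {v | ups (site ξ k) (n + v) ≤ v}) hu⟩
      · push Not at h
        refine Or.inr ⟨Nat.sInf_eq_zero.2 (Or.inr ?_), fun u => not_le.2 (h u)⟩
        ext u
        simpa using h u
    · rintro (⟨h1, h2⟩ | ⟨rfl, h⟩)
      · refine le_antisymm (Nat.sInf_le h1) ?_
        by_contra! hlt
        exact h2 _ hlt (Nat.sInf_mem (s := {v | ups (site ξ k) (n + v) ≤ v}) ⟨v, h1⟩)
      · refine Nat.sInf_eq_zero.2 (Or.inr ?_)
        ext u
        simpa using h u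
  rw [this]
  have h2 : ∀ q : ℕ → Prop, MeasurableSet {ξ : Stacks | ∀ u, q u → ¬ ups (site ξ k) (n + u) ≤ u} := by
    intro q
    simp only [Set.ofPred_forall]
    exact MeasurableSet.iInter fun u => MeasurableSet.iInter fun _ => (h1 u).compl
  have h3 := h2 fun _ => True
  simp only [true_imp_iff] at h3
  exact ((h1 v).inter (h2 (· < v))).union ((MeasurableSet.const (v = 0)).inter h3)

lemma dependsOn_upsBefore (k : ℤ) (n : ℕ) :
    DependsOn (fun ξ => upsBefore (site ξ k) n) {a | a.1 = k} := by
  intro ξ ξ' h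
  have : site ξ k = site ξ' k := by
    funext u d
    exact h (k, u, d) rfl
  simp only [this]

section

variable {p : ℤ → ℝ}

lemma absTail_eq_two_mul (hp : IsBias p) (t : ℕ) {i : ℕ} (hi : 1 ≤ i) :
    absTail p t i = 2 * (stepOp p)^[t] (fun d => if (i : ℤ) ≤ d then 1 else 0) 0 := by
  have h1 := iterate_stepOp_comp_neg hp t (fun d => if (i : ℤ) ≤ d then 1 else 0) 0
  have h2 := iterate_stepOp_add (p := p) t (fun d => if (i : ℤ) ≤ d then 1 else 0)
    (fun d => if (i : ℤ) ≤ -d then 1 else 0) 0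
  rw [neg_zero] at h1
  rw [h1, ← two_mul] at h2
  rw [← h2, absTail]
  refine congrArg (fun f => (stepOp p)^[t] f 0) (funext fun d => ?_)
  simp only [le_abs]
  by_cases h3 : (i : ℤ) ≤ d
  · have h4 : ¬ (i : ℤ) ≤ -d := by omega
    simp [h3, h4]
  · simp [h3]

lemma real_le_excess (hp : IsBias p) (k : ℤ) (t : ℕ) {i : ℕ} (hi : 1 ≤ i) :
    (stackLaw p).real {ξ | (i : ℤ) ≤ 2 * ups (site ξ k) t - t} = absTail p t i / 2 := by
  have h := integral_ups hp k t (fun d => if (i : ℤ) ≤ d then 1 else 0)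
  rw [absTail_eq_two_mul hp t hi, mul_div_cancel_left₀ _ two_ne_zero, ← h,
    ← integral_indicator_one]
  · exact integral_congr_ae (Eventually.of_forall fun ξ => by simp [Set.indicator])
  · exact measurable_of_dependsOn (finite_instructions k t)
      (dependsOn_comp_ups k t fun u => (2 * u - t : ℤ)) measurableSet_Ici

lemma real_excess_le (hp : IsBias p) (k : ℤ) (t : ℕ) {i : ℕ} (hi : 1 ≤ i) :
    (stackLaw p).real {ξ | (i : ℤ) ≤ -(2 * ups (site ξ k) t - t)} = absTail p t i / 2 := by
  have h := integral_ups hp k t (fun d => if (i : ℤ) ≤ -d then 1 else 0)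
  have h1 := iterate_stepOp_comp_neg hp t (fun d => if (i : ℤ) ≤ d then 1 else 0) 0
  rw [neg_zero] at h1
  rw [absTail_eq_two_mul hp t hi, mul_div_cancel_left₀ _ two_ne_zero, ← h1, ← h,
    ← integral_indicator_one]
  · exact integral_congr_ae (Eventually.of_forall fun ξ => by simp [Set.indicator])
  · exact measurable_of_dependsOn (finite_instructions k t)
      (dependsOn_comp_ups k t fun u => -(2 * u - t : ℤ)) measurableSet_Ici

lemma tendsto_absTail (hp : IsBias p) (t : ℕ → ℕ) :
    Tendsto (fun j => absTail p (t j) (j + 1) / 2) atTop (𝓝 0) := by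
  obtain ⟨θ, hθ, C, hC⟩ := exists_absTail_le hp
  have h1 : Tendsto (fun j : ℕ => C * (θ⁻¹) ^ (j + 1) / 2) atTop (𝓝 0) := by
    have := (tendsto_pow_atTop_nhds_zero_of_lt_one (inv_nonneg.2 (by linarith))
      (inv_lt_one_of_one_lt₀ hθ)).comp (tendsto_add_atTop_nat 1)
    simpa using (this.const_mul C).div_const 2
  refine squeeze_zero (fun j => ?_) (fun j => ?_) h1
  · rw [← real_le_excess hp 0 (t j) (Nat.le_add_left 1 j)]
    exact measureReal_nonneg
  · gcongr
    exact hC _ _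

lemma ae_exists_ups_le (hp : IsBias p) :
    ∀ᵐ ξ ∂stackLaw p, ∀ (k : ℤ) (n : ℕ), ∃ v, ups (site ξ k) (n + v) ≤ v := by
  rw [ae_all_iff]
  intro k
  rw [ae_all_iff]
  intro n
  rw [ae_iff, ← measureReal_eq_zero_iff]
  refine le_antisymm (ge_of_tendsto' (tendsto_absTail hp fun j => n + (n + j)) fun j => ?_)
    measureReal_nonneg
  rw [← real_le_excess hp k _ (Nat.le_add_left 1 j)]
  refine measureReal_mono fun ξ hξ => ?_
  simp only [not_exists, not_le, Set.mem_ofPred_eq] at hξ ⊢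
  have := hξ (n + j)
  omega

/-- The upper tail of `upsBefore · n - n`. The event is decided at the deterministic time
`2 n + j`. -/
lemma real_lt_upsBefore (hp : IsBias p) (k : ℤ) (n j : ℕ) :
    (stackLaw p).real {ξ | n + j < upsBefore (site ξ k) n} = absTail p (2 * n + j) (j + 1) / 2 := by
  rw [← real_le_excess hp k _ (Nat.le_add_left 1 j)]
  refine measureReal_congr ?_
  filter_upwards [ae_exists_ups_le hp] with ξ hξ
  refine propext ?_
  show n + j < upsBefore (site ξ k) n ↔ ((j + 1 : ℕ) : ℤ) ≤ _
  rw [lt_upsBefore_iff (hξ k n), show n + (n + j) = 2 * n + j by ring]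
  omega

/-- The lower tail of `upsBefore · n - n`, which by the symmetry of the chain is an upper tail of
`upsBefore · m - m` with `m = n - (j + 1)`. -/
lemma real_upsBefore_add_lt (hp : IsBias p) (k : ℤ) (n j : ℕ) :
    (stackLaw p).real {ξ | upsBefore (site ξ k) n + (j + 1) < n} =
      absTail p (2 * (n - (j + 1)) + j) (j + 1) / 2 := by
  rcases le_or_gt n (j + 1) with hn | hn
  · have h0 : n - (j + 1) = 0 := by omega
    have h1 := real_lt_upsBefore hp k 0 j
    simp only [upsBefore_zero, not_lt_zero, Set.ofPred_false, measureReal_empty] at h1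
    rw [h0, ← h1]
    convert measureReal_empty
    ext ξ
    simp only [Set.mem_ofPred_eq, Set.mem_empty_iff_false, iff_false]
    omega
  · obtain ⟨m, rfl⟩ : ∃ m, n = m + j + 2 := ⟨n - (j + 2), by omega⟩
    rw [← real_excess_le hp k _ (Nat.le_add_left 1 j)]
    refine measureReal_congr ?_
    filter_upwards [ae_exists_ups_le hp] with ξ hξ
    refine propext ?_
    show upsBefore (site ξ k) (m + j + 2) + (j + 1) < m + j + 2 ↔ ((j + 1 : ℕ) : ℤ) ≤ _
    have h1 := lt_upsBefore_iff (hξ k (m + j + 2)) m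
    rw [show m + j + 2 + m = 2 * (m + j + 2 - (j + 1)) + j by omega] at h1
    omega

/-- Before the `n`-th downward step there are fewer than `n` upward ones if and only if downward
steps prevail at the odd time `2 n - 1`. -/
lemma real_upsBefore_lt (hp : IsBias p) (k : ℤ) {n : ℕ} (hn : 1 ≤ n) :
    (stackLaw p).real {ξ | upsBefore (site ξ k) n < n} = 1 / 2 := by
  have h1 : absTail p (2 * n - 1) 1 = 1 := by
    have h1 := real_le_excess hp k (2 * n - 1) le_rfl
    have h2 := real_excess_le hp k (2 * n - 1) le_rfl
    have h3 : {ξ | ((1 : ℕ) : ℤ) ≤ -(2 * ups (site ξ k) (2 * n - 1) - (2 * n - 1 : ℕ))} =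
        {ξ | ((1 : ℕ) : ℤ) ≤ (2 * ups (site ξ k) (2 * n - 1) - (2 * n - 1 : ℕ))}ᶜ := by
      ext ξ
      simp only [Set.mem_ofPred_eq, Set.mem_compl_iff]
      omega
    rw [h3, probReal_compl_eq_one_sub, h1] at h2
    · linarith
    · exact measurable_of_dependsOn (finite_instructions k _)
        (dependsOn_comp_ups k (2 * n - 1) fun u => (2 * u - (2 * n - 1 : ℕ) : ℤ)) measurableSet_Ici
  rw [← h1, ← real_excess_le hp k _ le_rfl]
  refine measureReal_congr ?_
  filter_upwards [ae_exists_ups_le hp] with ξ hξ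
  refine propext ?_
  show upsBefore (site ξ k) n < n ↔ ((1 : ℕ) : ℤ) ≤ _
  have h1 := lt_upsBefore_iff (hξ k n) (n - 1)
  rw [show n + (n - 1) = 2 * n - 1 by omega] at h1
  omega

end

/-! ### Mean and variance of the local time increments -/

section

variable {p : ℤ → ℝ}

lemma sum_range_odd (a : ℕ) : ∑ j ∈ Finset.range a, (2 * j + 1) = a ^ 2 := by
  induction a with
  | zero => rfl
  | succ a ih => rw [Finset.sum_range_succ, ih]; ring

lemma exists_real_lt_natAbs_le (hp : IsBias p) :
    ∃ κ, 0 ≤ κ ∧ κ < 1 ∧ ∃ D, 0 ≤ D ∧ ∀ (k : ℤ) (n j : ℕ),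
      (stackLaw p).real {ξ | j < ((upsBefore (site ξ k) n : ℤ) - n).natAbs} ≤ D * κ ^ j := by
  obtain ⟨θ, hθ, C, hC⟩ := exists_absTail_le hp
  have hκ0 : 0 ≤ θ⁻¹ := inv_nonneg.2 (by linarith)
  have hκ1 : θ⁻¹ < 1 := inv_lt_one_of_one_lt₀ hθ
  have hC' : ∀ t i, absTail p t i ≤ |C| * (θ⁻¹) ^ i := fun t i =>
    (hC t i).trans (by gcongr; exact le_abs_self C)
  refine ⟨θ⁻¹, hκ0, hκ1, |C| + 1, by positivity, fun k n j => ?_⟩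
  have h1 : (stackLaw p).real {ξ | j < ((upsBefore (site ξ k) n : ℤ) - n).natAbs} ≤
      (stackLaw p).real {ξ | n + j < upsBefore (site ξ k) n} +
        (stackLaw p).real {ξ | upsBefore (site ξ k) n + j < n} := by
    refine (measureReal_mono fun ξ hξ => ?_).trans (measureReal_union_le _ _)
    simp only [Set.mem_ofPred_eq, Set.mem_union] at hξ ⊢
    omega
  have h2 : (stackLaw p).real {ξ | n + j < upsBefore (site ξ k) n} ≤ |C| * (θ⁻¹) ^ j / 2 := by
    rw [real_lt_upsBefore hp]
    have h3 := hC' (2 * n + j) (j + 1)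
    have h4 : (θ⁻¹) ^ (j + 1) ≤ (θ⁻¹) ^ j := pow_le_pow_of_le_one hκ0 hκ1.le (Nat.le_succ j)
    have h5 := mul_le_mul_of_nonneg_left h4 (abs_nonneg C)
    linarith
  have h3 : (stackLaw p).real {ξ | upsBefore (site ξ k) n + j < n} ≤
      |C| * (θ⁻¹) ^ j / 2 + (θ⁻¹) ^ j := by
    rcases j with - | j
    · have : (stackLaw p).real {ξ | upsBefore (site ξ k) n + 0 < n} ≤ 1 := measureReal_le_one
      simp only [pow_zero, mul_one]
      linarith [abs_nonneg C]
    · rw [real_upsBefore_add_lt hp]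
      have h3 := hC' (2 * (n - (j + 1)) + j) (j + 1)
      have h4 : 0 ≤ (θ⁻¹) ^ (j + 1) := by positivity
      linarith
  linarith

lemma exists_lintegral_sq_le (hp : IsBias p) : ∃ C : ℝ, 0 ≤ C ∧ ∀ (k : ℤ) (n : ℕ),
    ∫⁻ ξ, ENNReal.ofReal (((upsBefore (site ξ k) n : ℝ) - n) ^ 2) ∂stackLaw p
      ≤ ENNReal.ofReal C := by
  obtain ⟨κ, hκ0, hκ1, D, hD, hb⟩ := exists_real_lt_natAbs_le hp
  have hs : Summable fun j : ℕ => (2 * (j : ℝ) + 1) * (D * κ ^ j) := by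
    have h1 := summable_pow_mul_geometric_of_norm_lt_one 1
      (show ‖κ‖ < 1 by rwa [Real.norm_of_nonneg hκ0])
    have h2 := summable_geometric_of_lt_one hκ0 hκ1
    refine ((h1.mul_left (2 * D)).add (h2.mul_left D)).congr fun j => ?_
    ring
  have hnn : ∀ j : ℕ, 0 ≤ (2 * (j : ℝ) + 1) * (D * κ ^ j) := fun j => by positivity
  refine ⟨∑' j : ℕ, (2 * (j : ℝ) + 1) * (D * κ ^ j), tsum_nonneg hnn, fun k n => ?_⟩
  have h1 : ∀ ξ : Stacks, ENNReal.ofReal (((upsBefore (site ξ k) n : ℝ) - n) ^ 2) =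
      ∑' j : ℕ, {ξ : Stacks | j < ((upsBefore (site ξ k) n : ℤ) - n).natAbs}.indicator
        (fun _ => ENNReal.ofReal (2 * (j : ℝ) + 1)) ξ := by
    intro ξ
    set a := ((upsBefore (site ξ k) n : ℤ) - n).natAbs with ha
    have h2 : ((upsBefore (site ξ k) n : ℝ) - n) ^ 2 = ∑ j ∈ Finset.range a, (2 * (j : ℝ) + 1) := by
      have h3 := sum_range_odd a
      have h4 : ((a ^ 2 : ℕ) : ℤ) = ((upsBefore (site ξ k) n : ℤ) - n) ^ 2 := by
        rw [Nat.cast_pow, ha, Int.natCast_natAbs, sq_abs]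
      rw [← h3] at h4
      have h5 := congrArg (fun z : ℤ => (z : ℝ)) h4
      push_cast at h5
      exact h5.symm
    rw [h2, ENNReal.ofReal_sum_of_nonneg fun j _ => by positivity,
      tsum_eq_sum (s := Finset.range a)]
    · refine Finset.sum_congr rfl fun j hj => ?_
      rw [Set.indicator_of_mem]
      exact Finset.mem_range.1 hj
    · intro j hj
      rw [Set.indicator_of_notMem]
      exact fun h => hj (Finset.mem_range.2 h)
  have hms : ∀ j : ℕ,
      MeasurableSet {ξ : Stacks | j < ((upsBefore (site ξ k) n : ℤ) - n).natAbs} := fun j =>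
    (measurable_from_nat (f := fun u : ℕ => ((u : ℤ) - n).natAbs)).comp
      (measurable_upsBefore k n) measurableSet_Ioi
  simp_rw [h1]
  rw [lintegral_tsum fun j => (measurable_const.indicator (hms j)).aemeasurable,
    ENNReal.ofReal_tsum_of_nonneg hnn hs]
  refine ENNReal.tsum_le_tsum fun j => ?_
  rw [lintegral_indicator_const (hms j), ENNReal.ofReal_mul (by positivity)]
  gcongr
  rw [← ofReal_measureReal]
  exact ENNReal.ofReal_le_ofReal (hb k n j)

/-- The increment of the local time from one site to the next. -/
noncomputable def increment (k : ℤ) (n : ℕ) (ξ : Stacks) : ℝ := (upsBefore (site ξ k) n : ℝ) - n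

lemma measurable_increment (k : ℤ) (n : ℕ) : Measurable (increment k n) :=
  (measurable_from_nat (f := fun u : ℕ => (u : ℝ) - n)).comp (measurable_upsBefore k n)

lemma increment_zero (k : ℤ) (ξ : Stacks) : increment k 0 ξ = 0 := by
  simp [increment, upsBefore_zero]

lemma exists_integral_increment_sq_le (hp : IsBias p) : ∃ C : ℝ, 0 ≤ C ∧ ∀ (k : ℤ) (n : ℕ),
    Integrable (increment k n) (stackLaw p) ∧
    Integrable (fun ξ => increment k n ξ ^ 2) (stackLaw p) ∧
    ∫ ξ, increment k n ξ ^ 2 ∂stackLaw p ≤ C := by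
  obtain ⟨C, hC, h⟩ := exists_lintegral_sq_le hp
  refine ⟨C, hC, fun k n => ?_⟩
  have hm := (measurable_increment k n).pow_const 2
  have hfin : ∫⁻ ξ, ENNReal.ofReal (increment k n ξ ^ 2) ∂stackLaw p < ⊤ :=
    (h k n).trans_lt ENNReal.ofReal_lt_top
  have hi : Integrable (fun ξ => increment k n ξ ^ 2) (stackLaw p) := by
    refine ⟨hm.aestronglyMeasurable, ?_⟩
    rwa [hasFiniteIntegral_iff_ofReal (Eventually.of_forall fun ξ => sq_nonneg _)]
  refine ⟨?_, hi, ?_⟩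
  · exact ((memLp_two_iff_integrable_sq (measurable_increment k n).aestronglyMeasurable).2
      hi).integrable one_le_two
  · rw [integral_eq_lintegral_of_nonneg_ae (Eventually.of_forall fun ξ => sq_nonneg _)
      hm.aestronglyMeasurable]
    exact ENNReal.toReal_le_of_le_ofReal hC (h k n)

lemma sum_range_lt (J a : ℕ) :
    ∑ j ∈ Finset.range J, (if j < a then (1 : ℝ) else 0) = min (J : ℝ) (a : ℝ) := by
  induction J with
  | zero => simp
  | succ J ih =>
    rw [Finset.sum_range_succ, ih]
    rcases lt_or_ge J a with h | h
    · rw [if_pos h, min_eq_left (by exact_mod_cast h.le), min_eq_left (by exact_mod_cast h)]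
      push_cast; ring
    · rw [if_neg (not_lt.2 h), min_eq_right (by exact_mod_cast h),
        min_eq_right (by exact_mod_cast h.trans (Nat.le_succ J)), add_zero]

/-- The sum of the first `J` upper tail indicators of `u - n`, minus the indicators of the first
`J + 1` lower tails; for large `J` this is `u - n`. -/
noncomputable def truncatedIncrement (k : ℤ) (n J : ℕ) (ξ : Stacks) : ℝ :=
  ∑ j ∈ Finset.range J, ({ξ : Stacks | n + j < upsBefore (site ξ k) n}.indicator 1 ξ -
    {ξ : Stacks | upsBefore (site ξ k) n + (j + 1) < n}.indicator 1 ξ) -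
    {ξ : Stacks | upsBefore (site ξ k) n < n}.indicator 1 ξ

lemma truncatedIncrement_eq (k : ℤ) (n J : ℕ) (ξ : Stacks) : truncatedIncrement k n J ξ =
    min (J : ℝ) ((upsBefore (site ξ k) n - n : ℕ) : ℝ) -
      min ((J + 1 : ℕ) : ℝ) ((n - upsBefore (site ξ k) n : ℕ) : ℝ) := by
  rw [← sum_range_lt, ← sum_range_lt, Finset.sum_range_succ', truncatedIncrement,
    Finset.sum_sub_distrib, sub_sub]
  congr 1
  · refine Finset.sum_congr rfl fun j _ => ?_
    by_cases h : n + j < upsBefore (site ξ k) n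
    · rw [Set.indicator_of_mem (by exact h), if_pos (by omega)]; rfl
    · rw [Set.indicator_of_notMem (by exact h), if_neg (by omega)]
  · congr 1
    · refine Finset.sum_congr rfl fun j _ => ?_
      by_cases h : upsBefore (site ξ k) n + (j + 1) < n
      · rw [Set.indicator_of_mem (by exact h), if_pos (by omega)]; rfl
      · rw [Set.indicator_of_notMem (by exact h), if_neg (by omega)]
    · by_cases h : upsBefore (site ξ k) n < n
      · rw [Set.indicator_of_mem (by exact h), if_pos (by omega)]; rfl
      · rw [Set.indicator_of_notMem (by exact h), if_neg (by omega)]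

lemma integral_truncatedIncrement (hp : IsBias p) (k : ℤ) {n : ℕ} (hn : 1 ≤ n) (J : ℕ) :
    Integrable (truncatedIncrement k n J) (stackLaw p) ∧
    ∫ ξ, truncatedIncrement k n J ξ ∂stackLaw p =
      ∑ j ∈ Finset.range J, (absTail p (2 * n + j) (j + 1) / 2 -
        absTail p (2 * (n - (j + 1)) + j) (j + 1) / 2) - 1 / 2 := by
  have hm : ∀ s : Set ℕ, MeasurableSet {ξ : Stacks | upsBefore (site ξ k) n ∈ s} := fun s =>
    measurable_upsBefore k n (MeasurableSet.of_discrete (s := s))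
  have m1 : ∀ j, MeasurableSet {ξ : Stacks | n + j < upsBefore (site ξ k) n} := fun j =>
    hm {u | n + j < u}
  have m2 : ∀ j, MeasurableSet {ξ : Stacks | upsBefore (site ξ k) n + (j + 1) < n} := fun j =>
    hm {u | u + (j + 1) < n}
  have m3 : MeasurableSet {ξ : Stacks | upsBefore (site ξ k) n < n} := hm {u | u < n}
  have hi : ∀ {s : Set Stacks}, MeasurableSet s →
      Integrable (fun ξ => s.indicator (1 : Stacks → ℝ) ξ) (stackLaw p) := fun hs =>
    (integrable_const (1 : ℝ)).indicator hs
  have hsum : Integrable (fun ξ => ∑ j ∈ Finset.range J,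
      ({ξ : Stacks | n + j < upsBefore (site ξ k) n}.indicator (1 : Stacks → ℝ) ξ -
      {ξ : Stacks | upsBefore (site ξ k) n + (j + 1) < n}.indicator (1 : Stacks → ℝ) ξ))
      (stackLaw p) :=
    integrable_finsetSum _ fun j _ => (hi (m1 j)).sub (hi (m2 j))
  refine ⟨hsum.sub (hi m3), ?_⟩
  simp only [truncatedIncrement]
  rw [integral_sub hsum (hi m3), integral_finsetSum _ fun j _ => ?_,
    integral_indicator_one m3, real_upsBefore_lt hp k hn]
  swap
  · exact (hi (m1 j)).sub (hi (m2 j))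
  congr 1
  refine Finset.sum_congr rfl fun j _ => ?_
  rw [integral_sub (hi (m1 j)) (hi (m2 j)), integral_indicator_one (m1 j),
    integral_indicator_one (m2 j), real_lt_upsBefore hp, real_upsBefore_add_lt hp]

lemma monotone_absTail (hp : IsBias p) (j : ℕ) :
    Monotone fun n => absTail p (2 * n + j) (j + 1) / 2 := by
  refine monotone_nat_of_le_succ fun n => ?_
  have := absTail_le_add_two hp (2 * n + j) (j + 1)
  rw [show 2 * (n + 1) + j = 2 * n + j + 2 by ring]
  linarith

lemma integral_increment_ge (hp : IsBias p) (k : ℤ) (n : ℕ) :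
    -(1 / 2) ≤ ∫ ξ, increment k n ξ ∂stackLaw p := by
  rcases Nat.eq_zero_or_pos n with rfl | hn
  · simp only [increment_zero, integral_zero]; norm_num
  obtain ⟨C, -, hC⟩ := exists_integral_increment_sq_le hp
  obtain ⟨h1, h2⟩ := integral_truncatedIncrement hp k hn n
  have h3 : ∫ ξ, truncatedIncrement k n n ξ ∂stackLaw p ≤ ∫ ξ, increment k n ξ ∂stackLaw p := by
    refine integral_mono h1 (hC k n).1 fun ξ => ?_
    rw [truncatedIncrement_eq, increment]
    rcases le_total n (upsBefore (site ξ k) n) with h | h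
    · rw [Nat.sub_eq_zero_of_le h, Nat.cast_zero, min_eq_right (Nat.cast_nonneg _), sub_zero,
        Nat.cast_sub h]
      exact min_le_right _ _
    · rw [Nat.sub_eq_zero_of_le h, Nat.cast_zero, min_eq_right (Nat.cast_nonneg _),
        min_eq_right (by exact_mod_cast (by omega)), Nat.cast_sub h]
      linarith
  refine le_trans ?_ h3
  rw [h2]
  have h4 : 0 ≤ ∑ j ∈ Finset.range n, (absTail p (2 * n + j) (j + 1) / 2 -
        absTail p (2 * (n - (j + 1)) + j) (j + 1) / 2) :=
    Finset.sum_nonneg fun j _ => sub_nonneg.2 (monotone_absTail hp j (Nat.sub_le _ _))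
  linarith

/-- The mean increment converges to `-1 / 2`: the upper tail at `j` has a limit as `n → ∞`, and the
lower tail at `j` is the upper tail for `n - j`, except that the lower tail at `0` has no
counterpart and contributes `-1 / 2`. -/
lemma exists_integral_increment_le (hp : IsBias p) {ε : ℝ} (hε : 0 < ε) :
    ∃ K, ∀ (k : ℤ) (n : ℕ), K ≤ n → ∫ ξ, increment k n ξ ∂stackLaw p ≤ -(1 / 2) + ε := by
  obtain ⟨C, hC0, hC⟩ := exists_integral_increment_sq_le hp
  obtain ⟨J, hJ⟩ := exists_nat_gt (C / (ε / 2))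
  have hJ0 : (0 : ℝ) < J := lt_of_le_of_lt (by positivity) hJ
  have hCJ : C / J ≤ ε / 2 := by
    rw [div_lt_iff₀ (by positivity)] at hJ
    rw [div_le_iff₀ hJ0]
    linarith
  have hlim : ∀ j, Tendsto (fun n => absTail p (2 * n + j) (j + 1) / 2 -
      absTail p (2 * (n - (j + 1)) + j) (j + 1) / 2) atTop (𝓝 0) := by
    intro j
    have hb : BddAbove (Set.range fun n => absTail p (2 * n + j) (j + 1) / 2) := by
      refine ⟨1, ?_⟩
      rintro _ ⟨n, rfl⟩
      simp only
      rw [← real_le_excess hp 0 (2 * n + j) (Nat.le_add_left 1 j)]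
      exact measureReal_le_one
    have h1 := tendsto_atTop_ciSup (monotone_absTail hp j) hb
    have h2 := h1.sub (h1.comp (tendsto_sub_atTop_nat (j + 1)))
    rw [sub_self] at h2
    exact h2
  have hlim2 := tendsto_finsetSum (Finset.range J) fun j _ => hlim j
  rw [Finset.sum_const_zero] at hlim2
  obtain ⟨K, hK⟩ := eventually_atTop.1 (hlim2.eventually (gt_mem_nhds (half_pos hε)))
  refine ⟨max K 1, fun k n hn => ?_⟩
  obtain ⟨h1, h2⟩ := integral_truncatedIncrement hp k ((le_max_right K 1).trans hn) J
  obtain ⟨i1, i2, i3⟩ := hC k n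
  have h3 : ∫ ξ, increment k n ξ ∂stackLaw p ≤
      ∫ ξ, (truncatedIncrement k n J ξ + increment k n ξ ^ 2 / J) ∂stackLaw p := by
    refine integral_mono i1 (h1.add (i2.div_const _)) fun ξ => ?_
    simp only
    rw [truncatedIncrement_eq, increment]
    rcases le_total n (upsBefore (site ξ k) n) with h | h
    · rw [Nat.sub_eq_zero_of_le h, Nat.cast_zero, min_eq_right (Nat.cast_nonneg _), sub_zero,
        Nat.cast_sub h]
      set y : ℝ := (upsBefore (site ξ k) n : ℝ) - n
      rcases le_total (J : ℝ) y with hy | hy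
      · have : y ≤ y ^ 2 / J := by
          rw [le_div_iff₀ hJ0]
          nlinarith
        rw [min_eq_left hy]
        linarith
      · rw [min_eq_right hy]
        have : 0 ≤ y ^ 2 / J := by positivity
        linarith
    · rw [Nat.sub_eq_zero_of_le h, Nat.cast_zero, min_eq_right (Nat.cast_nonneg _),
        Nat.cast_sub h]
      have h4 := min_le_right ((J + 1 : ℕ) : ℝ) ((n : ℝ) - upsBefore (site ξ k) n)
      have h5 : 0 ≤ ((upsBefore (site ξ k) n : ℝ) - n) ^ 2 / J := by positivity
      linarith
  rw [integral_add h1 (i2.div_const _), integral_div, h2] at h3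
  have h4 : (∫ ξ, increment k n ξ ^ 2 ∂stackLaw p) / J ≤ C / J := by gcongr
  have h5 := hK n ((le_max_left K 1).trans hn)
  linarith

end

/-! ### The profile chain -/

/-- The Markov chain that describes the local times along consecutive sites: the walker makes
`profile N z ξ i` downward steps from the site `i`, where the sites before `N` receive one
additional upward passage. -/
noncomputable def profile (N z : ℕ) (ξ : Stacks) : ℕ → ℕ
  | 0 => z
  | i + 1 => upsBefore (site ξ i) (profile N z ξ i) + if i < N then 1 else 0

/-- The deterministic approximation of `profile`, with slope `1 / 2` up to `N` and then `-1 / 2`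
until it reaches `0`. -/
noncomputable def meanProfile (N z : ℕ) : ℕ → ℝ
  | 0 => z
  | i + 1 => if i < N then meanProfile N z i + 1 / 2 else max (meanProfile N z i - 1 / 2) 0

lemma dependsOn_profile (N z i : ℕ) :
    DependsOn (fun ξ => profile N z ξ i) {a | a.1 < i} := by
  induction i with
  | zero => exact fun _ _ _ => rfl
  | succ i ih =>
    intro ξ ξ' h
    have h1 : profile N z ξ i = profile N z ξ' i := ih fun a ha => h a (by
      simp only [Set.mem_ofPred_eq] at ha ⊢
      omega)
    have h2 := dependsOn_upsBefore i (profile N z ξ' i) (x := ξ) (y := ξ') fun a ha => h a (by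
      simp only [Set.mem_ofPred_eq] at ha ⊢
      omega)
    simp only [profile]
    rw [h1]
    simp only at h2
    rw [h2]

lemma measurable_apply_nat {Ω β : Type*} [MeasurableSpace Ω] [MeasurableSpace β] {f : ℕ → Ω → β}
    (hf : ∀ n, Measurable (f n)) {Z : Ω → ℕ} (hZ : Measurable Z) :
    Measurable fun ω => f (Z ω) ω := by
  intro s hs
  have : (fun ω => f (Z ω) ω) ⁻¹' s = ⋃ n, Z ⁻¹' {n} ∩ f n ⁻¹' s := by
    ext ω
    simp
  rw [this]
  exact MeasurableSet.iUnion fun n => (hZ (measurableSet_singleton n)).inter (hf n hs)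

lemma measurable_profile (N z i : ℕ) : Measurable fun ξ => profile N z ξ i := by
  induction i with
  | zero => exact measurable_const
  | succ i ih =>
    exact (measurable_apply_nat (fun n => measurable_upsBefore i n) ih).add_const _

section

variable {p : ℤ → ℝ}

/-- The Markov property of the profile chain: the next step only uses instructions at a new
site. -/
lemma lintegral_profile_succ_le (p : ℤ → ℝ) (N z i : ℕ) {g G : ℕ → ENNReal}
    (h : ∀ n, ∫⁻ ξ, g (upsBefore (site ξ i) n + if i < N then 1 else 0) ∂stackLaw p ≤ G n) :
    ∫⁻ ξ, g (profile N z ξ (i + 1)) ∂stackLaw p ≤ ∫⁻ ξ, G (profile N z ξ i) ∂stackLaw p := by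
  set c := if i < N then 1 else 0
  set e : ℕ → ℕ → ENNReal := fun n m => if m = n then 1 else 0
  have hsplit : ∀ (G : ℕ → Stacks → ENNReal) (ξ : Stacks), G (profile N z ξ i) ξ =
      ∑' n, e n (profile N z ξ i) * G n ξ := by
    intro G ξ
    rw [tsum_eq_single (profile N z ξ i)]
    · simp [e]
    · intro n hn
      simp [e, Ne.symm hn]
  have hme : ∀ n, Measurable fun ξ => e n (profile N z ξ i) := fun n =>
    (measurable_from_nat (f := e n)).comp (measurable_profile N z i)
  have hmg : ∀ n, Measurable fun ξ => g (upsBefore (site ξ i) n + c) := fun n =>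
    (measurable_from_nat (f := fun u => g (u + c))).comp (measurable_upsBefore i n)
  have hd : ∀ n, IndepFun (fun ξ => e n (profile N z ξ i))
      (fun ξ => g (upsBefore (site ξ i) n + c)) (stackLaw p) := by
    intro n
    refine indepFun_of_dependsOn p ?_ (hme n) (hmg n)
      (fun ξ ξ' h => congrArg (e n) (dependsOn_profile N z i h))
      (fun ξ ξ' h => congrArg (fun u => g (u + c)) (dependsOn_upsBefore i n h))
    rw [Set.disjoint_left]
    intro a h1 h2
    simp only [Set.mem_ofPred_eq] at h1 h2
    omega
  calc ∫⁻ ξ, g (profile N z ξ (i + 1)) ∂stackLaw p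
      = ∫⁻ ξ, ∑' n, e n (profile N z ξ i) * g (upsBefore (site ξ i) n + c) ∂stackLaw p :=
        lintegral_congr fun ξ => hsplit (fun n ξ => g (upsBefore (site ξ i) n + c)) ξ
    _ = ∑' n, (∫⁻ ξ, e n (profile N z ξ i) ∂stackLaw p) *
          ∫⁻ ξ, g (upsBefore (site ξ i) n + c) ∂stackLaw p := by
        rw [lintegral_tsum fun n => ?_]
        swap
        · exact ((hme n).mul (hmg n)).aemeasurable
        refine tsum_congr fun n => ?_
        exact lintegral_mul_eq_lintegral_mul_lintegral_of_indepFun'' (hme n).aemeasurable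
          (hmg n).aemeasurable (hd n)
    _ ≤ ∑' n, (∫⁻ ξ, e n (profile N z ξ i) ∂stackLaw p) * G n :=
        ENNReal.tsum_le_tsum fun n => by gcongr; exact h n
    _ = ∫⁻ ξ, ∑' n, e n (profile N z ξ i) * G n ∂stackLaw p := by
        rw [lintegral_tsum fun n => ((hme n).mul_const _).aemeasurable]
        exact tsum_congr fun n => (lintegral_mul_const _ (hme n)).symm
    _ = ∫⁻ ξ, G (profile N z ξ i) ∂stackLaw p :=
        lintegral_congr fun ξ => (hsplit (fun n _ => G n) ξ).symm

/-! ### Mean square distance of the profile chain to its approximation -/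

lemma meanProfile_nonneg (N z i : ℕ) : 0 ≤ meanProfile N z i := by
  induction i with
  | zero => exact Nat.cast_nonneg z
  | succ i ih =>
    rw [meanProfile]
    split_ifs
    · linarith
    · exact le_max_right _ _

lemma integral_increment_le_of_sq {C : ℝ} {k : ℤ} {n : ℕ}
    (h1 : Integrable (increment k n) (stackLaw p))
    (h2 : Integrable (fun ξ => increment k n ξ ^ 2) (stackLaw p))
    (h3 : ∫ ξ, increment k n ξ ^ 2 ∂stackLaw p ≤ C) :
    ∫ ξ, increment k n ξ ∂stackLaw p ≤ (1 + C) / 2 := by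
  have h4 : ∫ ξ, increment k n ξ ∂stackLaw p ≤
      ∫ ξ, (1 / 2 + increment k n ξ ^ 2 / 2) ∂stackLaw p :=
    integral_mono h1 ((integrable_const _).add (h2.div_const 2)) fun ξ => by
      simp only
      nlinarith [sq_nonneg (increment k n ξ - 1)]
  rw [integral_add (integrable_const _) (h2.div_const 2), integral_const,
    integral_div, probReal_univ, one_smul] at h4
  linarith

/-- One step of the mean square estimate. If the chain is below its approximation then the drift
pushes it up, because the mean increments are at least `-1 / 2`; if it is above, then the drift
exceeds that of the approximation by at most `ε`, except at finitely many heights. -/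
lemma exists_integral_sq_step_le (hp : IsBias p) {ε : ℝ} (hε : 0 < ε) :
    ∃ D, 0 ≤ D ∧ ∀ (N z i n : ℕ) (A : ℝ), 0 < A →
      ∫⁻ ξ, ENNReal.ofReal (((upsBefore (site ξ i) n + if i < N then 1 else 0 : ℕ) -
        meanProfile N z (i + 1)) ^ 2) ∂stackLaw p ≤
      ENNReal.ofReal ((1 + ε / A) * ((n : ℝ) - meanProfile N z i) ^ 2 + (ε * A + D)) := by
  obtain ⟨C, hC0, hC⟩ := exists_integral_increment_sq_le hp
  obtain ⟨K, hK⟩ := exists_integral_increment_le hp hε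
  refine ⟨C + (1 + C) / 2 + 1 / 4 + 2 * K * ((1 + C) / 2 + 1 / 2), by positivity,
    fun N z i n A hA => ?_⟩
  obtain ⟨i1, i2, i3⟩ := hC i n
  set m := ∫ ξ, increment i n ξ ∂stackLaw p with hm
  have hm1 : m ≤ (1 + C) / 2 := integral_increment_le_of_sq i1 i2 i3
  have hm2 : -(1 / 2) ≤ m := integral_increment_ge hp i n
  have hz := meanProfile_nonneg N z i
  set x := meanProfile N z i with hx
  set c : ℕ := if i < N then 1 else 0 with hc
  -- `a` is the difference between the immigration and the increment of the approximation
  set a : ℝ := c - (meanProfile N z (i + 1) - x) with ha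
  have ha' : a = 1 / 2 ∨ (a = x ∧ x < 1 / 2) := by
    rw [ha, hc, meanProfile, ← hx]
    split_ifs
    · left; push_cast; ring
    · rcases le_or_gt (1 / 2) x with h | h
      · left; rw [max_eq_left (by linarith)]; push_cast; ring
      · right
        exact ⟨by rw [max_eq_right (by linarith)]; push_cast; ring, h⟩
  have ha0 : 0 ≤ a := by rcases ha' with h | ⟨h, -⟩ <;> rw [h] <;> linarith
  have ha1 : a ≤ 1 / 2 := by rcases ha' with h | ⟨h, h'⟩ <;> rw [h]; linarith
  set y : ℝ := n - x with hy
  have hsq : ∀ ξ, (((upsBefore (site ξ i) n + c : ℕ) : ℝ) - meanProfile N z (i + 1)) ^ 2 =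
      increment i n ξ ^ 2 + (2 * (y + a) * increment i n ξ + (y + a) ^ 2) := by
    intro ξ
    rw [increment, hy, ha]
    push_cast
    ring
  simp_rw [hsq]
  have hint2 : Integrable (fun ξ => 2 * (y + a) * increment i n ξ + (y + a) ^ 2) (stackLaw p) :=
    (i1.const_mul _).add (integrable_const _)
  have hint : Integrable (fun ξ => increment i n ξ ^ 2 +
      (2 * (y + a) * increment i n ξ + (y + a) ^ 2)) (stackLaw p) := i2.add hint2
  rw [← ofReal_integral_eq_lintegral_ofReal hint
    (Eventually.of_forall fun ξ => by
      simp only [Pi.zero_apply, ← hsq]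
      positivity)]
  refine ENNReal.ofReal_le_ofReal ?_
  rw [integral_add i2 hint2, integral_add (i1.const_mul _) (integrable_const _),
    integral_const_mul, ← hm]
  simp only [integral_const, probReal_univ, smul_eq_mul, one_mul]
  have h2am : 2 * a * m ≤ (1 + C) / 2 := by
    rcases le_or_gt m 0 with h | h
    · nlinarith
    · nlinarith
  have haa : a ^ 2 ≤ 1 / 4 := by nlinarith
  have hyA : 2 * y ≤ y ^ 2 / A + A := by
    rw [← sub_nonneg, show y ^ 2 / A + A - 2 * y = (y - A) ^ 2 / A by field_simp; ring]
    positivity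
  have hKC : 0 ≤ 2 * K * ((1 + C) / 2 + 1 / 2) := by positivity
  have hyA0 : 0 ≤ y ^ 2 / A + A := by positivity
  have cross : 2 * y * (m + a) ≤ ε * (y ^ 2 / A + A) + 2 * K * ((1 + C) / 2 + 1 / 2) := by
    have hεyA : 0 ≤ ε * (y ^ 2 / A + A) := mul_nonneg hε.le hyA0
    rcases lt_or_ge y 0 with hy0 | hy0
    · have : 2 * y * (m + a) ≤ 0 := by
        rcases ha' with h | ⟨h, h'⟩
        · rw [h]
          nlinarith
        · have hn0 : n = 0 := by
            have : (n : ℝ) < 1 := by linarith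
            exact_mod_cast Nat.lt_one_iff.1 (by exact_mod_cast this)
          have hm0 : m = 0 := by
            rw [hm, hn0]
            simp only [increment_zero, integral_zero]
          rw [hm0, zero_add]
          nlinarith
      linarith
    · have h1 : 2 * y * (m + a) ≤ 2 * y * (m + 1 / 2) := by gcongr
      rcases le_or_gt K n with hn | hn
      · have h2 : 2 * y * (m + 1 / 2) ≤ 2 * y * ε := by
          have := hK i n hn
          gcongr
          linarith
        nlinarith
      · have h2 : y ≤ K := by
          have : (n : ℝ) ≤ K := by exact_mod_cast hn.le
          linarith
        have h3 : 2 * y * (m + 1 / 2) ≤ 2 * K * ((1 + C) / 2 + 1 / 2) := by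
          have : 0 ≤ m + 1 / 2 := by linarith
          gcongr
        linarith
  have e1 : ε * (y ^ 2 / A + A) = ε / A * y ^ 2 + ε * A := by ring
  nlinarith

lemma exists_lintegral_sq_profile_le (hp : IsBias p) {ε : ℝ} (hε : 0 < ε) :
    ∃ D, 0 ≤ D ∧ ∀ (N z i : ℕ) (A : ℝ), 0 < A →
      ∫⁻ ξ, ENNReal.ofReal (((profile N z ξ i : ℝ) - meanProfile N z i) ^ 2) ∂stackLaw p ≤
      ENNReal.ofReal ((1 + ε / A) ^ i * (i * (ε * A + D))) := by
  obtain ⟨D, hD, h⟩ := exists_integral_sq_step_le hp hε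
  refine ⟨D, hD, fun N z i A hA => ?_⟩
  induction i with
  | zero => simp [profile, meanProfile]
  | succ i ih =>
    have hq : 1 ≤ 1 + ε / A := by
      have : 0 ≤ ε / A := by positivity
      linarith
    have hq0 : 0 ≤ 1 + ε / A := by linarith
    have hR : 0 ≤ ε * A + D := by positivity
    have hm : Measurable fun ξ => ENNReal.ofReal (((profile N z ξ i : ℝ) - meanProfile N z i) ^ 2) :=
      (measurable_from_nat (f := fun m : ℕ =>
        ENNReal.ofReal (((m : ℝ) - meanProfile N z i) ^ 2))).comp (measurable_profile N z i)
    calc ∫⁻ ξ, ENNReal.ofReal (((profile N z ξ (i + 1) : ℝ) - meanProfile N z (i + 1)) ^ 2)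
          ∂stackLaw p
        ≤ ∫⁻ ξ, ENNReal.ofReal ((1 + ε / A) * ((profile N z ξ i : ℝ) - meanProfile N z i) ^ 2 +
            (ε * A + D)) ∂stackLaw p :=
          lintegral_profile_succ_le p N z i
            (g := fun m => ENNReal.ofReal (((m : ℝ) - meanProfile N z (i + 1)) ^ 2))
            (G := fun n => ENNReal.ofReal ((1 + ε / A) * ((n : ℝ) - meanProfile N z i) ^ 2 +
              (ε * A + D))) fun n => h N z i n A hA
      _ = ∫⁻ ξ, (ENNReal.ofReal (1 + ε / A) *
            ENNReal.ofReal (((profile N z ξ i : ℝ) - meanProfile N z i) ^ 2) +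
            ENNReal.ofReal (ε * A + D)) ∂stackLaw p :=
          lintegral_congr fun ξ => by
            rw [ENNReal.ofReal_add (by positivity) hR, ENNReal.ofReal_mul hq0]
      _ = ENNReal.ofReal (1 + ε / A) * ∫⁻ ξ,
            ENNReal.ofReal (((profile N z ξ i : ℝ) - meanProfile N z i) ^ 2) ∂stackLaw p +
            ENNReal.ofReal (ε * A + D) := by
          rw [lintegral_add_right _ measurable_const, lintegral_const_mul _ hm]
          simp
      _ ≤ ENNReal.ofReal (1 + ε / A) * ENNReal.ofReal ((1 + ε / A) ^ i * (i * (ε * A + D))) +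
            ENNReal.ofReal (ε * A + D) := by gcongr
      _ = ENNReal.ofReal ((1 + ε / A) * ((1 + ε / A) ^ i * (i * (ε * A + D))) + (ε * A + D)) := by
          rw [← ENNReal.ofReal_mul hq0, ← ENNReal.ofReal_add (by positivity) hR]
      _ ≤ _ := by
          refine ENNReal.ofReal_le_ofReal ?_
          have h1 : 1 ≤ (1 + ε / A) ^ (i + 1) := one_le_pow₀ hq
          have h2 := mul_le_mul_of_nonneg_right h1 hR
          have h3 : (1 + ε / A) ^ (i + 1) * (((i + 1 : ℕ) : ℝ) * (ε * A + D)) =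
              (1 + ε / A) * ((1 + ε / A) ^ i * (i * (ε * A + D))) +
                (1 + ε / A) ^ (i + 1) * (ε * A + D) := by
            push_cast
            ring
          linarith

end

/-! ### Extinction of the profile chain -/

section

variable {p : ℤ → ℝ}

/-- The Lyapunov function `n ^ 2 + B (1 - 4 ^ (-n))` of the profile chain. The square decreases on
average at large heights; the bounded second term decreases at every positive height, because the
chain steps down with probability `1 / 2`. -/
noncomputable def lyapunov (B : ℝ) (n : ℕ) : ℝ := (n : ℝ) ^ 2 + B * (1 - (1 / 4) ^ n)

lemma lyapunov_nonneg {B : ℝ} (hB : 0 ≤ B) (n : ℕ) : 0 ≤ lyapunov B n := by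
  have : ((1 : ℝ) / 4) ^ n ≤ 1 := pow_le_one₀ (by norm_num) (by norm_num)
  have : 0 ≤ B * (1 - (1 / 4) ^ n) := mul_nonneg hB (by linarith)
  unfold lyapunov
  positivity

lemma lyapunov_le {B : ℝ} (hB : 0 ≤ B) (n : ℕ) : lyapunov B n ≤ (n : ℝ) ^ 2 + B := by
  have h1 : (0 : ℝ) ≤ (1 / 4) ^ n := by positivity
  unfold lyapunov
  nlinarith

lemma integrable_quarter_pow (k : ℤ) (n : ℕ) :
    Integrable (fun ξ => ((1 : ℝ) / 4) ^ upsBefore (site ξ k) n) (stackLaw p) := by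
  refine Integrable.of_bound ((measurable_from_nat (f := fun u : ℕ => ((1 : ℝ) / 4) ^ u)).comp
    (measurable_upsBefore k n)).aestronglyMeasurable 1 (Eventually.of_forall fun ξ => ?_)
  rw [Real.norm_of_nonneg (by positivity)]
  exact pow_le_one₀ (by norm_num) (by norm_num)

lemma le_integral_quarter_pow (hp : IsBias p) (k : ℤ) {n : ℕ} (hn : 1 ≤ n) :
    2 * (1 / 4) ^ n ≤ ∫ ξ, ((1 : ℝ) / 4) ^ upsBefore (site ξ k) n ∂stackLaw p := by
  have hm : MeasurableSet {ξ : Stacks | upsBefore (site ξ k) n < n} :=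
    measurable_upsBefore k n (measurableSet_Iio (a := n))
  have h1 : ∫ ξ, {ξ : Stacks | upsBefore (site ξ k) n < n}.indicator
      (fun _ => 4 * ((1 : ℝ) / 4) ^ n) ξ ∂stackLaw p ≤
      ∫ ξ, ((1 : ℝ) / 4) ^ upsBefore (site ξ k) n ∂stackLaw p := by
    refine integral_mono ((integrable_const _).indicator hm) (integrable_quarter_pow k n)
      fun ξ => ?_
    by_cases hξ : upsBefore (site ξ k) n < n
    swap
    · rw [Set.indicator_of_notMem (by exact hξ)]
      positivity
    rw [Set.indicator_of_mem (by exact hξ)]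
    have h2 : upsBefore (site ξ k) n ≤ n - 1 := Nat.le_sub_one_of_lt hξ
    have h3 : (4 : ℝ) * (1 / 4) ^ n = (1 / 4) ^ (n - 1) := by
      obtain ⟨m, rfl⟩ : ∃ m, n = m + 1 := ⟨n - 1, by omega⟩
      rw [Nat.add_sub_cancel, pow_succ]
      ring
    rw [h3]
    exact pow_le_pow_of_le_one (by norm_num) (by norm_num) h2
  rw [integral_indicator_const _ hm, real_upsBefore_lt hp k hn, smul_eq_mul] at h1
  linarith

lemma exists_lintegral_lyapunov_le (hp : IsBias p) : ∃ B, 0 ≤ B ∧ ∀ (k : ℤ) (n : ℕ),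
    (n : ℝ) / 4 ≤ lyapunov B n ∧
    ∫⁻ ξ, ENNReal.ofReal (lyapunov B (upsBefore (site ξ k) n)) ∂stackLaw p ≤
      ENNReal.ofReal (lyapunov B n - n / 4) := by
  obtain ⟨C, hC0, hC⟩ := exists_integral_increment_sq_le hp
  obtain ⟨K₀, hK₀⟩ := exists_integral_increment_le hp (show (0 : ℝ) < 1 / 4 by norm_num)
  obtain ⟨K, hK1, hK2⟩ : ∃ K : ℕ, K₀ ≤ K ∧ 4 * C ≤ K := by
    obtain ⟨K', hK'⟩ := exists_nat_ge (4 * C)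
    exact ⟨max K₀ K', le_max_left _ _, hK'.trans (by exact_mod_cast le_max_right _ _)⟩
  set E : ℝ := 2 * K * ((1 + C) / 2) + C + K / 4 with hE
  have hE0 : 0 ≤ E := by positivity
  refine ⟨4 ^ K * E, by positivity, fun k n => ?_⟩
  set B : ℝ := 4 ^ K * E with hB
  have hB0 : 0 ≤ B := by positivity
  have h14 : ((1 : ℝ) / 4) ^ n ≤ 1 := pow_le_one₀ (by norm_num) (by norm_num)
  refine ⟨?_, ?_⟩
  · rcases Nat.eq_zero_or_pos n with rfl | hn
    · simp [lyapunov]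
    · have h1 : (1 : ℝ) ≤ n := by exact_mod_cast hn
      have h2 : 0 ≤ B * (1 - (1 / 4) ^ n) := mul_nonneg hB0 (by linarith)
      unfold lyapunov
      nlinarith
  rcases Nat.eq_zero_or_pos n with rfl | hn
  · simp [upsBefore_zero]
  obtain ⟨i1, i2, i3⟩ := hC k n
  set m := ∫ ξ, increment k n ξ ∂stackLaw p with hm
  have hm1 : m ≤ (1 + C) / 2 := integral_increment_le_of_sq i1 i2 i3
  have i4 := integrable_quarter_pow (p := p) k n
  have hlin : Integrable (fun ξ => 2 * n * increment k n ξ + n ^ 2 + B) (stackLaw p) :=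
    ((i1.const_mul _).add (integrable_const _)).add (integrable_const _)
  have hfg : Integrable (fun ξ => increment k n ξ ^ 2 +
      (2 * n * increment k n ξ + n ^ 2 + B)) (stackLaw p) := i2.add hlin
  have hsq : ∀ ξ, lyapunov B (upsBefore (site ξ k) n) =
      increment k n ξ ^ 2 + (2 * n * increment k n ξ + n ^ 2 + B) -
        B * (1 / 4) ^ upsBefore (site ξ k) n := by
    intro ξ
    rw [increment, lyapunov]
    ring
  have hint : Integrable (fun ξ => lyapunov B (upsBefore (site ξ k) n)) (stackLaw p) := by
    simp_rw [hsq]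
    exact hfg.sub (i4.const_mul B)
  rw [← ofReal_integral_eq_lintegral_ofReal hint
    (Eventually.of_forall fun ξ => lyapunov_nonneg hB0 _)]
  refine ENNReal.ofReal_le_ofReal ?_
  simp_rw [hsq]
  have e1 : ∫ ξ, (2 * n * increment k n ξ + n ^ 2 + B) ∂stackLaw p = 2 * n * m + n ^ 2 + B := by
    simp_rw [add_assoc]
    rw [integral_add (i1.const_mul _) (integrable_const _), integral_const_mul]
    simp [hm]
  rw [integral_sub hfg (i4.const_mul B), integral_const_mul, integral_add i2 hlin, e1]
  have h4 := mul_le_mul_of_nonneg_left (le_integral_quarter_pow hp k hn) hB0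
  have hpos : 0 ≤ B * (1 / 4) ^ n := by positivity
  have hmain : C + 2 * n * m + n / 4 ≤ B * (1 / 4) ^ n := by
    rcases le_or_gt K n with hKn | hKn
    · have h5 : m ≤ -(1 / 4) := by
        have := hK₀ k n (hK1.trans hKn)
        linarith
      have h6 : (K : ℝ) ≤ n := by exact_mod_cast hKn
      have h7 : 2 * n * m ≤ 2 * n * (-(1 / 4)) := by gcongr
      linarith
    · have h6 : (n : ℝ) ≤ K := by exact_mod_cast hKn.le
      have h7 : 2 * n * m ≤ 2 * K * ((1 + C) / 2) := by
        have h8 : 2 * n * m ≤ 2 * n * ((1 + C) / 2) := by gcongr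
        have h9 : 2 * (n : ℝ) * ((1 + C) / 2) ≤ 2 * K * ((1 + C) / 2) := by gcongr
        linarith
      have h8 : E ≤ B * (1 / 4) ^ n := by
        have h9 : ((1 : ℝ) / 4) ^ K ≤ (1 / 4) ^ n :=
          pow_le_pow_of_le_one (by norm_num) (by norm_num) hKn.le
        have h10 : B * (1 / 4) ^ K = E := by
          rw [hB, mul_right_comm, ← mul_pow]
          norm_num
        rw [← h10]
        gcongr
      linarith
  rw [lyapunov]
  linarith

/-- After the immigration has stopped, the expected sum of the profile chain is controlled by its
present second moment. -/
lemma exists_tsum_lintegral_profile_le (hp : IsBias p) : ∃ B, 0 ≤ B ∧ ∀ (N z i : ℕ), N ≤ i →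
    ∑' l, ∫⁻ ξ, ENNReal.ofReal (profile N z ξ (i + l) : ℝ) ∂stackLaw p ≤
      4 * ∫⁻ ξ, ENNReal.ofReal ((profile N z ξ i : ℝ) ^ 2 + B) ∂stackLaw p := by
  obtain ⟨B, hB0, hB⟩ := exists_lintegral_lyapunov_le hp
  refine ⟨B, hB0, fun N z i hi => ?_⟩
  set V : ℕ → ENNReal := fun l =>
    ∫⁻ ξ, ENNReal.ofReal (lyapunov B (profile N z ξ (i + l))) ∂stackLaw p with hV
  set S : ℕ → ENNReal := fun l =>
    ∫⁻ ξ, ENNReal.ofReal (profile N z ξ (i + l) / 4 : ℝ) ∂stackLaw p with hS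
  have hmf : ∀ (f : ℕ → ℝ) (j : ℕ), Measurable fun ξ => ENNReal.ofReal (f (profile N z ξ j)) :=
    fun f j => (measurable_from_nat (f := fun n => ENNReal.ofReal (f n))).comp
      (measurable_profile N z j)
  have step : ∀ l, V (l + 1) + S l ≤ V l := by
    intro l
    have h1 : V (l + 1) ≤ ∫⁻ ξ, ENNReal.ofReal (lyapunov B (profile N z ξ (i + l)) -
        profile N z ξ (i + l) / 4) ∂stackLaw p := by
      refine lintegral_profile_succ_le p N z (i + l)
        (g := fun n => ENNReal.ofReal (lyapunov B n))
        (G := fun n => ENNReal.ofReal (lyapunov B n - n / 4)) fun n => ?_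
      rw [if_neg (by omega)]
      exact (hB _ n).2
    calc V (l + 1) + S l
        ≤ ∫⁻ ξ, ENNReal.ofReal (lyapunov B (profile N z ξ (i + l)) -
            profile N z ξ (i + l) / 4) ∂stackLaw p + S l := by gcongr
      _ = V l := by
          rw [hS, hV]
          simp only
          rw [← lintegral_add_right _ (hmf (fun n => (n : ℝ) / 4) (i + l))]
          refine lintegral_congr fun ξ => ?_
          rw [← ENNReal.ofReal_add (sub_nonneg.2 (hB 0 _).1) (by positivity), sub_add_cancel]
  have hsum : ∀ m, ∑ l ∈ Finset.range m, S l + V m ≤ V 0 := by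
    intro m
    induction m with
    | zero => simp
    | succ m ih =>
      rw [Finset.sum_range_succ, add_assoc, add_comm (S m)]
      exact (add_le_add_right (step m) _).trans ih
  have h4 : ∀ l, ∫⁻ ξ, ENNReal.ofReal (profile N z ξ (i + l) : ℝ) ∂stackLaw p = 4 * S l := by
    intro l
    rw [hS, ← lintegral_const_mul _ (hmf (fun n => (n : ℝ) / 4) (i + l))]
    refine lintegral_congr fun ξ => ?_
    rw [show (4 : ENNReal) = ENNReal.ofReal 4 by simp, ← ENNReal.ofReal_mul (by norm_num)]
    congr 1
    ring
  simp_rw [h4]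
  rw [ENNReal.tsum_mul_left]
  gcongr
  calc ∑' l, S l ≤ V 0 := by
        rw [ENNReal.tsum_eq_iSup_nat]
        exact iSup_le fun m => le_self_add.trans (hsum m)
    _ ≤ _ := lintegral_mono fun ξ => ENNReal.ofReal_le_ofReal (lyapunov_le hB0 _)

/-! ### The sum of the profile chain -/

lemma meanProfile_of_le {N z i : ℕ} (hi : i ≤ N) : meanProfile N z i = z + i / 2 := by
  induction i with
  | zero => simp [meanProfile]
  | succ i ih =>
    rw [meanProfile, if_pos (by omega), ih (by omega)]
    push_cast
    ring

lemma meanProfile_add (N z l : ℕ) : meanProfile N z (N + l) =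
    max ((z : ℝ) + N / 2 - l / 2) 0 := by
  induction l with
  | zero =>
    rw [add_zero, meanProfile_of_le le_rfl, Nat.cast_zero, zero_div, sub_zero,
      max_eq_left (by positivity)]
  | succ l ih =>
    rw [← add_assoc, meanProfile, if_neg (by omega), ih]
    push_cast
    rcases le_total (0 : ℝ) (z + N / 2 - l / 2) with h | h
    · rw [max_eq_left h]
      congr 1
      ring
    · rw [max_eq_right h, max_eq_right (by linarith), max_eq_right (by linarith)]

lemma meanProfile_eq_zero {N z i : ℕ} (hi : 2 * N + 2 * z ≤ i) : meanProfile N z i = 0 := by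
  obtain ⟨l, rfl⟩ : ∃ l, i = N + l := ⟨i - N, by omega⟩
  rw [meanProfile_add, max_eq_right]
  have : ((N + 2 * z : ℕ) : ℝ) ≤ l := by exact_mod_cast (by omega)
  push_cast at this
  linarith

lemma sum_meanProfile (N z : ℕ) : ∑ i ∈ Finset.range (2 * N + 2 * z), meanProfile N z i =
    z * N + N * (N - 1) / 4 + (2 * z + N) * (2 * z + N + 1) / 4 := by
  have h1 : ∀ n ≤ N, ∑ i ∈ Finset.range n, meanProfile N z i = z * n + n * (n - 1) / 4 := by
    intro n hn
    induction n with
    | zero => simp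
    | succ n ih =>
      rw [Finset.sum_range_succ, ih (by omega), meanProfile_of_le (by omega)]
      push_cast
      ring
  have h2 : ∀ l ≤ 2 * z + N, ∑ i ∈ Finset.range l, meanProfile N z (N + i) =
      (z + N / 2) * l - l * (l - 1) / 4 := by
    intro l hl
    induction l with
    | zero => simp
    | succ l ih =>
      rw [Finset.sum_range_succ, ih (by omega), meanProfile_add, max_eq_left]
      · push_cast
        ring
      · have : (l : ℝ) ≤ ((2 * z + N : ℕ) : ℝ) := by exact_mod_cast (by omega)
        push_cast at this
        linarith
  rw [show 2 * N + 2 * z = N + (2 * z + N) by ring, Finset.sum_range_add, h1 N le_rfl,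
    h2 _ le_rfl]
  push_cast
  ring

/-- The profile chain is close in mean to its deterministic approximation, summed over all sites. -/
lemma exists_tsum_lintegral_sub_le (hp : IsBias p) {ε : ℝ} (hε : 0 < ε) :
    ∃ D, 0 ≤ D ∧ ∀ N z : ℕ,
      ∑' i, ∫⁻ ξ, ENNReal.ofReal |(profile N z ξ i : ℝ) - meanProfile N z i| ∂stackLaw p ≤
        ENNReal.ofReal (ε * (N + z + 1) ^ 2 + D * (N + z + 1)) := by
  -- the errors are `19 δ A ^ 2` before and `72 δ ^ 2 A ^ 2` after the approximation vanishes
  obtain ⟨δ, hδ, hδ1, hδε⟩ : ∃ δ : ℝ, 0 < δ ∧ δ ≤ 1 ∧ 19 * δ + 72 * δ ^ 2 ≤ ε := by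
    refine ⟨min 1 (ε / 91), by positivity, min_le_left _ _, ?_⟩
    have h1 := min_le_left 1 (ε / 91)
    have h2 := min_le_right 1 (ε / 91)
    have h3 : 0 < min 1 (ε / 91) := by positivity
    nlinarith
  obtain ⟨D₁, hD₁, hsq⟩ := exists_lintegral_sq_profile_le hp (show 0 < δ ^ 2 by positivity)
  obtain ⟨B, hB, htail⟩ := exists_tsum_lintegral_profile_le hp
  refine ⟨18 * D₁ / δ + 72 * D₁ + 4 * B, by positivity, fun N z => ?_⟩
  set A : ℝ := N + z + 1 with hA
  have hA1 : 1 ≤ A := by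
    have h1 : (0 : ℝ) ≤ N := Nat.cast_nonneg N
    have h2 : (0 : ℝ) ≤ z := Nat.cast_nonneg z
    rw [hA]
    linarith
  have hA0 : 0 < A := by linarith
  set i₀ := 2 * N + 2 * z with hi₀
  have hi₀A : (i₀ : ℝ) ≤ 2 * A := by rw [hi₀, hA]; push_cast; linarith
  have hmf : ∀ (f : ℕ → ℝ) (j : ℕ), Measurable fun ξ => ENNReal.ofReal (f (profile N z ξ j)) :=
    fun f j => (measurable_from_nat (f := fun n => ENNReal.ofReal (f n))).comp
      (measurable_profile N z j)
  have hsq' : ∀ i ≤ i₀,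
      ∫⁻ ξ, ENNReal.ofReal (((profile N z ξ i : ℝ) - meanProfile N z i) ^ 2) ∂stackLaw p ≤
        ENNReal.ofReal (18 * A * (δ ^ 2 * A + D₁)) := by
    intro i hi
    refine (hsq N z i A hA0).trans (ENNReal.ofReal_le_ofReal ?_)
    have hiA : (i : ℝ) ≤ 2 * A := le_trans (by exact_mod_cast hi) hi₀A
    have h1 : (1 + δ ^ 2 / A) ^ i ≤ 9 := by
      have h2 : 1 + δ ^ 2 / A ≤ Real.exp (δ ^ 2 / A) := by
        rw [add_comm]; exact Real.add_one_le_exp _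
      calc (1 + δ ^ 2 / A) ^ i ≤ Real.exp (δ ^ 2 / A) ^ i := by gcongr
        _ = Real.exp (i * (δ ^ 2 / A)) := (Real.exp_nat_mul _ _).symm
        _ ≤ Real.exp 2 := by
          refine Real.exp_le_exp.2 ?_
          have h3 : δ ^ 2 ≤ 1 := pow_le_one₀ hδ.le hδ1
          rw [mul_div_assoc', div_le_iff₀ hA0]
          calc (i : ℝ) * δ ^ 2 ≤ 2 * A * 1 := by gcongr
            _ = 2 * A := mul_one _
        _ = Real.exp 1 ^ 2 := by rw [← Real.exp_nat_mul]; norm_num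
        _ ≤ 3 ^ 2 := by
          gcongr
          linarith [Real.exp_one_lt_d9]
        _ = 9 := by norm_num
    calc (1 + δ ^ 2 / A) ^ i * (i * (δ ^ 2 * A + D₁))
        ≤ 9 * (2 * A * (δ ^ 2 * A + D₁)) := by gcongr
      _ = _ := by ring
  have hhead : ∀ i ∈ Finset.range i₀,
      ∫⁻ ξ, ENNReal.ofReal |(profile N z ξ i : ℝ) - meanProfile N z i| ∂stackLaw p ≤
        ENNReal.ofReal (19 / 2 * δ * A + 9 * D₁ / δ) := by
    intro i hi
    have h1 : ∀ y : ℝ, |y| ≤ 1 / (2 * δ * A) * y ^ 2 + δ * A / 2 := by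
      intro y
      rw [← sub_nonneg, ← sq_abs y,
        show 1 / (2 * δ * A) * |y| ^ 2 + δ * A / 2 - |y| = (|y| - δ * A) ^ 2 / (2 * δ * A) by
          field_simp; ring]
      positivity
    calc ∫⁻ ξ, ENNReal.ofReal |(profile N z ξ i : ℝ) - meanProfile N z i| ∂stackLaw p
        ≤ ∫⁻ ξ, (ENNReal.ofReal (1 / (2 * δ * A)) *
            ENNReal.ofReal (((profile N z ξ i : ℝ) - meanProfile N z i) ^ 2) +
            ENNReal.ofReal (δ * A / 2)) ∂stackLaw p := by
          refine lintegral_mono fun ξ => ?_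
          rw [← ENNReal.ofReal_mul (by positivity), ← ENNReal.ofReal_add (by positivity)
            (by positivity)]
          exact ENNReal.ofReal_le_ofReal (h1 _)
      _ = ENNReal.ofReal (1 / (2 * δ * A)) *
            ∫⁻ ξ, ENNReal.ofReal (((profile N z ξ i : ℝ) - meanProfile N z i) ^ 2) ∂stackLaw p +
            ENNReal.ofReal (δ * A / 2) := by
          rw [lintegral_add_right _ measurable_const, lintegral_const_mul _
            (hmf (fun n => ((n : ℝ) - meanProfile N z i) ^ 2) i)]
          simp
      _ ≤ ENNReal.ofReal (1 / (2 * δ * A)) * ENNReal.ofReal (18 * A * (δ ^ 2 * A + D₁)) +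
            ENNReal.ofReal (δ * A / 2) := by
          gcongr
          exact hsq' i (Finset.mem_range.1 hi).le
      _ = ENNReal.ofReal (19 / 2 * δ * A + 9 * D₁ / δ) := by
          rw [← ENNReal.ofReal_mul (by positivity), ← ENNReal.ofReal_add (by positivity)
            (by positivity)]
          congr 1
          field_simp
          ring
  have htl : ∑' l, ∫⁻ ξ, ENNReal.ofReal
      |(profile N z ξ (l + i₀) : ℝ) - meanProfile N z (l + i₀)| ∂stackLaw p ≤
        ENNReal.ofReal (4 * (18 * A * (δ ^ 2 * A + D₁) + B)) := by
    have h0 : meanProfile N z i₀ = 0 := meanProfile_eq_zero le_rfl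
    calc ∑' l, ∫⁻ ξ, ENNReal.ofReal
          |(profile N z ξ (l + i₀) : ℝ) - meanProfile N z (l + i₀)| ∂stackLaw p
        = ∑' l, ∫⁻ ξ, ENNReal.ofReal (profile N z ξ (i₀ + l) : ℝ) ∂stackLaw p := by
          refine tsum_congr fun l => lintegral_congr fun ξ => ?_
          rw [add_comm l, meanProfile_eq_zero (by omega), sub_zero,
            abs_of_nonneg (Nat.cast_nonneg _)]
      _ ≤ 4 * ∫⁻ ξ, ENNReal.ofReal ((profile N z ξ i₀ : ℝ) ^ 2 + B) ∂stackLaw p :=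
          htail N z i₀ (by omega)
      _ = 4 * (∫⁻ ξ, ENNReal.ofReal (((profile N z ξ i₀ : ℝ) - meanProfile N z i₀) ^ 2)
            ∂stackLaw p + ENNReal.ofReal B) := by
          congr 1
          rw [h0]
          simp only [sub_zero]
          simp_rw [ENNReal.ofReal_add (sq_nonneg _) hB]
          rw [lintegral_add_right _ measurable_const]
          simp
      _ ≤ 4 * (ENNReal.ofReal (18 * A * (δ ^ 2 * A + D₁)) + ENNReal.ofReal B) := by
          gcongr
          exact hsq' i₀ le_rfl
      _ = _ := by
          rw [← ENNReal.ofReal_add (by positivity) hB,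
            show (4 : ENNReal) = ENNReal.ofReal 4 by simp, ← ENNReal.ofReal_mul (by norm_num)]
  rw [← ENNReal.summable.sum_add_tsum_nat_add' (k := i₀)]
  refine (add_le_add ((Finset.sum_le_card_nsmul _ _ _ hhead)) htl).trans ?_
  rw [Finset.card_range, nsmul_eq_mul, ← ENNReal.ofReal_natCast,
    ← ENNReal.ofReal_mul (Nat.cast_nonneg _), ← ENNReal.ofReal_add (by positivity) (by positivity)]
  refine ENNReal.ofReal_le_ofReal ?_
  have h1 : (i₀ : ℝ) * (19 / 2 * δ * A + 9 * D₁ / δ) ≤ 2 * A * (19 / 2 * δ * A + 9 * D₁ / δ) := by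
    gcongr
  have h2 : (19 * δ + 72 * δ ^ 2) * A ^ 2 ≤ ε * A ^ 2 := by gcongr
  have h3 : 4 * B ≤ 4 * B * A := le_mul_of_one_le_right (by positivity) hA1
  have h4 : 2 * A * (19 / 2 * δ * A + 9 * D₁ / δ) + 4 * (18 * A * (δ ^ 2 * A + D₁) + B) =
      (19 * δ + 72 * δ ^ 2) * A ^ 2 + (18 * D₁ / δ + 72 * D₁) * A + 4 * B := by ring
  linarith

end

/-! ### Paths driven by stacks -/

/-- The step of a walker that obeys the instruction `b`. -/
def stepOf (b : Bool) : ℤ := if b then 1 else -1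

/-- The path `q` starts from `0` and obeys the stacks `ξ`. -/
structure Follows (ξ : Stacks) (q : ℕ → ℤ) : Prop where
  start : q 0 = 0
  step : ∀ n, q (n + 1) = q n +
    stepOf (ξ (q n, orientedLocalTime 1 q n (q n), orientedLocalTime (-1) q n (q n)))

/-- The stacks seen from the site `a`. -/
def shift (a : ℤ) (ξ : Stacks) : Stacks := fun x => ξ (x.1 + a, x.2.1, x.2.2)

/-- The mirror image of the stacks at the origin. -/
def reflect (ξ : Stacks) : Stacks := fun x => !ξ (-x.1, x.2.2, x.2.1)

lemma orientedLocalTime_zero (s : ℤˣ) (q : ℕ → ℤ) (k : ℤ) : orientedLocalTime s q 0 k = 0 := rfl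

lemma orientedLocalTime_succ (s : ℤˣ) (q : ℕ → ℤ) (n : ℕ) (k : ℤ) :
    orientedLocalTime s q (n + 1) k =
      orientedLocalTime s q n k + if q n = k ∧ q (n + 1) = k + (s : ℤ) then 1 else 0 := by
  unfold orientedLocalTime
  rw [Finset.range_add_one, Finset.filter_insert]
  split_ifs
  · rw [Finset.card_insert_of_notMem (by simp)]
  · rfl

lemma orientedLocalTime_neg (s : ℤˣ) (q : ℕ → ℤ) (n : ℕ) (k : ℤ) :
    orientedLocalTime s (fun i => -q i) n k = orientedLocalTime (-s) q n (-k) := by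
  unfold orientedLocalTime
  congr 1
  refine Finset.filter_congr fun i _ => ?_
  show -q i = k ∧ -q (i + 1) = k + s ↔ q i = -k ∧ q (i + 1) = -k + ((-s : ℤˣ) : ℤ)
  rw [Units.val_neg]
  omega

lemma Follows.neg {ξ : Stacks} {q : ℕ → ℤ} (h : Follows ξ q) :
    Follows (reflect ξ) fun n => -q n := by
  refine ⟨by simp [h.start], fun n => ?_⟩
  have h1 := h.step n
  simp only [orientedLocalTime_neg, reflect, neg_neg]
  rw [h1]
  generalize ξ _ = b
  cases b <;> simp [stepOf] <;> ring

section

variable {ξ : Stacks} {q : ℕ → ℤ}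

lemma Follows.succ_cases (h : Follows ξ q) (n : ℕ) :
    (ξ (q n, orientedLocalTime 1 q n (q n), orientedLocalTime (-1) q n (q n)) = true ∧
      q (n + 1) = q n + 1 ∧
      (∀ k, orientedLocalTime 1 q (n + 1) k =
        orientedLocalTime 1 q n k + if k = q n then 1 else 0) ∧
      ∀ k, orientedLocalTime (-1) q (n + 1) k = orientedLocalTime (-1) q n k) ∨
    (ξ (q n, orientedLocalTime 1 q n (q n), orientedLocalTime (-1) q n (q n)) = false ∧
      q (n + 1) = q n - 1 ∧
      (∀ k, orientedLocalTime 1 q (n + 1) k = orientedLocalTime 1 q n k) ∧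
      ∀ k, orientedLocalTime (-1) q (n + 1) k =
        orientedLocalTime (-1) q n k + if k = q n then 1 else 0) := by
  have h1 := h.step n
  cases hb : ξ (q n, orientedLocalTime 1 q n (q n), orientedLocalTime (-1) q n (q n))
  · right
    simp only [hb, stepOf, Bool.false_eq_true, if_false] at h1
    refine ⟨rfl, h1, fun k => ?_, fun k => ?_⟩
    · rw [orientedLocalTime_succ, if_neg, add_zero]
      simp only [Units.val_one]
      omega
    · rw [orientedLocalTime_succ]
      congr 1
      refine if_congr ?_ rfl rfl
      simp only [Units.val_neg, Units.val_one]
      omega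
  · left
    simp only [hb, stepOf, if_true] at h1
    refine ⟨rfl, h1, fun k => ?_, fun k => ?_⟩
    · rw [orientedLocalTime_succ]
      congr 1
      refine if_congr ?_ rfl rfl
      simp only [Units.val_one]
      omega
    · rw [orientedLocalTime_succ, if_neg, add_zero]
      simp only [Units.val_neg, Units.val_one]
      omega

lemma Follows.ups_eq (h : Follows ξ q) (n : ℕ) (k : ℤ) :
    ups (site ξ k) (orientedLocalTime 1 q n k + orientedLocalTime (-1) q n k) =
      orientedLocalTime 1 q n k := by
  induction n with
  | zero => rfl
  | succ n ih =>
    have hstep : ups (site ξ k) (orientedLocalTime 1 q n k + orientedLocalTime (-1) q n k + 1) =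
        orientedLocalTime 1 q n k +
          (ξ (k, orientedLocalTime 1 q n k, orientedLocalTime (-1) q n k)).toNat := by
      rw [ups, ih, Nat.add_sub_cancel_left]
      rfl
    rcases h.succ_cases n with ⟨h1, -, h3, h4⟩ | ⟨h1, -, h3, h4⟩ <;> rw [h3, h4] <;>
      by_cases hk : k = q n
    · subst hk
      rw [if_pos rfl, show ∀ a b : ℕ, a + 1 + b = a + b + 1 by intros; ring, hstep, h1]
      rfl
    · rw [if_neg hk, add_zero, ih]
    · subst hk
      rw [if_pos rfl, ← add_assoc, hstep, h1]
      rfl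
    · rw [if_neg hk, add_zero, ih]

/-- Conservation of flow across the edge between `k` and `k + 1`. -/
lemma Follows.flow (h : Follows ξ q) (n : ℕ) (k : ℤ) :
    (orientedLocalTime 1 q n k : ℤ) + (if k < 0 then 1 else 0) =
      orientedLocalTime (-1) q n (k + 1) + if k < q n then 1 else 0 := by
  induction n with
  | zero => simp [orientedLocalTime_zero, h.start]
  | succ n ih =>
    rcases h.succ_cases n with ⟨-, h2, h3, h4⟩ | ⟨-, h2, h3, h4⟩ <;> rw [h3, h4, h2] <;>
      push_cast <;> split_ifs at ih ⊢ <;> omega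

lemma ups_mono (η : ℕ → ℕ → Bool) : Monotone (ups η) :=
  monotone_nat_of_le_succ fun _ => Nat.le_add_right _ _

/-- Every site has infinitely many downward instructions. -/
def Recurs (ξ : Stacks) : Prop := ∀ (k : ℤ) (n : ℕ), ∃ v, ups (site ξ k) (n + v) ≤ v

lemma upsBefore_mono (hr : Recurs ξ) (k : ℤ) : Monotone (upsBefore (site ξ k)) := by
  intro m n hmn
  refine le_of_forall_lt fun v hv => ?_
  rw [lt_upsBefore_iff (hr k _)] at hv ⊢
  exact hv.trans_le (ups_mono _ (by omega))

lemma Follows.le_upsBefore (h : Follows ξ q) (hr : Recurs ξ) (n : ℕ) (k : ℤ) :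
    orientedLocalTime 1 q n k ≤ upsBefore (site ξ k) (orientedLocalTime (-1) q n k + 1) := by
  by_contra! hlt
  have h1 := lt_upsBefore_iff (hr k (orientedLocalTime (-1) q n k + 1))
    (orientedLocalTime 1 q n k - 1)
  have h2 := h.ups_eq n k
  rw [show orientedLocalTime (-1) q n k + 1 + (orientedLocalTime 1 q n k - 1) =
    orientedLocalTime 1 q n k + orientedLocalTime (-1) q n k by omega, h2] at h1
  omega

/-- A site to the right of the walker was last left downwards, if at all. -/
lemma Follows.eq_upsBefore (h : Follows ξ q) (hr : Recurs ξ) (n : ℕ) {k : ℤ} (hk : q n < k) :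
    orientedLocalTime 1 q n k = upsBefore (site ξ k) (orientedLocalTime (-1) q n k) := by
  induction n with
  | zero => rw [orientedLocalTime_zero, orientedLocalTime_zero, upsBefore_zero]
  | succ n ih =>
    have hups := h.ups_eq (n + 1) k
    rcases h.succ_cases n with ⟨-, h2, h3, h4⟩ | ⟨-, h2, h3, h4⟩
    · rw [h3, h4, if_neg (by omega), add_zero]
      exact ih (by omega)
    · by_cases hkq : k = q n
      · have hle := h.le_upsBefore hr n k
        rw [h3, h4, if_pos hkq] at hups ⊢
        refine le_antisymm hle (not_lt.1 fun hlt => ?_)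
        rw [lt_upsBefore_iff (hr k _), add_comm, hups] at hlt
        exact lt_irrefl _ hlt
      · rw [h3, h4, if_neg hkq, add_zero]
        exact ih (by omega)

lemma Follows.le_upsBefore_reflect (h : Follows ξ q) (hr : Recurs (reflect ξ)) (n : ℕ) (k : ℤ) :
    orientedLocalTime (-1) q n k ≤
      upsBefore (site (reflect ξ) (-k)) (orientedLocalTime 1 q n k + 1) := by
  have := h.neg.le_upsBefore hr n (-k)
  rwa [orientedLocalTime_neg, orientedLocalTime_neg, neg_neg, neg_neg] at this

lemma Follows.eq_upsBefore_reflect (h : Follows ξ q) (hr : Recurs (reflect ξ)) (n : ℕ) {k : ℤ}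
    (hk : k < q n) : orientedLocalTime (-1) q n k =
      upsBefore (site (reflect ξ) (-k)) (orientedLocalTime 1 q n k) := by
  have := h.neg.eq_upsBefore hr n (k := -k) (by simpa using hk)
  rwa [orientedLocalTime_neg, orientedLocalTime_neg, neg_neg, neg_neg] at this

lemma Follows.abs_apply_le (h : Follows ξ q) (n : ℕ) : |q n| ≤ n := by
  induction n with
  | zero => simp [h.start]
  | succ n ih =>
    rw [abs_le] at ih ⊢
    rcases h.succ_cases n with ⟨-, h2, -⟩ | ⟨-, h2, -⟩ <;> rw [h2] <;> push_cast <;> omega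

/-- Time is the total local time. -/
lemma Follows.eq_sum (h : Follows ξ q) (j : ℤ) (M n : ℕ)
    (hM : ∀ i < n, j - M < q i ∧ q i ≤ j + M) :
    n = ∑ i ∈ Finset.range M, (orientedLocalTime (-1) q n (j + 1 + i) +
        orientedLocalTime 1 q n (j + 1 + i)) +
      ∑ i ∈ Finset.range M, (orientedLocalTime 1 q n (j - i) +
        orientedLocalTime (-1) q n (j - i)) := by
  induction n with
  | zero => simp [orientedLocalTime_zero]
  | succ n ih =>
    have ih' := ih fun i hi => hM i (by omega)
    have hq := hM n (Nat.lt_succ_self n)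
    have hk : ∀ k : ℤ, orientedLocalTime 1 q (n + 1) k + orientedLocalTime (-1) q (n + 1) k =
        orientedLocalTime 1 q n k + orientedLocalTime (-1) q n k + if k = q n then 1 else 0 := by
      intro k
      rcases h.succ_cases n with ⟨-, -, h3, h4⟩ | ⟨-, -, h3, h4⟩ <;> rw [h3, h4] <;> ring
    have hk' : ∀ k : ℤ, orientedLocalTime (-1) q (n + 1) k + orientedLocalTime 1 q (n + 1) k =
        orientedLocalTime (-1) q n k + orientedLocalTime 1 q n k + if k = q n then 1 else 0 := by
      intro k
      rw [add_comm, hk, add_comm (orientedLocalTime 1 q n k)]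
    simp_rw [hk, hk']
    simp only [Finset.sum_add_distrib] at ih' ⊢
    have hcount : ∑ i ∈ Finset.range M, (if j + 1 + (i : ℤ) = q n then 1 else 0) +
        ∑ i ∈ Finset.range M, (if j - (i : ℤ) = q n then 1 else 0) = 1 := by
      rcases le_or_gt (q n) j with hj | hj
      · rw [Finset.sum_eq_zero fun i _ => if_neg (by omega),
          Finset.sum_eq_single (j - q n).toNat (fun i _ hi => if_neg (by omega))
          (fun hi => absurd (Finset.mem_range.2 (by omega)) hi), if_pos (by omega)]
      · rw [Finset.sum_eq_single (q n - j - 1).toNat (fun i _ hi => if_neg (by omega))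
          (fun hi => absurd (Finset.mem_range.2 (by omega)) hi), if_pos (by omega),
          Finset.sum_eq_zero fun i _ => if_neg (by omega), add_zero]
    omega

/-- The profile to the right of `j` at the time of the `r`-th passage from `j` to `j + 1`. -/
noncomputable def rightProfile (j : ℤ) (r : ℕ) (ξ : Stacks) : ℕ → ℕ :=
  profile (-j - 1).toNat (if j < 0 then r else r - 1) (shift (j + 1) ξ)

/-- The profile to the left of `j` at the time of the `r`-th passage from `j` to `j + 1`. -/
noncomputable def leftProfile (j : ℤ) (r : ℕ) (ξ : Stacks) : ℕ → ℕ :=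
  profile j.toNat r (shift (-j) (reflect ξ))

lemma rightProfile_succ (j : ℤ) (r : ℕ) (ξ : Stacks) (i : ℕ) : rightProfile j r ξ (i + 1) =
    upsBefore (site ξ (j + 1 + i)) (rightProfile j r ξ i) + if j + 1 + i < 0 then 1 else 0 := by
  rw [rightProfile, profile]
  congr 1
  · rw [add_comm (j + 1)]
    rfl
  · exact if_congr (by omega) rfl rfl

lemma leftProfile_succ (j : ℤ) (r : ℕ) (ξ : Stacks) (i : ℕ) : leftProfile j r ξ (i + 1) =
    upsBefore (site (reflect ξ) (-(j - i))) (leftProfile j r ξ i) +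
      if (i : ℤ) < j then 1 else 0 := by
  rw [leftProfile, profile]
  congr 1
  · rw [show -(j - (i : ℤ)) = i + -j by ring]
    rfl
  · exact if_congr (by omega) rfl rfl

/-- Before the `r`-th passage from `j` to `j + 1`, the local times are bounded by the profiles. -/
lemma Follows.le_profile (h : Follows ξ q) (hr : Recurs ξ) (hr' : Recurs (reflect ξ)) {j : ℤ}
    {r n : ℕ} (hn : orientedLocalTime 1 q n j < r) (i : ℕ) :
    (orientedLocalTime (-1) q n (j + 1 + i) + (if j + 1 + i ≤ q n then 1 else 0) ≤
      rightProfile j r ξ i ∧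
    orientedLocalTime 1 q n (j + 1 + i) ≤ upsBefore (site ξ (j + 1 + i)) (rightProfile j r ξ i)) ∧
    (orientedLocalTime 1 q n (j - i) + (if q n ≤ j - i then 1 else 0) ≤ leftProfile j r ξ i ∧
    orientedLocalTime (-1) q n (j - i) ≤
      upsBefore (site (reflect ξ) (-(j - i))) (leftProfile j r ξ i)) := by
  have right : ∀ i : ℕ, orientedLocalTime (-1) q n (j + 1 + i) +
      (if j + 1 + i ≤ q n then 1 else 0) ≤ rightProfile j r ξ i →
      orientedLocalTime 1 q n (j + 1 + i) ≤
        upsBefore (site ξ (j + 1 + i)) (rightProfile j r ξ i) := by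
    intro i hi
    split_ifs at hi with hq
    · exact (h.le_upsBefore hr n _).trans (upsBefore_mono hr _ hi)
    · rw [h.eq_upsBefore hr n (not_le.1 hq)]
      exact upsBefore_mono hr _ hi
  have left : ∀ i : ℕ, orientedLocalTime 1 q n (j - i) +
      (if q n ≤ j - i then 1 else 0) ≤ leftProfile j r ξ i →
      orientedLocalTime (-1) q n (j - i) ≤
        upsBefore (site (reflect ξ) (-(j - i))) (leftProfile j r ξ i) := by
    intro i hi
    split_ifs at hi with hq
    · exact (h.le_upsBefore_reflect hr' n _).trans (upsBefore_mono hr' _ hi)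
    · rw [h.eq_upsBefore_reflect hr' n (not_le.1 hq)]
      exact upsBefore_mono hr' _ hi
  have right' : ∀ i : ℕ, orientedLocalTime (-1) q n (j + 1 + i) +
      (if j + 1 + i ≤ q n then 1 else 0) ≤ rightProfile j r ξ i := by
    intro i
    induction i with
    | zero =>
      have := h.flow n j
      rw [rightProfile, profile]
      push_cast
      rw [add_zero]
      split_ifs at this ⊢ <;> omega
    | succ i ih =>
      have h1 := right i ih
      have h2 := h.flow n (j + 1 + i)
      rw [rightProfile_succ]
      push_cast
      rw [← add_assoc]
      split_ifs at h2 ⊢ <;> omega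
  have left' : ∀ i : ℕ, orientedLocalTime 1 q n (j - i) +
      (if q n ≤ j - i then 1 else 0) ≤ leftProfile j r ξ i := by
    intro i
    induction i with
    | zero =>
      rw [leftProfile, profile]
      push_cast
      rw [sub_zero]
      split_ifs <;> omega
    | succ i ih =>
      have h1 := left i ih
      have h2 := h.flow n (j - (i + 1))
      rw [leftProfile_succ]
      push_cast
      rw [show j - ((i : ℤ) + 1) + 1 = j - i by ring] at h2
      split_ifs at h2 ⊢ <;> omega
  exact ⟨⟨right' i, right i (right' i)⟩, ⟨left' i, left i (left' i)⟩⟩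

/-- If both profiles have finite support then the edge from `j` to `j + 1` is passed `r` times,
since otherwise the total local time would stay bounded. -/
lemma Follows.exists_le (h : Follows ξ q) (hr : Recurs ξ) (hr' : Recurs (reflect ξ)) (j : ℤ)
    (r : ℕ) (hR : ∀ᶠ i in atTop, rightProfile j r ξ i = 0)
    (hL : ∀ᶠ i in atTop, leftProfile j r ξ i = 0) : ∃ n, r ≤ orientedLocalTime 1 q n j := by
  by_contra! hn
  obtain ⟨M, hM⟩ := eventually_atTop.1 (hR.and hL)
  obtain ⟨hM1, hM2⟩ := hM M le_rfl
  set B := ∑ i ∈ Finset.range M, (rightProfile j r ξ i +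
      upsBefore (site ξ (j + 1 + i)) (rightProfile j r ξ i)) +
    ∑ i ∈ Finset.range M, (leftProfile j r ξ i +
      upsBefore (site (reflect ξ) (-(j - i))) (leftProfile j r ξ i)) with hB
  have hle : B + 1 ≤ B := by
    conv_lhs => rw [h.eq_sum j M (B + 1) fun i _ => by
      obtain ⟨⟨h1, -⟩, ⟨h2, -⟩⟩ := h.le_profile hr hr' (hn i) M
      rw [hM1] at h1
      rw [hM2] at h2
      split_ifs at h1 h2 <;> omega]
    rw [hB]
    gcongr with i _ i _
    · exact (Nat.le_add_right _ _).trans (h.le_profile hr hr' (hn _) i).1.1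
    · exact (h.le_profile hr hr' (hn _) i).1.2
    · exact (Nat.le_add_right _ _).trans (h.le_profile hr hr' (hn _) i).2.1
    · exact (h.le_profile hr hr' (hn _) i).2.2
  omega

/-- The Ray-Knight description of the local times at the time of the `r`-th passage from `j` to
`j + 1`. -/
lemma Follows.eq_profile (h : Follows ξ q) (hr : Recurs ξ) (hr' : Recurs (reflect ξ)) {j : ℤ}
    {r n : ℕ} (hn : orientedLocalTime 1 q n j < r) (hn' : r ≤ orientedLocalTime 1 q (n + 1) j)
    (i : ℕ) :
    (orientedLocalTime (-1) q (n + 1) (j + 1 + i) = rightProfile j r ξ i ∧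
    orientedLocalTime 1 q (n + 1) (j + 1 + i) =
      upsBefore (site ξ (j + 1 + i)) (rightProfile j r ξ i)) ∧
    (orientedLocalTime 1 q (n + 1) (j - i) = leftProfile j r ξ i ∧
    orientedLocalTime (-1) q (n + 1) (j - i) =
      upsBefore (site (reflect ξ) (-(j - i))) (leftProfile j r ξ i)) := by
  obtain ⟨hqn, hq, hU, hUk, hDk⟩ : q n = j ∧ q (n + 1) = j + 1 ∧
      orientedLocalTime 1 q (n + 1) j = r ∧
      orientedLocalTime 1 q (n + 1) (j + 1) = orientedLocalTime 1 q n (j + 1) ∧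
      orientedLocalTime (-1) q (n + 1) (j + 1) = orientedLocalTime (-1) q n (j + 1) := by
    rcases h.succ_cases n with ⟨-, h2, h3, h4⟩ | ⟨-, h2, h3, h4⟩
    · have hj : j = q n := by
        by_contra hj
        rw [h3, if_neg hj] at hn'
        omega
      have h5 := h3 j
      rw [if_pos hj] at h5
      have h6 := h3 (j + 1)
      rw [if_neg (by omega)] at h6
      exact ⟨hj.symm, by omega, by omega, h6, h4 _⟩
    · rw [h3] at hn'
      omega
  have right : ∀ i : ℕ, orientedLocalTime 1 q (n + 1) (j + 1 + i) =
      upsBefore (site ξ (j + 1 + i)) (orientedLocalTime (-1) q (n + 1) (j + 1 + i)) := by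
    intro i
    rcases Nat.eq_zero_or_pos i with rfl | hi
    · rw [Nat.cast_zero, add_zero, hUk, hDk]
      exact h.eq_upsBefore hr n (by omega)
    · exact h.eq_upsBefore hr (n + 1) (by omega)
  have left : ∀ i : ℕ, orientedLocalTime (-1) q (n + 1) (j - i) =
      upsBefore (site (reflect ξ) (-(j - i))) (orientedLocalTime 1 q (n + 1) (j - i)) :=
    fun i => h.eq_upsBefore_reflect hr' (n + 1) (by omega)
  have right' : ∀ i : ℕ, orientedLocalTime (-1) q (n + 1) (j + 1 + i) = rightProfile j r ξ i := by
    intro i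
    induction i with
    | zero =>
      have := h.flow (n + 1) j
      rw [rightProfile, profile]
      push_cast
      rw [add_zero]
      split_ifs at this ⊢ <;> omega
    | succ i ih =>
      have h1 := right i
      have h2 := h.flow (n + 1) (j + 1 + i)
      rw [rightProfile_succ, ← ih, ← h1]
      push_cast
      rw [← add_assoc]
      split_ifs at h2 ⊢ <;> omega
  have left' : ∀ i : ℕ, orientedLocalTime 1 q (n + 1) (j - i) = leftProfile j r ξ i := by
    intro i
    induction i with
    | zero =>
      rw [leftProfile, profile]
      push_cast
      rw [sub_zero, hU]
    | succ i ih =>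
      have h1 := left i
      have h2 := h.flow (n + 1) (j - (i + 1))
      rw [leftProfile_succ, ← ih, ← h1]
      push_cast
      rw [show j - ((i : ℤ) + 1) + 1 = j - i by ring] at h2
      split_ifs at h2 ⊢ <;> omega
  exact ⟨⟨right' i, by rw [right, right']⟩, ⟨left' i, by rw [left, left']⟩⟩

/-- The time of the `r`-th passage from `j` to `j + 1` is twice the sum of both profiles, up to a
correction by their initial values and immigration. -/
lemma Follows.time_eq (h : Follows ξ q) (hr : Recurs ξ) (hr' : Recurs (reflect ξ)) {j : ℤ}
    {r n : ℕ} (hn : orientedLocalTime 1 q n j < r) (hn' : r ≤ orientedLocalTime 1 q (n + 1) j)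
    (hR : ∀ᶠ i in atTop, rightProfile j r ξ i = 0)
    (hL : ∀ᶠ i in atTop, leftProfile j r ξ i = 0) :
    ∀ᶠ M in atTop, n + 1 + ((if j < 0 then r else r - 1) + (-j - 1).toNat) + (r + j.toNat) =
      2 * ∑ i ∈ Finset.range M, rightProfile j r ξ i +
      2 * ∑ i ∈ Finset.range M, leftProfile j r ξ i := by
  have hprof := h.eq_profile hr hr' hn hn'
  have count : ∀ N M : ℕ, N ≤ M → ∑ i ∈ Finset.range M, (if i < N then 1 else 0) = N := by
    intro N M hNM
    rw [Finset.sum_boole, Nat.cast_id]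
    have : (Finset.range M).filter (· < N) = Finset.range N := by
      ext i
      simp only [Finset.mem_filter, Finset.mem_range]
      omega
    rw [this, Finset.card_range]
  have hsum : ∀ (N z : ℕ) (ζ : Stacks) (M : ℕ), N ≤ M → profile N z ζ M = 0 →
      ∑ i ∈ Finset.range M, upsBefore (site ζ i) (profile N z ζ i) + (z + N) =
        ∑ i ∈ Finset.range M, profile N z ζ i := by
    intro N z ζ M hNM h0
    have h1 := Finset.sum_range_succ' (profile N z ζ) M
    rw [Finset.sum_range_succ, h0] at h1
    simp only [profile] at h1
    rw [Finset.sum_add_distrib, count N M hNM] at h1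
    omega
  filter_upwards [hR, hL, eventually_ge_atTop (n + 1 + j.natAbs + 1)] with M hRM hLM hM
  have h1 := h.eq_sum j M (n + 1) fun i hi => by
    have := abs_le.1 (h.abs_apply_le i)
    omega
  simp only [(hprof _).1.1, (hprof _).1.2, (hprof _).2.1, (hprof _).2.2,
    Finset.sum_add_distrib] at h1
  have h2 := hsum (-j - 1).toNat (if j < 0 then r else r - 1) (shift (j + 1) ξ) M (by omega) hRM
  have h3 := hsum j.toNat r (shift (-j) (reflect ξ)) M (by omega) hLM
  have e1 : ∀ i : ℕ, upsBefore (site (shift (j + 1) ξ) i) (rightProfile j r ξ i) =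
      upsBefore (site ξ (j + 1 + i)) (rightProfile j r ξ i) := fun i => by
    rw [add_comm (j + 1)]; rfl
  have e2 : ∀ i : ℕ, upsBefore (site (shift (-j) (reflect ξ)) i) (leftProfile j r ξ i) =
      upsBefore (site (reflect ξ) (-(j - i))) (leftProfile j r ξ i) := fun i => by
    rw [show -(j - (i : ℤ)) = i + -j by ring]; rfl
  have h2' : ∑ i ∈ Finset.range M, upsBefore (site ξ (j + 1 + i)) (rightProfile j r ξ i) +
      ((if j < 0 then r else r - 1) + (-j - 1).toNat) =
      ∑ i ∈ Finset.range M, rightProfile j r ξ i := by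
    rw [← Finset.sum_congr rfl fun i _ => e1 i]
    exact h2
  have h3' : ∑ i ∈ Finset.range M, upsBefore (site (reflect ξ) (-(j - i))) (leftProfile j r ξ i) +
      (r + j.toNat) = ∑ i ∈ Finset.range M, leftProfile j r ξ i := by
    rw [← Finset.sum_congr rfl fun i _ => e2 i]
    exact h3
  omega

end

/-! ### The walk driven by random stacks -/

/-- The position of the walker that obeys the stacks `ξ`, together with the numbers of its upward
and downward departures from all sites. -/
def walkState (ξ : Stacks) : ℕ → ℤ × (ℤ → ℕ) × (ℤ → ℕ)
  | 0 => (0, fun _ => 0, fun _ => 0)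
  | n + 1 =>
    let y := walkState ξ n
    if ξ (y.1, y.2.1 y.1, y.2.2 y.1) then
      (y.1 + 1, fun k => y.2.1 k + (if k = y.1 then 1 else 0), y.2.2)
    else (y.1 - 1, y.2.1, fun k => y.2.2 k + (if k = y.1 then 1 else 0))

/-- The path of the walker that obeys the stacks `ξ`. -/
def walk (ξ : Stacks) (n : ℕ) : ℤ := (walkState ξ n).1

lemma walkState_eq (ξ : Stacks) (n : ℕ) :
    walkState ξ n = (walk ξ n, orientedLocalTime 1 (walk ξ) n, orientedLocalTime (-1) (walk ξ) n) := by
  induction n with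
  | zero => rfl
  | succ n ih =>
    have h1 : walkState ξ (n + 1) = _ := walkState.eq_2 ξ n
    have h2 : walk ξ (n + 1) = _ := congrArg Prod.fst h1
    simp only [ih] at h1 h2
    rw [h1]
    split_ifs at h2 ⊢ with hb
    · refine Prod.ext h2.symm (Prod.ext (funext fun k => ?_) (funext fun k => ?_))
      · simp only
        rw [orientedLocalTime_succ]
        congr 1
        refine if_congr ?_ rfl rfl
        simp only [Units.val_one] at h2 ⊢
        omega
      · simp only
        rw [orientedLocalTime_succ, if_neg, add_zero]
        simp only [Units.val_neg, Units.val_one] at h2 ⊢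
        omega
    · refine Prod.ext h2.symm (Prod.ext (funext fun k => ?_) (funext fun k => ?_))
      · simp only
        rw [orientedLocalTime_succ, if_neg, add_zero]
        simp only [Units.val_one] at h2 ⊢
        omega
      · simp only
        rw [orientedLocalTime_succ]
        congr 1
        refine if_congr ?_ rfl rfl
        simp only [Units.val_neg, Units.val_one] at h2 ⊢
        omega

lemma follows_walk (ξ : Stacks) : Follows ξ (walk ξ) := by
  refine ⟨rfl, fun n => ?_⟩
  have h1 : walk ξ (n + 1) = _ := congrArg Prod.fst (walkState.eq_2 ξ n)
  simp only [walkState_eq ξ n] at h1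
  rw [h1, stepOf]
  split_ifs <;> rfl

lemma orientedLocalTime_congr (s : ℤˣ) {q q' : ℕ → ℤ} {n : ℕ} (h : ∀ i ≤ n, q i = q' i) (k : ℤ) :
    orientedLocalTime s q n k = orientedLocalTime s q' n k := by
  unfold orientedLocalTime
  congr 1
  refine Finset.filter_congr fun i hi => ?_
  have := Finset.mem_range.1 hi
  rw [h i (by omega), h (i + 1) (by omega)]

lemma orientedLocalTime_le (s : ℤˣ) (q : ℕ → ℤ) (n : ℕ) (k : ℤ) : orientedLocalTime s q n k ≤ n :=
  (Finset.card_filter_le _ _).trans_eq (Finset.card_range n)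

lemma localTimeDiff_congr {q q' : ℕ → ℤ} {n : ℕ} (h : ∀ i ≤ n, q i = q' i) :
    localTimeDiff q n = localTimeDiff q' n := by
  unfold localTimeDiff
  rw [h n le_rfl, orientedLocalTime_congr 1 h, orientedLocalTime_congr (-1) h]

lemma orientedLocalTime_mono (s : ℤˣ) (q : ℕ → ℤ) (k : ℤ) :
    Monotone fun n => orientedLocalTime s q n k :=
  monotone_nat_of_le_succ fun n => by
    rw [orientedLocalTime_succ]
    exact Nat.le_add_right _ _

/-- The position of the instruction that a walker with the path `q` obeys at the time `n`. -/
def instruction (q : ℕ → ℤ) (n : ℕ) : ℤ × ℕ × ℕ :=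
  (q n, orientedLocalTime 1 q n (q n), orientedLocalTime (-1) q n (q n))

lemma instruction_congr {q q' : ℕ → ℤ} {n : ℕ} (h : ∀ i ≤ n, q i = q' i) :
    instruction q n = instruction q' n := by
  unfold instruction
  rw [h n le_rfl, orientedLocalTime_congr 1 h, orientedLocalTime_congr (-1) h]

lemma finite_box (n : ℕ) :
    {a : ℤ × ℕ × ℕ | |a.1| ≤ n ∧ a.2.1 ≤ n ∧ a.2.2 ≤ n}.Finite := by
  refine ((Set.finite_Icc (-(n : ℤ)) n).prod ((Set.finite_Iic n).prod (Set.finite_Iic n))).subset ?_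
  rintro ⟨a, b, c⟩ ⟨h1, h2, h3⟩
  exact ⟨abs_le.1 h1, h2, h3⟩

lemma walk_congr {ξ ξ' : Stacks} {n : ℕ}
    (h : ∀ a : ℤ × ℕ × ℕ, a ∈ {a : ℤ × ℕ × ℕ | |a.1| ≤ n ∧ a.2.1 ≤ n ∧ a.2.2 ≤ n} → ξ a = ξ' a) :
    ∀ i ≤ n, walk ξ i = walk ξ' i := by
  induction n with
  | zero =>
    intro i hi
    rw [Nat.le_zero.1 hi]
    rfl
  | succ n ih =>
    have ih' := ih fun a ha => h a
      ⟨ha.1.trans (by push_cast; omega), ha.2.1.trans (by omega), ha.2.2.trans (by omega)⟩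
    intro i hi
    rcases Nat.lt_or_eq_of_le hi with hi | rfl
    · exact ih' i (by omega)
    · rw [(follows_walk ξ).step, (follows_walk ξ').step]
      change _ + stepOf (ξ (instruction (walk ξ) n)) = _ + stepOf (ξ' (instruction (walk ξ') n))
      rw [instruction_congr ih', ih' n le_rfl, h]
      refine ⟨((follows_walk ξ').abs_apply_le n).trans (by push_cast; omega),
        (orientedLocalTime_le _ _ _ _).trans (by omega),
        (orientedLocalTime_le _ _ _ _).trans (by omega)⟩

lemma measurable_walk : Measurable walk :=
  measurable_pi_lambda _ fun n => measurable_of_dependsOn (finite_box n)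
    (f := fun ξ => walk ξ n) fun _ _ h => walk_congr h n le_rfl

lemma measurableSet_apply_eq (n : ℕ) (z : ℤ) : MeasurableSet {q : ℕ → ℤ | q n = z} :=
  measurable_pi_apply (X := fun _ : ℕ => ℤ) n (measurableSet_singleton z)

/-- Paths that agree with `q` up to the time `n`. -/
def pathCylinder (q : ℕ → ℤ) (n : ℕ) : Set (ℕ → ℤ) := {q' | ∀ i ≤ n, q' i = q i}

lemma measurableSet_pathCylinder (q : ℕ → ℤ) (n : ℕ) : MeasurableSet (pathCylinder q n) := by
  have : pathCylinder q n = ⋂ i, ⋂ (_ : i ≤ n), (fun q' : ℕ → ℤ => q' i) ⁻¹' {q i} := by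
    ext q'
    simp [pathCylinder]
  rw [this]
  exact MeasurableSet.iInter fun i => MeasurableSet.iInter fun _ =>
    measurable_pi_apply i (measurableSet_singleton _)

/-- `ν` is the law on path space of a self-repelling walk. -/
structure IsWalkLaw (w : ℤ → ℝ) (ν : Measure (ℕ → ℤ)) : Prop where
  start : ∀ᵐ q ∂ν, q 0 = 0
  step : ∀ (q : ℕ → ℤ) (n : ℕ) (s : ℤˣ),
    ν (pathCylinder q n ∩ {q' | q' (n + 1) = q n + (s : ℤ)}) =
      ENNReal.ofReal (stepProb w s (localTimeDiff q n)) * ν (pathCylinder q n)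

lemma IsWeight.denom_pos {w : ℤ → ℝ} (hw : IsWeight w) (d : ℤ) : 0 < w d + w (-d) := by
  rcases le_total 0 d with h | h
  · linarith [hw.mono h, hw.pos_zero, hw.nonneg (-d)]
  · linarith [hw.mono (neg_nonneg.2 h), hw.pos_zero, hw.nonneg d]

lemma stepProb_neg_one {w : ℤ → ℝ} (hw : IsWeight w) (d : ℤ) :
    stepProb w (-1) d = 1 - stepProb w 1 d := by
  have := (hw.denom_pos d).ne'
  simp only [stepProb, Units.val_neg, Units.val_one, neg_neg, one_mul, neg_mul]
  field_simp
  ring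

lemma IsWeight.isBias {w : ℤ → ℝ} (hw : IsWeight w) : IsBias (stepProb w 1) := by
  have hdef : ∀ d, stepProb w 1 d = w (-d) / (w d + w (-d)) := fun d => by
    simp [stepProb]
  refine ⟨fun d => ?_, fun d => ?_, ?_⟩
  · rw [hdef]
    exact div_nonneg (hw.nonneg _) (hw.denom_pos d).le
  · have h1 := (hw.denom_pos d).ne'
    have h2 := (hw.denom_pos (-d)).ne'
    rw [neg_neg] at h2
    rw [hdef, hdef, neg_neg, add_comm (w (-d))]
    field_simp
    ring
  · obtain ⟨a, b, hab⟩ := hw.nonconst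
    set M := max a.natAbs b.natAbs
    have hM : w (-M) < w M := by
      have hle : ∀ c : ℤ, c.natAbs ≤ M → w (-M) ≤ w c ∧ w c ≤ w M := fun c hc =>
        ⟨hw.mono (by omega), hw.mono (by omega)⟩
      obtain ⟨h1, h2⟩ := hle a (le_max_left _ _)
      obtain ⟨h3, h4⟩ := hle b (le_max_right _ _)
      refine lt_of_le_of_ne (h1.trans h2) fun h => hab ?_
      linarith
    have hpos : 0 < w M + w (-M) := hw.denom_pos M
    refine ⟨w (-M) / (w M + w (-M)), ?_, M, fun d hd => ?_⟩
    · rw [div_lt_div_iff₀ hpos two_pos]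
      linarith
    · rw [hdef, div_le_div_iff₀ (hw.denom_pos d) hpos]
      have h1 : w (-d) ≤ w (-M) := hw.mono (by omega)
      have h2 : w M ≤ w d := hw.mono hd
      have h3 := mul_le_mul h1 h2 (hw.nonneg _) (hw.nonneg _)
      linarith

lemma IsWalkLaw.measure_pathCylinder_inter_eq_zero {w : ℤ → ℝ} (hw : IsWeight w)
    {ν : Measure (ℕ → ℤ)} [IsFiniteMeasure ν] (hν : IsWalkLaw w ν) (q : ℕ → ℤ) (n : ℕ) {z : ℤ}
    (h1 : z ≠ q n + 1) (h2 : z ≠ q n - 1) :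
    ν (pathCylinder q n ∩ {q' | q' (n + 1) = z}) = 0 := by
  have hms : ∀ z : ℤ, MeasurableSet (pathCylinder q n ∩ {q' | q' (n + 1) = z}) := fun z =>
    (measurableSet_pathCylinder q n).inter (measurableSet_apply_eq (n + 1) z)
  have hup := hν.step q n 1
  have hdown := hν.step q n (-1)
  rw [stepProb_neg_one hw] at hdown
  have h0 := hw.isBias.nonneg (localTimeDiff q n)
  have h0' := sub_nonneg.2 (hw.isBias.le_one (localTimeDiff q n))
  have hadd : ν (pathCylinder q n ∩ {q' | q' (n + 1) = q n + ((1 : ℤˣ) : ℤ)} ∪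
      pathCylinder q n ∩ {q' | q' (n + 1) = q n + ((-1 : ℤˣ) : ℤ)}) = ν (pathCylinder q n) := by
    rw [measure_union _ (hms _), hup, hdown, ← add_mul, ← ENNReal.ofReal_add h0 h0',
      add_sub_cancel, ENNReal.ofReal_one, one_mul]
    rw [Set.disjoint_left]
    rintro q' ⟨-, h3⟩ ⟨-, h4⟩
    simp only [Set.mem_ofPred_eq, Units.val_one, Units.val_neg] at h3 h4
    omega
  have hdisj : Disjoint (pathCylinder q n ∩ {q' | q' (n + 1) = q n + ((1 : ℤˣ) : ℤ)} ∪
      pathCylinder q n ∩ {q' | q' (n + 1) = q n + ((-1 : ℤˣ) : ℤ)})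
      (pathCylinder q n ∩ {q' | q' (n + 1) = z}) := by
    rw [Set.disjoint_left]
    rintro q' h3 ⟨-, h4⟩
    rcases h3 with ⟨-, h3⟩ | ⟨-, h3⟩ <;>
    · simp only [Set.mem_ofPred_eq, Units.val_one, Units.val_neg] at h3 h4
      omega
  have hle := measure_mono (μ := ν) (Set.union_subset (Set.union_subset Set.inter_subset_left
    Set.inter_subset_left) Set.inter_subset_left :
      (pathCylinder q n ∩ {q' | q' (n + 1) = q n + ((1 : ℤˣ) : ℤ)} ∪
      pathCylinder q n ∩ {q' | q' (n + 1) = q n + ((-1 : ℤˣ) : ℤ)}) ∪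
      pathCylinder q n ∩ {q' | q' (n + 1) = z} ⊆ pathCylinder q n)
  rw [measure_union hdisj (hms z), hadd] at hle
  exact nonpos_iff_eq_zero.1 ((ENNReal.add_le_add_iff_left (measure_ne_top ν (pathCylinder q n))).1
    (hle.trans_eq (add_zero _).symm))

/-- The law of a self-repelling walk is determined by the weight function. -/
lemma IsWalkLaw.unique {w : ℤ → ℝ} (hw : IsWeight w) {ν ν' : Measure (ℕ → ℤ)}
    [IsProbabilityMeasure ν] [IsProbabilityMeasure ν'] (hν : IsWalkLaw w ν)
    (hν' : IsWalkLaw w ν') : ν = ν' := by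
  have hcyl : ∀ (q : ℕ → ℤ) (n : ℕ), ν (pathCylinder q n) = ν' (pathCylinder q n) := by
    intro q n
    induction n with
    | zero =>
      have h0 : ∀ (ρ : Measure (ℕ → ℤ)) [IsProbabilityMeasure ρ], (∀ᵐ q ∂ρ, q 0 = 0) →
          ρ (pathCylinder q 0) = if q 0 = 0 then 1 else 0 := by
        intro ρ _ hρ
        split_ifs with hq
        · refine (prob_compl_eq_zero_iff (measurableSet_pathCylinder q 0)).1 ?_
          refine measure_mono_null (fun q' hq' => ?_) (ae_iff.1 hρ)
          refine fun h0 => hq' fun i hi => ?_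
          rw [Nat.le_zero.1 hi, h0, hq]
        · refine measure_mono_null (fun q' hq' => ?_) (ae_iff.1 hρ)
          have := hq' 0 le_rfl
          simp only [Set.mem_ofPred_eq]
          rwa [this]
      rw [h0 ν hν.start, h0 ν' hν'.start]
    | succ n ih =>
      have hsucc : pathCylinder q (n + 1) = pathCylinder q n ∩ {q' | q' (n + 1) = q (n + 1)} := by
        ext q'
        simp only [pathCylinder, Set.mem_inter_iff, Set.mem_ofPred_eq]
        refine ⟨fun h => ⟨fun i hi => h i (by omega), h _ le_rfl⟩, fun h i hi => ?_⟩
        rcases Nat.lt_or_eq_of_le hi with hi | rfl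
        · exact h.1 i (by omega)
        · exact h.2
      rw [hsucc]
      by_cases h1 : q (n + 1) = q n + ((1 : ℤˣ) : ℤ)
      · rw [h1, hν.step, hν'.step, ih]
      by_cases h2 : q (n + 1) = q n + ((-1 : ℤˣ) : ℤ)
      · rw [h2, hν.step, hν'.step, ih]
      · simp only [Units.val_one, Units.val_neg] at h1 h2
        rw [hν.measure_pathCylinder_inter_eq_zero hw q n h1 h2,
          hν'.measure_pathCylinder_inter_eq_zero hw q n h1 h2]
  have hle : ∀ n, ν.map (Preorder.frestrictLe n) = ν'.map (Preorder.frestrictLe n) := by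
    intro n
    refine Measure.ext_of_singleton fun x => ?_
    rw [Measure.map_apply (by fun_prop) (measurableSet_singleton x),
      Measure.map_apply (by fun_prop) (measurableSet_singleton x)]
    have : Preorder.frestrictLe (π := fun _ : ℕ => ℤ) n ⁻¹' {x} =
        pathCylinder (fun i => if h : i ≤ n then x ⟨i, Finset.mem_Iic.2 h⟩ else 0) n := by
      ext q
      simp only [Set.mem_preimage, Set.mem_singleton_iff, pathCylinder, Set.mem_ofPred_eq]
      constructor
      · rintro rfl i hi
        rw [dif_pos hi]
        rfl
      · intro h
        funext i
        have hi := Finset.mem_Iic.1 i.2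
        have := h i hi
        rw [dif_pos hi] at this
        exact this
    rw [this, hcyl]
  refine IsProjectiveLimit.unique (P := fun I => ν'.map I.restrict) (fun I => ?_) fun I => rfl
  have hI : I ⊆ Finset.Iic (I.sup id) := fun i hi => Finset.mem_Iic.2 (Finset.le_sup (f := id) hi)
  have h1 := congrArg (fun ρ => ρ.map (Finset.restrict₂ (π := fun _ : ℕ => ℤ) hI)) (hle (I.sup id))
  rw [Measure.map_map (by fun_prop) (by fun_prop), Measure.map_map (by fun_prop) (by fun_prop)] at h1
  exact h1

lemma instruction_ne {ξ : Stacks} {q : ℕ → ℤ} (h : Follows ξ q) {i n : ℕ} (hi : i < n) :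
    instruction q i ≠ instruction q n := by
  intro he
  simp only [instruction, Prod.mk.injEq] at he
  obtain ⟨h1, h2, h3⟩ := he
  rw [← h1] at h2 h3
  have h4 : orientedLocalTime 1 q (i + 1) (q i) ≤ orientedLocalTime 1 q n (q i) :=
    orientedLocalTime_mono 1 q (q i) hi
  have h5 : orientedLocalTime (-1) q (i + 1) (q i) ≤ orientedLocalTime (-1) q n (q i) :=
    orientedLocalTime_mono (-1) q (q i) hi
  rw [← h2, orientedLocalTime_succ] at h4
  rw [← h3, orientedLocalTime_succ] at h5
  have h6 := h.step i
  simp only [Units.val_one, Units.val_neg, true_and, stepOf] at h4 h5 h6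
  split_ifs at h4 h5 h6 <;> omega

lemma stepOf_injective : Function.Injective stepOf := by
  intro b b'
  cases b <;> cases b' <;> simp [stepOf]

lemma stackLaw_instruction (p : ℤ → ℝ) (a : ℤ × ℕ × ℕ) (b : Bool) :
    stackLaw p {ξ | ξ a = b} = coin (p ((a.2.1 : ℤ) - a.2.2)) {b} :=
  (measurePreserving_eval_infinitePi
    (fun a : ℤ × ℕ × ℕ => coin (p ((a.2.1 : ℤ) - a.2.2))) a).measure_preimage
    (measurableSet_singleton b).nullMeasurableSet

/-- The walk that obeys random stacks is a self-repelling walk, since no instruction is used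
twice. -/
lemma isWalkLaw_map_walk {w : ℤ → ℝ} (hw : IsWeight w) :
    IsWalkLaw w ((stackLaw (stepProb w 1)).map walk) := by
  refine ⟨?_, fun q n s => ?_⟩
  · rw [ae_map_iff measurable_walk.aemeasurable (measurableSet_apply_eq 0 0)]
    exact Eventually.of_forall fun ξ => rfl
  rw [Measure.map_apply measurable_walk
    ((measurableSet_pathCylinder q n).inter (measurableSet_apply_eq _ _)),
    Measure.map_apply measurable_walk (measurableSet_pathCylinder q n), Set.preimage_inter]
  rcases Set.eq_empty_or_nonempty (walk ⁻¹' pathCylinder q n) with he | ⟨ξ₀, hξ₀⟩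
  · rw [he, Set.empty_inter, measure_empty, mul_zero]
  have hξ₀' : ∀ i ≤ n, walk ξ₀ i = q i := hξ₀
  have hinst : ∀ i ≤ n, instruction (walk ξ₀) i = instruction q i := fun i hi =>
    instruction_congr fun k hk => hξ₀' k (hk.trans hi)
  have hiff : ∀ ξ, ξ ∈ walk ⁻¹' pathCylinder q n ↔
      ∀ i < n, ξ (instruction q i) = ξ₀ (instruction q i) := by
    refine fun ξ => ⟨fun h i hi => stepOf_injective ?_, fun h => ?_⟩
    · have h1 : ∀ k ≤ n, walk ξ k = q k := h
      have h2 := (follows_walk ξ).step i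
      have h3 := (follows_walk ξ₀).step i
      change _ = _ + stepOf (ξ (instruction (walk ξ) i)) at h2
      change _ = _ + stepOf (ξ₀ (instruction (walk ξ₀) i)) at h3
      rw [h1 _ hi, h1 _ hi.le, instruction_congr fun k hk => h1 k (hk.trans hi.le)] at h2
      rw [hξ₀' _ hi, hξ₀' _ hi.le, hinst i hi.le] at h3
      linarith
    · suffices ∀ m ≤ n, ∀ i ≤ m, walk ξ i = q i from this n le_rfl
      intro m
      induction m with
      | zero =>
        intro _ i hi
        rw [Nat.le_zero.1 hi, ← hξ₀' 0 (Nat.zero_le n)]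
        rfl
      | succ m ih =>
        intro hm i hi
        have ih' := ih (by omega)
        rcases Nat.lt_or_eq_of_le hi with hi | rfl
        · exact ih' i (by omega)
        · have h2 := (follows_walk ξ).step m
          have h3 := (follows_walk ξ₀).step m
          change _ = _ + stepOf (ξ (instruction (walk ξ) m)) at h2
          change _ = _ + stepOf (ξ₀ (instruction (walk ξ₀) m)) at h3
          rw [instruction_congr ih', ih' m le_rfl, h m hm] at h2
          rw [hinst m (by omega), hξ₀' m (by omega), hξ₀' _ hm] at h3
          rw [h2, h3]
  set a := instruction q n with ha
  obtain ⟨b, hb⟩ : ∃ b, stepOf b = s := by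
    rcases Int.units_eq_one_or s with rfl | rfl
    · exact ⟨true, rfl⟩
    · exact ⟨false, rfl⟩
  have hset : walk ⁻¹' pathCylinder q n ∩ walk ⁻¹' {q' | q' (n + 1) = q n + (s : ℤ)} =
      (fun ξ => ξ ∈ walk ⁻¹' pathCylinder q n) ⁻¹' {True} ∩ (fun ξ => ξ a) ⁻¹' {b} := by
    ext ξ
    simp only [Set.mem_inter_iff, Set.mem_preimage, Set.mem_singleton_iff, eq_iff_iff, iff_true]
    refine and_congr_right fun hξ => ?_
    have h1 : ∀ k ≤ n, walk ξ k = q k := hξ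
    have h2 := (follows_walk ξ).step n
    change _ = _ + stepOf (ξ (instruction (walk ξ) n)) at h2
    rw [instruction_congr h1, h1 n le_rfl] at h2
    rw [Set.mem_ofPred_eq, h2, ← hb, add_right_inj, stepOf_injective.eq_iff]
  have hdep : DependsOn (fun ξ => ξ ∈ walk ⁻¹' pathCylinder q n)
      (instruction q '' {i | i < n}) := by
    intro ξ ξ' h
    simp only [hiff, eq_iff_iff]
    refine forall₂_congr fun i hi => ?_
    rw [h _ ⟨i, hi, rfl⟩]
  have hdisj : Disjoint (instruction q '' {i | i < n}) {a} := by
    rw [Set.disjoint_singleton_right]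
    rintro ⟨i, hi, h⟩
    have hi' : i < n := hi
    rw [ha, ← hinst i hi'.le, ← hinst n le_rfl] at h
    exact instruction_ne (follows_walk ξ₀) hi' h
  have hind := indepFun_of_dependsOn (stepProb w 1) hdisj
    (f := fun ξ => ξ ∈ walk ⁻¹' pathCylinder q n) (g := fun ξ => ξ a)
    (measurable_walk (measurableSet_pathCylinder q n)).mem (measurable_pi_apply a) hdep
    fun ξ ξ' h => h a rfl
  rw [hset, hind.measure_inter_preimage_eq_mul _ _ (measurableSet_singleton _)
    (measurableSet_singleton _), mul_comm]
  congr 1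
  · refine (stackLaw_instruction (stepProb w 1) a b).trans ?_
    have h0 := hw.isBias.nonneg (localTimeDiff q n)
    have h1 := hw.isBias.le_one (localTimeDiff q n)
    change coin (stepProb w 1 (localTimeDiff q n)) {b} = _
    rcases Int.units_eq_one_or s with rfl | rfl
    · rw [← coin_true h0 h1]
      cases b
      · simp [stepOf] at hb
      · rfl
    · rw [stepProb_neg_one hw, ← coin_false h0 h1]
      cases b
      · rfl
      · simp [stepOf] at hb
  · congr 1
    ext ξ
    simp

/-- The law of any self-repelling walk. -/
lemma IsSelfRepellingWalk.isWalkLaw {Ω : Type*} [MeasurableSpace Ω] {μ : Measure Ω}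
    [IsProbabilityMeasure μ] {w : ℤ → ℝ} {X : ℕ → Ω → ℤ} (hX : IsSelfRepellingWalk μ w X) :
    IsWalkLaw w (μ.map fun ω i => X i ω) := by
  have hm : Measurable fun ω i => X i ω := measurable_pi_lambda _ hX.measurable
  refine ⟨?_, fun q n s => ?_⟩
  · rw [ae_map_iff hm.aemeasurable (measurableSet_apply_eq 0 0)]
    exact hX.start
  set E : Set Ω := (fun ω i => X i ω) ⁻¹' pathCylinder q n with hE
  set A : Set Ω := {ω | X (n + 1) ω = X n ω + (s : ℤ)} with hA
  have hEn : MeasurableSet[Filtration.natural X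
      (fun i => (hX.measurable i).stronglyMeasurable) n] E := by
    have : E = ⋂ i, ⋂ (_ : i ≤ n), X i ⁻¹' {q i} := by
      ext ω
      simp [E, pathCylinder]
    rw [this]
    refine MeasurableSet.iInter fun i => MeasurableSet.iInter fun hi => ?_
    exact (((Filtration.stronglyAdapted_natural fun i =>
      (hX.measurable i).stronglyMeasurable) i).mono
      ((Filtration.natural X fun i => (hX.measurable i).stronglyMeasurable).mono hi)).measurable
      (measurableSet_singleton _)
  have hEm : MeasurableSet E := hm (measurableSet_pathCylinder q n)
  have hAm : MeasurableSet A := measurableSet_eq_fun (hX.measurable _) ((hX.measurable _).add_const _)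
  have hint : Integrable (A.indicator fun _ => (1 : ℝ)) μ := (integrable_const 1).indicator hAm
  have h1 := setIntegral_condExp
    ((Filtration.natural X fun i => (hX.measurable i).stronglyMeasurable).le n) hint hEn
  rw [setIntegral_congr_ae hEm ((hX.step n s).mono fun ω h _ => h),
    setIntegral_congr_fun hEm (g := fun _ => stepProb w s (localTimeDiff q n)),
    setIntegral_const, setIntegral_indicator hAm, setIntegral_const, smul_eq_mul, smul_eq_mul,
    mul_one] at h1
  swap
  · intro ω hω
    exact congrArg (stepProb w s) (localTimeDiff_congr hω)
  rw [Measure.map_apply hm ((measurableSet_pathCylinder q n).inter (measurableSet_apply_eq _ _)),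
    Measure.map_apply hm (measurableSet_pathCylinder q n), ← hE]
  have h2 : (fun ω i => X i ω) ⁻¹' (pathCylinder q n ∩ {q' | q' (n + 1) = q n + (s : ℤ)}) =
      E ∩ A := by
    ext ω
    simp only [Set.mem_preimage, Set.mem_inter_iff, hE, hA, Set.mem_ofPred_eq]
    refine and_congr_right fun hω => ?_
    have h3 : X n ω = q n := hω n le_rfl
    rw [h3]
  rw [h2, ← ofReal_measureReal, ← ofReal_measureReal (s := E), ← h1, mul_comm,
    ENNReal.ofReal_mul' measureReal_nonneg]

lemma coin_map_not {a : ℝ} (h0 : 0 ≤ a) (h1 : a ≤ 1) : (coin a).map not = coin (1 - a) := by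
  refine Measure.ext_of_singleton fun b => ?_
  rw [Measure.map_apply (measurable_of_finite _) (measurableSet_singleton b)]
  cases b
  · rw [show not ⁻¹' {false} = {true} by ext b; cases b <;> simp, coin_true h0 h1,
      coin_false (by linarith) (by linarith), sub_sub_cancel]
  · rw [show not ⁻¹' {true} = {false} by ext b; cases b <;> simp, coin_false h0 h1,
      coin_true (by linarith) (by linarith)]

lemma measurePreserving_shift (p : ℤ → ℝ) (a : ℤ) :
    MeasurePreserving (shift a) (stackLaw p) (stackLaw p) := by
  refine ⟨measurable_pi_lambda _ fun x => measurable_pi_apply _, ?_⟩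
  refine Measure.map_infinitePi_infinitePi_of_inj (α := ℤ × ℕ × ℕ)
    (P := fun a : ℤ × ℕ × ℕ => coin (p ((a.2.1 : ℤ) - a.2.2)))
    (f := fun x => (x.1 + a, x.2.1, x.2.2)) fun x y h => ?_
  simp only [Prod.mk.injEq, add_left_inj] at h
  exact Prod.ext h.1 (Prod.ext h.2.1 h.2.2)

lemma measurePreserving_reflect {p : ℤ → ℝ} (hp : IsBias p) :
    MeasurePreserving reflect (stackLaw p) (stackLaw p) := by
  have hm : Measurable reflect :=
    measurable_pi_lambda _ fun x => (measurable_of_finite not).comp (measurable_pi_apply _)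
  refine ⟨hm, ?_⟩
  have h1 := Measure.map_infinitePi_infinitePi_of_inj (α := ℤ × ℕ × ℕ)
    (P := fun a : ℤ × ℕ × ℕ => coin (p ((a.2.1 : ℤ) - a.2.2)))
    (f := fun x => (-x.1, x.2.2, x.2.1)) fun x y h => by
      simp only [Prod.mk.injEq, neg_inj] at h
      exact Prod.ext h.1 (Prod.ext h.2.2 h.2.1)
  have h2 := Measure.infinitePi_map_pi (X := fun _ : ℤ × ℕ × ℕ => Bool)
    (fun a : ℤ × ℕ × ℕ => coin (p ((a.2.2 : ℤ) - a.2.1))) (f := fun _ => not)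
    fun _ => measurable_of_finite _
  have h3 : reflect = (fun (ξ : Stacks) i => !ξ i) ∘ fun (ξ : Stacks) i => ξ (-i.1, i.2.2, i.2.1) :=
    rfl
  have hm1 : Measurable fun (ξ : Stacks) i => !ξ i :=
    measurable_pi_lambda _ fun x => (measurable_of_finite not).comp (measurable_pi_apply x)
  have hm2 : Measurable fun (ξ : Stacks) (i : ℤ × ℕ × ℕ) => ξ (-i.1, i.2.2, i.2.1) :=
    measurable_pi_lambda _ fun x => measurable_pi_apply _
  rw [h3, ← Measure.map_map hm1 hm2]
  refine (congrArg _ h1).trans (h2.trans ?_)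
  refine congrArg _ (funext fun a => ?_)
  rw [coin_map_not (hp.nonneg _) (hp.le_one _), ← hp.symm, neg_sub]

/-! ### Inverse local times -/

lemma inverseLocalTime_ne_top {s : ℤˣ} {q : ℕ → ℤ} {j : ℤ} {r : ℕ}
    (h : ∃ n, r ≤ orientedLocalTime s q n j) : inverseLocalTime s q j r ≠ ⊤ := by
  obtain ⟨n, hn⟩ := h
  exact ne_top_of_le_ne_top (ENat.natCast_ne_top n) (iInf₂_le n hn)

/-- An inverse local time at a positive level is the time after the jump which completes it. -/
lemma exists_inverseLocalTime_eq {s : ℤˣ} {q : ℕ → ℤ} {j : ℤ} {r : ℕ} (hr : 0 < r)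
    (h : ∃ n, r ≤ orientedLocalTime s q n j) :
    ∃ n : ℕ, inverseLocalTime s q j r = (n + 1 : ℕ) ∧ orientedLocalTime s q n j < r ∧
      r ≤ orientedLocalTime s q (n + 1) j := by
  classical
  have hpos : Nat.find h ≠ 0 := by
    intro h0
    have := Nat.find_spec h
    rw [h0] at this
    exact absurd this (by simpa [orientedLocalTime] using hr.ne')
  obtain ⟨n, hn⟩ := Nat.exists_eq_succ_of_ne_zero hpos
  have hspec : r ≤ orientedLocalTime s q (n + 1) j := by
    have := Nat.find_spec h
    rwa [hn] at this
  refine ⟨n, le_antisymm (iInf₂_le (n + 1) hspec) (le_iInf₂ fun m hm => ?_), ?_,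
    hspec⟩
  · have := Nat.find_min' h hm
    rw [hn] at this
    exact_mod_cast this
  · exact not_le.1 (Nat.find_min h (hn ▸ Nat.lt_succ_self n))

lemma measurable_orientedLocalTime (s : ℤˣ) (n : ℕ) (j : ℤ) :
    Measurable fun q : ℕ → ℤ => orientedLocalTime s q n j := by
  simp only [orientedLocalTime, Finset.card_filter]
  refine Finset.measurable_sum _ fun i _ => Measurable.ite ?_ measurable_const measurable_const
  exact (measurableSet_apply_eq i j).inter (measurableSet_apply_eq (i + 1) _)

lemma measurable_inverseLocalTime (s : ℤˣ) (j : ℤ) (r : ℕ) :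
    Measurable fun q : ℕ → ℤ => inverseLocalTime s q j r := by
  have hex : ∀ q (m : ℕ), inverseLocalTime s q j r ≤ m ↔
      ∃ n ≤ m, r ≤ orientedLocalTime s q n j := by
    intro q m
    constructor
    · intro h
      by_contra! hn
      have : ((m + 1 : ℕ) : ℕ∞) ≤ inverseLocalTime s q j r := by
        refine le_iInf₂ fun n hn' => ?_
        by_contra! hlt
        have hlt' : n < m + 1 := by exact_mod_cast hlt
        exact absurd hn' (not_le.2 (hn n (by omega)))
      have h2 : m + 1 ≤ m := by exact_mod_cast this.trans h
      omega
    · rintro ⟨n, hn, hr⟩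
      exact (iInf₂_le n hr).trans (by exact_mod_cast hn)
  have hle : ∀ m : ℕ, MeasurableSet {q : ℕ → ℤ | inverseLocalTime s q j r ≤ m} := by
    intro m
    have : {q : ℕ → ℤ | inverseLocalTime s q j r ≤ m} =
        ⋃ n, ⋃ (_ : n ≤ m), (fun q : ℕ → ℤ => orientedLocalTime s q n j) ⁻¹' Set.Ici r := by
      ext q
      simp [hex]
    rw [this]
    exact MeasurableSet.iUnion fun n => MeasurableSet.iUnion fun _ =>
      measurable_orientedLocalTime s n j measurableSet_Ici
  rw [ENat.measurable_iff]
  intro m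
  cases m with
  | zero =>
    convert hle 0 using 1
    ext q
    simp
  | succ m =>
    convert (hle (m + 1)).diff (hle m) using 1
    ext q
    simp only [Set.mem_preimage, Set.mem_singleton_iff, Set.mem_sdiff, Set.mem_ofPred_eq, not_le]
    constructor
    · intro h
      rw [h]
      exact ⟨le_rfl, by exact_mod_cast Nat.lt_succ_self m⟩
    · rintro ⟨h1, h2⟩
      refine le_antisymm h1 ?_
      rw [Nat.cast_succ]
      exact Order.add_one_le_of_lt h2

lemma inverseLocalTime_neg (s : ℤˣ) (q : ℕ → ℤ) (j : ℤ) (r : ℕ) :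
    inverseLocalTime s (fun i => -q i) j r = inverseLocalTime (-s) q (-j) r := by
  simp only [inverseLocalTime, orientedLocalTime_neg]

lemma Follows.eq_walk {ξ : Stacks} {q : ℕ → ℤ} (h : Follows ξ q) : q = walk ξ := by
  suffices ∀ n, ∀ i ≤ n, q i = walk ξ i from funext fun n => this n n le_rfl
  intro n
  induction n with
  | zero =>
    intro i hi
    rw [Nat.le_zero.1 hi, h.start]
    rfl
  | succ n ih =>
    intro i hi
    rcases Nat.lt_or_eq_of_le hi with hi | rfl
    · exact ih i (by omega)
    · rw [h.step, (follows_walk ξ).step]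
      change _ + stepOf (ξ (instruction q n)) = _ + stepOf (ξ (instruction (walk ξ) n))
      rw [instruction_congr ih, ih n le_rfl]

lemma inverseLocalTime_neg_one_walk (ξ : Stacks) (j : ℤ) (r : ℕ) :
    inverseLocalTime (-1) (walk ξ) j r = inverseLocalTime 1 (walk (reflect ξ)) (-j) r := by
  rw [← (follows_walk ξ).neg.eq_walk, inverseLocalTime_neg, neg_neg]

/-! ### Deviation of the inverse local times -/

/-- The total deviation of the profile `profile N z` from its approximation. -/
noncomputable def profileDev (N z : ℕ) (ξ : Stacks) : ENNReal :=
  ∑' i, ENNReal.ofReal |(profile N z ξ i : ℝ) - meanProfile N z i|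

/-- The sum of the approximation `meanProfile N z` of the profile. -/
noncomputable def meanTotal (N z : ℝ) : ℝ :=
  z * N + N * (N - 1) / 4 + (2 * z + N) * (2 * z + N + 1) / 4

lemma measurable_ofReal_abs_profile_sub (N z i : ℕ) : Measurable fun ξ =>
    ENNReal.ofReal |(profile N z ξ i : ℝ) - meanProfile N z i| :=
  (measurable_from_nat (f := fun m : ℕ => ENNReal.ofReal |(m : ℝ) - meanProfile N z i|)).comp
    (measurable_profile N z i)

lemma measurable_profileDev (N z : ℕ) : Measurable (profileDev N z) :=
  Measurable.tsum fun i => measurable_ofReal_abs_profile_sub N z i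

lemma exists_lintegral_profileDev_le {p : ℤ → ℝ} (hp : IsBias p) {ε : ℝ} (hε : 0 < ε) :
    ∃ D, 0 ≤ D ∧ ∀ N z : ℕ, ∫⁻ ξ, profileDev N z ξ ∂stackLaw p ≤
      ENNReal.ofReal (ε * (N + z + 1) ^ 2 + D * (N + z + 1)) := by
  obtain ⟨D, hD, h⟩ := exists_tsum_lintegral_sub_le hp hε
  refine ⟨D, hD, fun N z => ?_⟩
  unfold profileDev
  rw [lintegral_tsum fun i => (measurable_ofReal_abs_profile_sub N z i).aemeasurable]
  exact h N z

lemma ofReal_abs_sum_profile_sub_le (N z : ℕ) (ξ : Stacks) : ∀ᶠ M in atTop,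
    ENNReal.ofReal |((∑ i ∈ Finset.range M, profile N z ξ i : ℕ) : ℝ) - meanTotal N z| ≤
      profileDev N z ξ := by
  filter_upwards [eventually_ge_atTop (2 * N + 2 * z)] with M hM
  have hmean : meanTotal N z = ∑ i ∈ Finset.range M, meanProfile N z i := by
    rw [meanTotal, ← sum_meanProfile]
    refine Finset.sum_subset (Finset.range_subset_range.2 hM) fun i _ hi => ?_
    exact meanProfile_eq_zero (by simpa using hi)
  rw [hmean, Nat.cast_sum, ← Finset.sum_sub_distrib]
  calc _ ≤ ENNReal.ofReal (∑ i ∈ Finset.range M, |(profile N z ξ i : ℝ) - meanProfile N z i|) :=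
        ENNReal.ofReal_le_ofReal (Finset.abs_sum_le_sum_abs _ _)
    _ = ∑ i ∈ Finset.range M, ENNReal.ofReal |(profile N z ξ i : ℝ) - meanProfile N z i| :=
        ENNReal.ofReal_sum_of_nonneg fun i _ => abs_nonneg _
    _ ≤ _ := ENNReal.sum_le_tsum _

lemma ae_eventually_profile_eq_zero {p : ℤ → ℝ} (hp : IsBias p) (N z : ℕ) :
    ∀ᵐ ξ ∂stackLaw p, ∀ᶠ i in atTop, profile N z ξ i = 0 := by
  obtain ⟨D, -, h⟩ := exists_lintegral_profileDev_le hp one_pos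
  filter_upwards [ae_lt_top (measurable_profileDev N z)
    ((h N z).trans_lt ENNReal.ofReal_lt_top).ne] with ξ hξ
  have hlim := ENNReal.tendsto_cofinite_zero_of_tsum_ne_top hξ.ne
  rw [Nat.cofinite_eq_atTop] at hlim
  filter_upwards [hlim.eventually_lt_const one_pos, eventually_ge_atTop (2 * N + 2 * z)]
    with i hi hi'
  rw [meanProfile_eq_zero hi', sub_zero, Nat.abs_cast, ENNReal.ofReal_natCast] at hi
  exact Nat.lt_one_iff.1 (by exact_mod_cast hi)

/-- The number of sites strictly between `j` and `0`, or `0` if `j` is nonnegative. -/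
abbrev rightShift (j : ℤ) : ℕ := (-j - 1).toNat

/-- The number of jumps from `j + 1` to `j` before the `r`-th jump from `j` to `j + 1`; there is one
jump less if the walk starts to the left of the edge. -/
abbrev rightStart (j : ℤ) (r : ℕ) : ℕ := if j < 0 then r else r - 1

/-- The stacks on which the profile to the right of `j` is built. -/
def rightStacks (j : ℤ) (ξ : Stacks) : Stacks := shift (j + 1) ξ

/-- The stacks on which the profile to the left of `j` is built. -/
def leftStacks (j : ℤ) (ξ : Stacks) : Stacks := shift (-j) (reflect ξ)

lemma measurePreserving_rightStacks (p : ℤ → ℝ) (j : ℤ) :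
    MeasurePreserving (rightStacks j) (stackLaw p) (stackLaw p) :=
  measurePreserving_shift p (j + 1)

lemma measurePreserving_leftStacks {p : ℤ → ℝ} (hp : IsBias p) (j : ℤ) :
    MeasurePreserving (leftStacks j) (stackLaw p) (stackLaw p) :=
  (measurePreserving_shift p (-j)).comp (measurePreserving_reflect hp)

/-- Almost surely the deterministic description of the inverse local times applies. -/
lemma ae_recurs_and_profiles {p : ℤ → ℝ} (hp : IsBias p) (j : ℤ) (r : ℕ) :
    ∀ᵐ ξ ∂stackLaw p, Recurs ξ ∧ Recurs (reflect ξ) ∧ (∀ᶠ i in atTop, rightProfile j r ξ i = 0) ∧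
      ∀ᶠ i in atTop, leftProfile j r ξ i = 0 := by
  filter_upwards [ae_exists_ups_le hp,
    (measurePreserving_reflect hp).quasiMeasurePreserving.ae (ae_exists_ups_le hp),
    (measurePreserving_rightStacks p j).quasiMeasurePreserving.ae
      (ae_eventually_profile_eq_zero hp (rightShift j) (rightStart j r)),
    (measurePreserving_leftStacks hp j).quasiMeasurePreserving.ae
      (ae_eventually_profile_eq_zero hp j.toNat r)] with ξ h1 h2 h3 h4
  exact ⟨h1, h2, h3, h4⟩

lemma ae_inverseLocalTime_walk_ne_top {p : ℤ → ℝ} (hp : IsBias p) (j : ℤ) (r : ℕ) :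
    ∀ᵐ ξ ∂stackLaw p, inverseLocalTime 1 (walk ξ) j r ≠ ⊤ := by
  filter_upwards [ae_recurs_and_profiles hp j r] with ξ hξ
  exact inverseLocalTime_ne_top
    ((follows_walk ξ).exists_le hξ.1 hξ.2.1 j r hξ.2.2.1 hξ.2.2.2)

/-- The deterministic approximation of the inverse local time at the edge from `j` to `j + 1`. -/
noncomputable def meanTime (j : ℤ) (r : ℕ) : ℝ :=
  2 * meanTotal (rightShift j) (rightStart j r) + 2 * meanTotal j.toNat r

/-- The difference between twice the sum of both profiles and the inverse local time: the initial
values of the profiles and the additional units at the sites between `j` and the origin. -/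
def boundaryTerm (j : ℤ) (r : ℕ) : ℕ := rightStart j r + rightShift j + (r + j.toNat)

lemma ae_abs_inverseLocalTime_sub_le {p : ℤ → ℝ} (hp : IsBias p) (j : ℤ) {r : ℕ} (hr : 0 < r) :
    ∀ᵐ ξ ∂stackLaw p,
      ENNReal.ofReal |((inverseLocalTime 1 (walk ξ) j r).toNat : ℝ) - meanTime j r| ≤
        2 * profileDev (rightShift j) (rightStart j r) (rightStacks j ξ) +
          2 * profileDev j.toNat r (leftStacks j ξ) + ENNReal.ofReal (boundaryTerm j r) := by
  filter_upwards [ae_recurs_and_profiles hp j r] with ξ ⟨h1, h2, h3, h4⟩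
  obtain ⟨n, hT, hn, hn'⟩ := exists_inverseLocalTime_eq hr
    ((follows_walk ξ).exists_le h1 h2 j r h3 h4)
  obtain ⟨M, hM, hMR, hML⟩ := ((follows_walk ξ).time_eq h1 h2 hn hn' h3 h4 |>.and
    ((ofReal_abs_sum_profile_sub_le (rightShift j) (rightStart j r) (rightStacks j ξ)).and
      (ofReal_abs_sum_profile_sub_le j.toNat r (leftStacks j ξ)))).exists
  set R : ℕ := ∑ i ∈ Finset.range M, profile (rightShift j) (rightStart j r) (rightStacks j ξ) i
  set L : ℕ := ∑ i ∈ Finset.range M, profile j.toNat r (leftStacks j ξ) i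
  have hM' : n + 1 + boundaryTerm j r = 2 * R + 2 * L := by
    refine Eq.trans ?_ hM
    rw [boundaryTerm]
    ring
  have hcast : ((n + 1 : ℕ) : ℝ) = 2 * R + 2 * L - boundaryTerm j r := by
    rw [eq_sub_iff_add_eq]
    exact_mod_cast hM'
  have hsplit : |((n + 1 : ℕ) : ℝ) - meanTime j r| ≤
      2 * |(R : ℝ) - meanTotal (rightShift j) (rightStart j r)| +
        2 * |(L : ℝ) - meanTotal j.toNat r| + boundaryTerm j r := by
    rw [hcast, meanTime]
    calc _ = |2 * ((R : ℝ) - meanTotal (rightShift j) (rightStart j r)) +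
          2 * ((L : ℝ) - meanTotal j.toNat r) - boundaryTerm j r| := by
          congr 1
          ring
      _ ≤ _ := by
          refine (abs_sub _ _).trans (add_le_add ((abs_add_le _ _).trans_eq ?_) (Nat.abs_cast _).le)
          rw [abs_mul, abs_mul, abs_two]
  rw [hT, ENat.toNat_natCast]
  refine (ENNReal.ofReal_le_ofReal hsplit).trans ?_
  rw [ENNReal.ofReal_add (by positivity) (by positivity),
    ENNReal.ofReal_add (by positivity) (by positivity), ENNReal.ofReal_mul zero_le_two,
    ENNReal.ofReal_mul zero_le_two, ENNReal.ofReal_ofNat]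
  gcongr

/-- Bound for the mean of the deviation of a profile. -/
def devBound (ε D N z : ℝ) : ℝ := ε * (N + z + 1) ^ 2 + D * (N + z + 1)

lemma devBound_nonneg {ε D : ℝ} (hε : 0 ≤ ε) (hD : 0 ≤ D) (N z : ℕ) : 0 ≤ devBound ε D N z := by
  unfold devBound
  positivity

lemma exists_lintegral_inverseLocalTime_sub_le {p : ℤ → ℝ} (hp : IsBias p) {ε : ℝ} (hε : 0 < ε) :
    ∃ D, 0 ≤ D ∧ ∀ (j : ℤ) (r : ℕ), 0 < r →
      ∫⁻ ξ, ENNReal.ofReal |((inverseLocalTime 1 (walk ξ) j r).toNat : ℝ) - meanTime j r|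
        ∂stackLaw p ≤ ENNReal.ofReal (2 * devBound ε D (rightShift j) (rightStart j r) +
          2 * devBound ε D j.toNat r + boundaryTerm j r) := by
  obtain ⟨D, hD, h⟩ := exists_lintegral_profileDev_le hp hε
  refine ⟨D, hD, fun j r hr => ?_⟩
  have hpos := devBound_nonneg hε.le hD
  have hR := measurePreserving_rightStacks p j
  have hL := measurePreserving_leftStacks hp j
  have hmR : Measurable fun ξ => 2 * profileDev (rightShift j) (rightStart j r) (rightStacks j ξ) :=
    ((measurable_profileDev _ _).comp hR.measurable).const_mul 2
  have hmL : Measurable fun ξ => 2 * profileDev j.toNat r (leftStacks j ξ) :=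
    ((measurable_profileDev _ _).comp hL.measurable).const_mul 2
  refine (lintegral_mono_ae (ae_abs_inverseLocalTime_sub_le hp j hr)).trans ?_
  rw [lintegral_add_right _ measurable_const, lintegral_add_right _ hmL,
    lintegral_const_mul' _ _ ENNReal.ofNat_ne_top, lintegral_const_mul' _ _ ENNReal.ofNat_ne_top,
    hR.lintegral_comp (measurable_profileDev _ _), hL.lintegral_comp (measurable_profileDev _ _),
    lintegral_const, measure_univ, mul_one, ENNReal.ofReal_add _ (Nat.cast_nonneg _),
    ENNReal.ofReal_add, ENNReal.ofReal_mul zero_le_two, ENNReal.ofReal_mul zero_le_two,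
    ENNReal.ofReal_ofNat]
  · gcongr
    · exact h _ _
    · exact h _ _
  · exact mul_nonneg zero_le_two (hpos _ _)
  · exact mul_nonneg zero_le_two (hpos _ _)
  · exact add_nonneg (mul_nonneg zero_le_two (hpos _ _)) (mul_nonneg zero_le_two (hpos _ _))

/-! ### The scaling limit -/

section

variable {N z : ℝ → ℝ} {a b : ℝ}

lemma tendsto_meanTotal (hN : Tendsto (fun A => N A / A) atTop (𝓝 a))
    (hz : Tendsto (fun A => z A / A) atTop (𝓝 b)) :
    Tendsto (fun A : ℝ => (A ^ 2)⁻¹ * meanTotal (N A) (z A)) atTop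
      (𝓝 (b * a + a * a / 4 + (2 * b + a) * (2 * b + a) / 4)) := by
  have hlim := ((hz.mul hN).add ((hN.mul (hN.sub tendsto_inv_atTop_zero)).div_const 4)).add
    ((((hz.const_mul 2).add hN).mul
      (((hz.const_mul 2).add hN).add tendsto_inv_atTop_zero)).div_const 4)
  rw [sub_zero, add_zero] at hlim
  refine hlim.congr' ?_
  filter_upwards [eventually_gt_atTop 0] with A hA
  unfold meanTotal
  field_simp

lemma tendsto_devBound (ε D : ℝ) (hN : Tendsto (fun A => N A / A) atTop (𝓝 a))
    (hz : Tendsto (fun A => z A / A) atTop (𝓝 b)) :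
    Tendsto (fun A : ℝ => (A ^ 2)⁻¹ * devBound ε D (N A) (z A)) atTop (𝓝 (ε * (a + b) ^ 2)) := by
  have h1 := (hN.add hz).add tendsto_inv_atTop_zero
  have hlim := ((h1.pow 2).const_mul ε).add ((h1.mul tendsto_inv_atTop_zero).const_mul D)
  rw [mul_zero, mul_zero, add_zero, add_zero] at hlim
  refine hlim.congr' ?_
  filter_upwards [eventually_gt_atTop 0] with A hA
  unfold devBound
  field_simp

variable {j : ℝ → ℤ} {r : ℝ → ℕ} {y h : ℝ}

lemma tendsto_toNat (hj : Tendsto (fun A => (j A : ℝ) / A) atTop (𝓝 y)) :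
    Tendsto (fun A => ((j A).toNat : ℝ) / A) atTop (𝓝 (max y 0)) := by
  refine (hj.max tendsto_const_nhds).congr' ?_
  filter_upwards [eventually_gt_atTop 0] with A hA
  have : (((j A).toNat : ℤ) : ℝ) = max (j A : ℝ) 0 := by
    rw [Int.toNat_eq_max]
    push_cast
    rfl
  rw [← Int.cast_natCast, this, ← max_div_div_right hA.le, zero_div]

lemma tendsto_rightShift (hj : Tendsto (fun A => (j A : ℝ) / A) atTop (𝓝 y)) :
    Tendsto (fun A => (rightShift (j A) : ℝ) / A) atTop (𝓝 (max (-y) 0)) := by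
  refine tendsto_toNat (j := fun A => -j A - 1) ?_
  have hlim := hj.neg.sub tendsto_inv_atTop_zero
  rw [sub_zero] at hlim
  refine hlim.congr fun A => ?_
  push_cast
  ring

lemma tendsto_rightStart (hr : Tendsto (fun A => (r A : ℝ) / A) atTop (𝓝 h)) :
    Tendsto (fun A => (rightStart (j A) (r A) : ℝ) / A) atTop (𝓝 h) := by
  have hlim := hr.sub tendsto_inv_atTop_zero
  rw [sub_zero] at hlim
  refine tendsto_of_tendsto_of_tendsto_of_le_of_le' hlim hr ?_ ?_
  · filter_upwards [eventually_gt_atTop 0] with A hA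
    rw [inv_eq_one_div, ← sub_div]
    refine div_le_div_of_nonneg_right ?_ hA.le
    rw [sub_le_iff_le_add]
    exact_mod_cast (show r A ≤ rightStart (j A) (r A) + 1 by
      unfold rightStart
      split_ifs <;> omega)
  · filter_upwards [eventually_gt_atTop 0] with A hA
    refine div_le_div_of_nonneg_right ?_ hA.le
    exact_mod_cast (show rightStart (j A) (r A) ≤ r A by
      unfold rightStart
      split_ifs <;> omega)

lemma tendsto_meanTime (hj : Tendsto (fun A => (j A : ℝ) / A) atTop (𝓝 y))
    (hr : Tendsto (fun A => (r A : ℝ) / A) atTop (𝓝 h)) :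
    Tendsto (fun A : ℝ => (A ^ 2)⁻¹ * meanTime (j A) (r A)) atTop (𝓝 ((|y| + 2 * h) ^ 2)) := by
  have hlim := ((tendsto_meanTotal (tendsto_rightShift hj) (tendsto_rightStart (j := j) hr)).const_mul
    2).add ((tendsto_meanTotal (tendsto_toNat hj) hr).const_mul 2)
  refine Tendsto.congr (fun A => ?_) (hlim.trans_eq ?_)
  · unfold meanTime
    ring
  · congr 1
    rcases le_total 0 y with hy | hy
    · rw [max_eq_left hy, max_eq_right (by linarith), abs_of_nonneg hy]
      ring
    · rw [max_eq_right hy, max_eq_left (by linarith), abs_of_nonpos hy]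
      ring

lemma tendsto_boundaryTerm (hj : Tendsto (fun A => (j A : ℝ) / A) atTop (𝓝 y))
    (hr : Tendsto (fun A => (r A : ℝ) / A) atTop (𝓝 h)) :
    Tendsto (fun A : ℝ => (A ^ 2)⁻¹ * (boundaryTerm (j A) (r A) : ℝ)) atTop (𝓝 0) := by
  have hlim := (((tendsto_rightStart (j := j) hr).add (tendsto_rightShift hj)).add
    (hr.add (tendsto_toNat hj))).mul tendsto_inv_atTop_zero
  rw [mul_zero] at hlim
  refine hlim.congr' ?_
  filter_upwards [eventually_gt_atTop 0] with A hA
  rw [boundaryTerm]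
  push_cast
  field_simp

/-- The scaling limit of the inverse local times at upward edges holds in mean. -/
lemma tendsto_lintegral_inverseLocalTime {p : ℤ → ℝ} (hp : IsBias p) (hh : 0 < h)
    (hj : Tendsto (fun A => (j A : ℝ) / A) atTop (𝓝 y))
    (hr : Tendsto (fun A => (r A : ℝ) / A) atTop (𝓝 h)) :
    Tendsto (fun A : ℝ => ∫⁻ ξ, edist ((A ^ 2)⁻¹ *
      ((inverseLocalTime 1 (walk ξ) (j A) (r A)).toNat : ℝ)) ((|y| + 2 * h) ^ 2) ∂stackLaw p)
      atTop (𝓝 0) := by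
  rw [ENNReal.tendsto_nhds_zero]
  intro δ hδ
  obtain ⟨δ', hδ', hδδ⟩ : ∃ δ' : ℝ, 0 < δ' ∧ ENNReal.ofReal δ' ≤ δ := by
    rcases eq_or_ne δ ⊤ with rfl | hne
    · exact ⟨1, one_pos, le_top⟩
    · exact ⟨δ.toReal, ENNReal.toReal_pos hδ.ne' hne, ENNReal.ofReal_toReal_le⟩
  set C : ℝ := 2 * (max (-y) 0 + h) ^ 2 + 2 * (max y 0 + h) ^ 2 with hC
  have hCpos : 0 < C := by positivity
  obtain ⟨D, hD0, hD⟩ := exists_lintegral_inverseLocalTime_sub_le hp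
    (ε := δ' / (2 * C)) (by positivity)
  set ε := δ' / (2 * C)
  have hbound := ((((tendsto_devBound ε D (tendsto_rightShift hj)
    (tendsto_rightStart (j := j) hr)).const_mul 2).add
    ((tendsto_devBound ε D (tendsto_toNat hj) hr).const_mul 2)).add
    (tendsto_boundaryTerm hj hr)).add ((tendsto_meanTime hj hr).sub_const ((|y| + 2 * h) ^ 2)).abs
  rw [sub_self, abs_zero, add_zero, add_zero] at hbound
  have hlt : 2 * (ε * (max (-y) 0 + h) ^ 2) + 2 * (ε * (max y 0 + h) ^ 2) < δ' := by
    have : 2 * (ε * (max (-y) 0 + h) ^ 2) + 2 * (ε * (max y 0 + h) ^ 2) = ε * C := by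
      rw [hC]
      ring
    rw [this, div_mul_eq_mul_div, div_lt_iff₀ (by positivity)]
    nlinarith
  have hrpos : ∀ᶠ A in atTop, 0 < r A := by
    filter_upwards [hr.eventually_const_lt hh] with A hA
    refine Nat.pos_of_ne_zero fun h0 => ?_
    simp [h0] at hA
  filter_upwards [hbound.eventually_lt_const hlt, hrpos, eventually_gt_atTop 0] with A hA hrA hA0
  refine le_trans ?_ hδδ
  have hsq : 0 ≤ (A ^ 2)⁻¹ := by positivity
  calc _ ≤ ∫⁻ ξ, (ENNReal.ofReal (A ^ 2)⁻¹ * ENNReal.ofReal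
          |((inverseLocalTime 1 (walk ξ) (j A) (r A)).toNat : ℝ) - meanTime (j A) (r A)| +
          ENNReal.ofReal |(A ^ 2)⁻¹ * meanTime (j A) (r A) - (|y| + 2 * h) ^ 2|) ∂stackLaw p := by
        refine lintegral_mono fun ξ => ?_
        rw [edist_dist, Real.dist_eq, ← ENNReal.ofReal_mul hsq,
          ← ENNReal.ofReal_add (by positivity) (abs_nonneg _)]
        refine ENNReal.ofReal_le_ofReal ?_
        rw [← abs_of_nonneg hsq, ← abs_mul, abs_of_nonneg hsq, mul_sub]
        exact abs_sub_le _ _ _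
    _ = ENNReal.ofReal (A ^ 2)⁻¹ * (∫⁻ ξ, ENNReal.ofReal
          |((inverseLocalTime 1 (walk ξ) (j A) (r A)).toNat : ℝ) - meanTime (j A) (r A)|
            ∂stackLaw p) +
          ENNReal.ofReal |(A ^ 2)⁻¹ * meanTime (j A) (r A) - (|y| + 2 * h) ^ 2| := by
        rw [lintegral_add_right _ measurable_const, lintegral_const_mul' _ _ ENNReal.ofReal_ne_top,
          lintegral_const, measure_univ, mul_one]
    _ ≤ ENNReal.ofReal (A ^ 2)⁻¹ * ENNReal.ofReal
          (2 * devBound ε D (rightShift (j A)) (rightStart (j A) (r A)) +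
            2 * devBound ε D (j A).toNat (r A) + boundaryTerm (j A) (r A)) +
          ENNReal.ofReal |(A ^ 2)⁻¹ * meanTime (j A) (r A) - (|y| + 2 * h) ^ 2| := by
        gcongr
        exact hD _ _ hrA
    _ ≤ ENNReal.ofReal δ' := by
        rw [← ENNReal.ofReal_mul hsq, ← ENNReal.ofReal_add ?_ (abs_nonneg _)]
        · refine ENNReal.ofReal_le_ofReal (le_trans (le_of_eq ?_) hA.le)
          ring
        · have hε : 0 ≤ ε := by positivity
          have hpos := devBound_nonneg hε hD0
          exact mul_nonneg hsq (add_nonneg (add_nonneg (mul_nonneg zero_le_two (hpos _ _))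
            (mul_nonneg zero_le_two (hpos _ _))) (Nat.cast_nonneg _))

end

/-- The scaling limit for both signs; the mirror image of the stacks reduces jumps downwards to jumps
upwards. -/
lemma tendsto_lintegral_inverseLocalTime_walk {p : ℤ → ℝ} (hp : IsBias p) (x : ℝ) {h : ℝ}
    (hh : 0 < h) (s : ℤˣ) :
    Tendsto (fun A : ℝ => ∫⁻ ξ, edist ((A ^ 2)⁻¹ *
      ((inverseLocalTime s (walk ξ) ⌊A * x⌋ ⌊A * h⌋₊).toNat : ℝ)) ((|x| + 2 * h) ^ 2) ∂stackLaw p)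
      atTop (𝓝 0) := by
  have hj : Tendsto (fun A : ℝ => (⌊A * x⌋ : ℝ) / A) atTop (𝓝 x) := by
    have h0 : Tendsto (fun A : ℝ => x - A⁻¹) atTop (𝓝 (x - 0)) :=
      tendsto_inv_atTop_zero.const_sub x
    rw [sub_zero] at h0
    refine tendsto_of_tendsto_of_tendsto_of_le_of_le' h0 tendsto_const_nhds ?_ ?_
    · filter_upwards [eventually_gt_atTop 0] with A hA
      rw [le_div_iff₀ hA, sub_mul, inv_mul_cancel₀ hA.ne', mul_comm]
      exact (Int.sub_one_lt_floor _).le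
    · filter_upwards [eventually_gt_atTop 0] with A hA
      rw [div_le_iff₀ hA, mul_comm]
      exact (mul_comm A x) ▸ Int.floor_le _
  have hr : Tendsto (fun A : ℝ => (⌊A * h⌋₊ : ℝ) / A) atTop (𝓝 h) := by
    simpa only [mul_comm] using tendsto_nat_floor_mul_div_atTop hh.le
  rcases Int.units_eq_one_or s with rfl | rfl
  · exact tendsto_lintegral_inverseLocalTime hp hh hj hr
  · have hj' : Tendsto (fun A : ℝ => ((-⌊A * x⌋ : ℤ) : ℝ) / A) atTop (𝓝 (-x)) := by
      simpa only [Int.cast_neg, neg_div] using hj.neg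
    have hlim := tendsto_lintegral_inverseLocalTime hp hh hj' hr
    rw [abs_neg] at hlim
    refine hlim.congr fun A => ?_
    simp only [inverseLocalTime_neg_one_walk]
    refine ((measurePreserving_reflect hp).lintegral_comp (f := fun ξ => edist ((A ^ 2)⁻¹ *
      ((inverseLocalTime 1 (walk ξ) (-⌊A * x⌋) ⌊A * h⌋₊).toNat : ℝ)) ((|x| + 2 * h) ^ 2)) ?_).symm
    exact (measurable_from_top (f := fun m : ℕ∞ =>
      edist ((A ^ 2)⁻¹ * (m.toNat : ℝ)) ((|x| + 2 * h) ^ 2))).comp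
      ((measurable_inverseLocalTime 1 _ _).comp measurable_walk)

lemma ae_inverseLocalTime_ne_top {p : ℤ → ℝ} (hp : IsBias p) (s : ℤˣ) (j : ℤ) (r : ℕ) :
    ∀ᵐ ξ ∂stackLaw p, inverseLocalTime s (walk ξ) j r ≠ ⊤ := by
  rcases Int.units_eq_one_or s with rfl | rfl
  · exact ae_inverseLocalTime_walk_ne_top hp j r
  · simp only [inverseLocalTime_neg_one_walk]
    exact (measurePreserving_reflect hp).quasiMeasurePreserving.ae
      (ae_inverseLocalTime_walk_ne_top hp (-j) r)

/-- The walk which obeys random stacks has the law of any self-repelling walk. -/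
lemma IsSelfRepellingWalk.map_eq {Ω : Type*} [MeasurableSpace Ω] {μ : Measure Ω}
    [IsProbabilityMeasure μ] {w : ℤ → ℝ} (hw : IsWeight w) {X : ℕ → Ω → ℤ}
    (hX : IsSelfRepellingWalk μ w X) :
    μ.map (fun ω i => X i ω) = (stackLaw (stepProb w 1)).map walk := by
  have : IsProbabilityMeasure (μ.map fun ω i => X i ω) :=
    Measure.isProbabilityMeasure_map (measurable_pi_lambda _ hX.measurable).aemeasurable
  have : IsProbabilityMeasure ((stackLaw (stepProb w 1)).map walk) :=
    Measure.isProbabilityMeasure_map measurable_walk.aemeasurable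
  exact hX.isWalkLaw.unique hw (isWalkLaw_map_walk hw)

end OrientedSelfRepelling

theorem corollary1 {Ω : Type*} [MeasurableSpace Ω] (μ : Measure Ω) [IsProbabilityMeasure μ]
    (w : ℤ → ℝ) (hw : OrientedSelfRepelling.IsWeight w)
    (X : ℕ → Ω → ℤ) (hX : OrientedSelfRepelling.IsSelfRepellingWalk μ w X)
    (x h : ℝ) (hh : 0 < h) (s : ℤˣ) :
    (∀ A : ℝ, 0 < A → ∀ᵐ ω ∂μ,
      OrientedSelfRepelling.inverseLocalTime s (fun i => X i ω) ⌊A * x⌋ ⌊A * h⌋₊ ≠ ⊤) ∧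
    TendstoInMeasure μ
      (fun (A : ℝ) (ω : Ω) => (A ^ 2)⁻¹ *
        ((OrientedSelfRepelling.inverseLocalTime s (fun i => X i ω) ⌊A * x⌋ ⌊A * h⌋₊).toNat : ℝ))
      atTop (fun _ : Ω => (|x| + 2 * h) ^ 2) := by
  have hp := hw.isBias
  have hmX : Measurable fun ω i => X i ω := measurable_pi_lambda _ hX.measurable
  have hlaw := hX.map_eq hw
  have hmw := OrientedSelfRepelling.measurable_walk
  have hmT := fun A : ℝ =>
    OrientedSelfRepelling.measurable_inverseLocalTime s ⌊A * x⌋ ⌊A * h⌋₊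
  constructor
  · intro A _
    have hms := hmT A (MeasurableSet.of_discrete (s := {m : ℕ∞ | m ≠ ⊤}))
    have h1 := (ae_map_iff hmw.aemeasurable hms).2
      (OrientedSelfRepelling.ae_inverseLocalTime_ne_top hp s ⌊A * x⌋ ⌊A * h⌋₊)
    rw [← hlaw] at h1
    exact (ae_map_iff hmX.aemeasurable hms).1 h1
  · have hm : ∀ A : ℝ, Measurable fun q : ℕ → ℤ => edist ((A ^ 2)⁻¹ *
        ((OrientedSelfRepelling.inverseLocalTime s q ⌊A * x⌋ ⌊A * h⌋₊).toNat : ℝ))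
        ((|x| + 2 * h) ^ 2) := fun A =>
      (measurable_from_top (f := fun m : ℕ∞ =>
        edist ((A ^ 2)⁻¹ * (m.toNat : ℝ)) ((|x| + 2 * h) ^ 2))).comp (hmT A)
    refine tendstoInMeasure_of_ne_top fun ε hε hε' => ?_
    have hlim := ENNReal.Tendsto.div_const
      (OrientedSelfRepelling.tendsto_lintegral_inverseLocalTime_walk hp x hh s) (b := ε)
      (Or.inr hε.ne')
    rw [ENNReal.zero_div] at hlim
    refine tendsto_of_tendsto_of_tendsto_of_le_of_le tendsto_const_nhds hlim
      (fun _ => zero_le) fun A => ?_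
    refine (meas_ge_le_lintegral_div ((hm A).comp hmX).aemeasurable hε.ne' hε').trans_eq ?_
    simp only [Function.comp_def]
    rw [← lintegral_map (hm A) hmX, hlaw, lintegral_map (hm A) hmw]
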